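/- Let $\Gamma$ be a Polish space and $\Omega=D([0,\infty);\Gamma)$ the space of càdlàg paths with canonical process $X=(X_t)_{t\ge0}$ and the $\sigma$-algebra generated by the coordinates. Let $L$ be a measure kernel on $\Gamma$ with $\sup_x L(x,\Gamma)<\infty$. For a random kernel $\overline L(\omega,\mathrm dt\,\mathrm dy)=K(\omega,t,\mathrm dy)\,\mathrm dt$ and a probability measure $\mu$ on $\Gamma$, a probability measure $P$ on $\Omega$ *solves* $\mathsf{MP}(\overline L,\mu)$ if $P(X_0\in\cdot)=\mu$, $P$-almost every path is a pure jump path (finitely many jumps in bounded time, constant between jumps), and there is a right-continuous filtration $\mathfrak F$ to which $X$ is adapted such that, up to $P$-null sets, $\overline L((0,t]\times C)$ is $\mathcal F_t$-measurable for all $t\ge 0$ and Borel $C\subset\Gamma$, and for every bounded Borel $\varphi:[0,\infty)\times\Gamma\times\Gamma\to\mathbb R$ the process $$\sum_{s\le t,\;X_s\ne X_{s^-}}\varphi_s(X_{s^-},X_s)-\iint_{(0,t]\times\Gamma}\varphi_s(X_{s^-},y)\,\overline L(\mathrm ds\,\mathrm dy)$$ is a $P$-martingale with respect to $\mathfrak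 F$. For $x\in\Gamma$ let $R^x$ be the law of the Markov jump process with rate $L$ started at $x$, i.e. the solution of $\mathsf{MP}(L(X_{t^-},\mathrm dy)\,\mathrm dt,\delta_x)$. Let $A,B\subset\Gamma$ be nonempty, disjoint and measurable, and $\tau=\inf\{t\ge0:X_t\in A\cup B\}$. Let $n\ge1$, and suppose that the boundary value problem $$\int_\Gamma (h(y)-h(z))\,L(z,\mathrm dy)=0\quad (z\notin A\cup B),\qquad h=\mathbf 1_B+e^{-n}\mathbf 1_A\quad\text{on }A\cup B,$$ has a unique bounded measurable solution $h^n$. Then $e^{-n}\le h^n\le 1$. Put $f^n=-\log h^n\in[0,n]$. For every $x\in\Gamma$ one has $\tau<\infty$ $R^x$-almost surely, and: (i) Among all probability measures $Q$ on $\Omega$, the cost $\mathsf E_Q[f^n(X_\tau)+\log\frac{\mathrm dQ}{\mathrm dR^x}]$ (which is $+\infty$ unless $Q\ll R^x$) has the unique minimizer $$P^{n,x}=\frac{h^n(X_\tau)}{h^n(x)}\,R^x=\int_\Gamma R^{x,X_\tau=\eta}\,\frac{h^n(\eta)}{h^n(x)}\,R^x_\tau(\mathrm d\eta),$$ where $R^x_\tau$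 is the law of $X_\tau$ under $R^x$ and $R^{x,X_\tau=\eta}$ is any version of the conditional law of $R^x$ given $X_\tau=\eta$; $P^{n,x}$ is a probability measure. (ii) The infimum of this cost over all probability measures $Q$ on $\Omega$ equals $-\log h^n(x)$. (iii) Up to time $\tau$, $P^{n,x}$ solves the martingale problem with the Doob-transformed kernel: the law under $P^{n,x}$ of the stopped process $(X_{t\wedge\tau})_{t\ge0}$ solves $\mathsf{MP}(\overline L^n,\delta_x)$ with $$\overline L^n(\omega,\mathrm dt\,\mathrm dy)=\mathbf 1_{[0,\tau)}(t)\,\frac{h^n(y)}{h^n(X_{t^-})}\,L(X_{t^-},\mathrm dy)\,\mathrm dt,$$ and $P^{n,x}$ itself solves $\mathsf{MP}(\overline L^n+\mathbf 1_{[\tau,\infty)}(t)\,L(X_{t^-},\mathrm dy)\,\mathrm dt,\;\delta_x)$. -/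

import Mathlib

open MeasureTheory ProbabilityTheory Filter Topology Set
open scoped NNReal ENNReal

noncomputable section

namespace JumpControl

/-! ### Path space -/

/-- Right-continuous with left limits on `[0, ∞)` (at time `0` the left limit is no condition). -/
def IsCadlag {Γ : Type*} [TopologicalSpace Γ] (w : ℝ≥0 → Γ) : Prop :=
  ∀ t, ContinuousWithinAt w (Ici t) t ∧ ∃ y, Tendsto w (𝓝[<] t) (𝓝 y)

/-- The Skorokhod space `D([0, ∞); Γ)`. As a subtype of `ℝ≥0 → Γ` it carries the σ-algebra
generated by the coordinates `X_t`. -/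
abbrev PathSpace (Γ : Type*) [TopologicalSpace Γ] : Type _ :=
  {w : ℝ≥0 → Γ // IsCadlag w}

/-- The canonical process `X_t(ω) = ω_t`. -/
def canon {Γ : Type*} [TopologicalSpace Γ] (t : ℝ≥0) (ω : PathSpace Γ) : Γ := ω.1 t

/-- The left limit `X_{t-}`, with `X_{0-} = X_0`. -/
def canonLeft {Γ : Type*} [TopologicalSpace Γ] (t : ℝ≥0) (ω : PathSpace Γ) : Γ :=
  Function.leftLim ω.1 t

/-- The set `𝒯_t` of jump times in `[0, t]` (time `0` is never one, as `X_{0-} = X_0`). -/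
def jumpTimes {Γ : Type*} [TopologicalSpace Γ] (t : ℝ≥0) (ω : PathSpace Γ) : Set ℝ≥0 :=
  {s | s ≤ t ∧ canon s ω ≠ canonLeft s ω}

/-- Pure jump (step) paths: constant on a right and on a left neighbourhood of every time, that is,
finitely many jumps in bounded time and constant between successive jumps. -/
def IsPureJump {Γ : Type*} (w : ℝ≥0 → Γ) : Prop :=
  ∀ t, (∀ᶠ s in 𝓝[>] t, w s = w t) ∧ ∃ y, ∀ᶠ s in 𝓝[<] t, w s = y

/-! ### The martingale problem -/

/-- `∑_{s ∈ 𝒯_t} φ_s(X_{s-}, X_s) - ∬_{(0,t] × Γ} φ_s(X_{s-}, y) K(ω, s, dy) ds`, where the Lévy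
kernel is `K(ω, s, dy) ds`. -/
def compensatedSum {Γ : Type*} [TopologicalSpace Γ] [MeasurableSpace Γ]
    (K : PathSpace Γ → ℝ≥0 → Measure Γ) (φ : ℝ≥0 × Γ × Γ → ℝ) (t : ℝ≥0) (ω : PathSpace Γ) : ℝ :=
  (∑' s : jumpTimes t ω, φ ((s : ℝ≥0), canonLeft (s : ℝ≥0) ω, canon (s : ℝ≥0) ω)) -
    ∫ s in Ioc (0 : ℝ) (t : ℝ),
      ∫ y, φ (s.toNNReal, canonLeft s.toNNReal ω, y) ∂(K ω s.toNNReal)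

/-- `P` solves the martingale problem with Lévy kernel `K(ω, t, dy) dt` and initial law `μ`, among
laws of jump processes (almost surely pure jump paths).
Measurability with respect to the `P`-completion of `𝔉` is expressed by passing to a version:
`AEStronglyMeasurable[𝔉 t]` for the predictability of the kernel, and a martingale `M`
with `M_t` almost surely equal to the compensated sum of jumps for the martingale property. -/
def SolvesMartingaleProblem {Γ : Type*} [TopologicalSpace Γ] [MeasurableSpace Γ]
    (P : Measure (PathSpace Γ)) (K : PathSpace Γ → ℝ≥0 → Measure Γ) (μ : Measure Γ) : Prop :=
  IsProbabilityMeasure P ∧ P.map (canon 0) = μ ∧ (∀ᵐ ω ∂P, IsPureJump ω.1) ∧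
  ∃ 𝔉 : Filtration ℝ≥0 (inferInstance : MeasurableSpace (PathSpace Γ)),
    𝔉.IsRightContinuous ∧
    (∀ t, Measurable[𝔉 t] (canon t : PathSpace Γ → Γ)) ∧
    (∀ (t : ℝ≥0) (C : Set Γ), MeasurableSet C →
      AEStronglyMeasurable[𝔉 t]
        (fun ω => ∫⁻ s in Ioc (0 : ℝ) (t : ℝ), K ω s.toNNReal C) P) ∧
    ∀ φ : ℝ≥0 × Γ × Γ → ℝ, Measurable φ → (∃ C : ℝ, ∀ z, |φ z| ≤ C) →
      ∃ M : ℝ≥0 → PathSpace Γ → ℝ,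
        Martingale M 𝔉 P ∧ ∀ t, M t =ᵐ[P] compensatedSum K φ t

/-- The Lévy kernel `L(X_{t-}, dy) dt` of the reference process. -/
def refKernel {Γ : Type*} [TopologicalSpace Γ] [MeasurableSpace Γ] (L : Kernel Γ Γ) :
    PathSpace Γ → ℝ≥0 → Measure Γ :=
  fun ω t => L (canonLeft t ω)

/-! ### Hitting time and committor problem -/

/-- `τ_{AB} = inf {t ≥ 0 : X_t ∈ A ∪ B}`, equal to `⊤` if `A ∪ B` is never hit. -/
def hitTime {Γ : Type*} [TopologicalSpace Γ] (A B : Set Γ) : PathSpace Γ → WithTop ℝ≥0 :=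
  hittingAfter canon (A ∪ B) 0

/-- `X_{τ_{AB}}` (an arbitrary value on `{τ_{AB} = ∞}`). -/
def hitValue {Γ : Type*} [TopologicalSpace Γ] (A B : Set Γ) : PathSpace Γ → Γ :=
  stoppedValue canon (hitTime A B)

/-- `h` is a bounded measurable solution of the boundary value problem
`∫ (h(y) - h(x)) L(x, dy) = 0` off `A ∪ B`, and `h = 1_B + ε 1_A` on `A ∪ B`. -/
structure IsBVPSolution {Γ : Type*} [MeasurableSpace Γ] (L : Kernel Γ Γ) (A B : Set Γ) (ε : ℝ)
    (h : Γ → ℝ) : Prop where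
  measurable : Measurable h
  bounded : ∃ C : ℝ, ∀ x, |h x| ≤ C
  harmonic : ∀ x, x ∉ A ∪ B → ∫ y, (h y - h x) ∂(L x) = 0
  boundary : ∀ x ∈ A ∪ B,
    h x = B.indicator (fun _ => (1 : ℝ)) x + ε * A.indicator (fun _ => (1 : ℝ)) x

/-- `h` is the unique bounded measurable solution of the boundary value problem. -/
def IsUniqueBVPSolution {Γ : Type*} [MeasurableSpace Γ] (L : Kernel Γ Γ) (A B : Set Γ) (ε : ℝ)
    (h : Γ → ℝ) : Prop :=
  IsBVPSolution L A B ε h ∧ ∀ g, IsBVPSolution L A B ε g → g = h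

/-! ### The control problem -/

/-- The terminal cost `f = -log h`, for `0 < h ≤ 1`. -/
def termCost {Γ : Type*} (h : Γ → ℝ) (y : Γ) : ℝ≥0∞ := ENNReal.ofReal (-Real.log (h y))

/-- The cost `E_Q[f(X_τ) + log (dQ/dR)]` in `[0, ∞]`, with `f ≥ 0`; the second term is the relative
entropy of `Q` with respect to `R`, which is `∞` unless `Q ≪ R`. -/
def pathCost {Γ : Type*} [TopologicalSpace Γ] [MeasurableSpace Γ] (A B : Set Γ) (f : Γ → ℝ≥0∞)
    (R Q : Measure (PathSpace Γ)) : ℝ≥0∞ :=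
  (∫⁻ ω, f (hitValue A B ω) ∂Q) + InformationTheory.klDiv Q R

/-- The value function: the infimum of the cost over all probability measures on path space. -/
def valueFunction {Γ : Type*} [TopologicalSpace Γ] [MeasurableSpace Γ] (A B : Set Γ) (f : Γ → ℝ≥0∞)
    (R : Measure (PathSpace Γ)) : ℝ≥0∞ :=
  ⨅ Q : ProbabilityMeasure (PathSpace Γ), pathCost A B f R (Q : Measure (PathSpace Γ))

/-- `P` is the unique minimizer of `J` among probability measures. -/
def IsUniqueMinimizer {Ω : Type*} [MeasurableSpace Ω] (J : Measure Ω → ℝ≥0∞) (P : Measure Ω) :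
    Prop :=
  IsProbabilityMeasure P ∧
    (∀ Q : Measure Ω, IsProbabilityMeasure Q → J P ≤ J Q) ∧
    ∀ Q : Measure Ω, IsProbabilityMeasure Q → J Q ≤ J P → Q = P

/-- The path measure `(h(X_τ) / h(x)) R`. -/
def doobMeasure {Γ : Type*} [TopologicalSpace Γ] [MeasurableSpace Γ] (A B : Set Γ) (h : Γ → ℝ)
    (x : Γ) (R : Measure (PathSpace Γ)) : Measure (PathSpace Γ) :=
  R.withDensity (fun ω => ENNReal.ofReal (h (hitValue A B ω) / h x))

/-- `κ η` is a version of the conditional law `R(· | Y = η)`, through the disintegration of the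
joint law of `Y` and the identity. -/
def IsConditionalLaw {Ω Γ : Type*} [MeasurableSpace Ω] [MeasurableSpace Γ] (R : Measure Ω)
    (Y : Ω → Γ) (κ : Kernel Γ Ω) : Prop :=
  IsMarkovKernel κ ∧ R.map (fun ω => (Y ω, ω)) = (R.map Y) ⊗ₘ κ

/-! ### The controlled kernels -/

/-- `(h(y) / h(x)) L(x, dy)`. -/
def doobRate {Γ : Type*} [MeasurableSpace Γ] (L : Kernel Γ Γ) (h : Γ → ℝ) (x : Γ) : Measure Γ :=
  (L x).withDensity (fun y => ENNReal.ofReal (h y / h x))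

open Classical in
/-- The Lévy kernel `1_{[0, τ)}(t) (h(y) / h(X_{t-})) L(X_{t-}, dy) dt`. -/
def doobKernel {Γ : Type*} [TopologicalSpace Γ] [MeasurableSpace Γ] (L : Kernel Γ Γ) (A B : Set Γ)
    (h : Γ → ℝ) : PathSpace Γ → ℝ≥0 → Measure Γ :=
  fun ω t => if (t : WithTop ℝ≥0) < hitTime A B ω then doobRate L h (canonLeft t ω) else 0

open Classical in
/-- The Lévy kernel
`(1_{[0, τ)}(t) (h(y) / h(X_{t-})) + 1_{[τ, ∞)}(t)) L(X_{t-}, dy) dt`. -/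
def doobKernelThenRef {Γ : Type*} [TopologicalSpace Γ] [MeasurableSpace Γ] (L : Kernel Γ Γ)
    (A B : Set Γ) (h : Γ → ℝ) : PathSpace Γ → ℝ≥0 → Measure Γ :=
  fun ω t => if (t : WithTop ℝ≥0) < hitTime A B ω then doobRate L h (canonLeft t ω)
    else L (canonLeft t ω)

/-! ### The path stopped at the hitting time -/

theorem isCadlag_min {Γ : Type*} [TopologicalSpace Γ] {w : ℝ≥0 → Γ} (hw : IsCadlag w) (r : ℝ≥0) :
    IsCadlag (fun t => w (min t r)) := by
  intro t
  rcases lt_or_ge t r with htr | htr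
  · have hev : ∀ᶠ s in 𝓝 t, w s = w (min s r) := by
      filter_upwards [Iio_mem_nhds htr] with s hs
      rw [min_eq_left (le_of_lt hs)]
    refine ⟨?_, ?_⟩
    · refine (hw t).1.congr_of_eventuallyEq ?_ ?_
      · filter_upwards [mem_nhdsWithin_of_mem_nhds hev] with s hs using hs.symm
      · simp [min_eq_left htr.le]
    · obtain ⟨y, hy⟩ := (hw t).2
      exact ⟨y, hy.congr' (mem_nhdsWithin_of_mem_nhds hev)⟩
  · refine ⟨?_, ?_⟩
    · refine (continuousWithinAt_const (b := w r)).congr ?_ ?_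
      · intro s hs
        simp only [min_eq_right (htr.trans hs)]
      · simp only [min_eq_right htr]
    · rcases htr.eq_or_lt with rfl | h
      · obtain ⟨y, hy⟩ := (hw r).2
        refine ⟨y, hy.congr' ?_⟩
        filter_upwards [self_mem_nhdsWithin] with s hs
        rw [min_eq_left (le_of_lt hs)]
      · refine ⟨w r, tendsto_const_nhds.congr' ?_⟩
        filter_upwards [mem_nhdsWithin_of_mem_nhds (Ioi_mem_nhds h)] with s hs
        rw [min_eq_right (le_of_lt hs)]

theorem isCadlag_stopped {Γ : Type*} [TopologicalSpace Γ] (A B : Set Γ) (ω : PathSpace Γ) :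
    IsCadlag (fun t => stoppedProcess canon (hitTime A B) t ω) := by
  rcases h : hitTime A B ω with _ | r
  · have : (fun t => stoppedProcess canon (hitTime A B) t ω) = ω.1 := by
      funext t
      have hm : min (t : WithTop ℝ≥0) (hitTime A B ω) = t := by rw [h]; exact min_eq_left le_top
      change ω.1 (min (t : WithTop ℝ≥0) (hitTime A B ω)).untopA = ω.1 t
      exact congrArg (fun z : WithTop ℝ≥0 => ω.1 z.untopA) hm
    rw [this]
    exact ω.2
  · have : (fun t => stoppedProcess canon (hitTime A B) t ω) = fun t => ω.1 (min t r) := by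
      funext t
      have hm : min (t : WithTop ℝ≥0) (hitTime A B ω) = ((min t r : ℝ≥0) : WithTop ℝ≥0) := by
        rw [h]; exact (WithTop.coe_min t r).symm
      change ω.1 (min (t : WithTop ℝ≥0) (hitTime A B ω)).untopA = ω.1 (min t r)
      exact congrArg (fun z : WithTop ℝ≥0 => ω.1 z.untopA) hm
    rw [this]
    exact isCadlag_min ω.2 r

/-- The path `t ↦ X_{t ∧ τ}` stopped at the hitting time. -/
def stopPath {Γ : Type*} [TopologicalSpace Γ] (A B : Set Γ) (ω : PathSpace Γ) : PathSpace Γ :=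
  ⟨fun t => stoppedProcess canon (hitTime A B) t ω, isCadlag_stopped A B ω⟩

end JumpControl

end

/-! Write E for A ∪ B, R for the reference law and w for a bounded function on the state space. The
martingale problem is used in the form of a compensation formula: for nonnegative predictable H, the
mean of the sum of H_s(X_s) over the jumps equals the mean of the integral of H_s(y) against
L(X_{s-}, dy) ds (`CompensationFormula`). The martingale property gives it on sets (r, ∞) × F × C
with F known at time r, and a monotone class argument does the rest. Conversely, a compensation
formula for bounded predictable H gives back the martingale problem
(`solvesMartingaleProblem_of_compensation`). Since a pure jump path is the sum of its jumps, the
formula contains Dynkin's formula for w(X_{t∧τ}) (`dynkin`), and functions harmonic off E give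
martingales of the stopped process.

Uniqueness of h is used twice, both times through monotone iteration of 1 + L/l, where l bounds the
jump rates. Started at e^{-n}, the iteration converges to a solution with values in [e^{-n}, 1],
which must be h. With zero boundary values, the iterates w_k decrease to a solution of the
homogeneous problem; adding it to h gives another solution, so it is zero. Now p = R(τ = ∞) is at
most the mean of w_k(X_{t∧τ}) for all k and t: if this failed first at k + 1, Dynkin's formula would
make the mean of w_k(X_{t∧τ}) drift below zero. At t = 0 this reads p ≤ w_k(x) → 0. Only the single
law R is involved; no Markov property is needed.

As τ is finite, the bounded martingale h(X_{t∧τ}) is closed by h(X_τ), so h(X_τ)/h(x) is a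
probability density with density process h(X_{t∧τ})/h(x). With f = -log h it is the Gibbs density
for the cost, and cost(Q) = -log h(x) + KL(Q | P) for every Q (`lintegral_neg_log_add_klDiv`). This
gives the minimizer, its uniqueness and the value. The density depends on X_τ alone, so the
conditional laws given X_τ are those of R.

For the martingale problems, put w = h/h(x). Under the new law a jump at time s is weighted by
w(X_{s∧τ}) and the rate by the left limit of this process. The latter is predictable, so the
compensation formula under R applies, and the quotient of the two weights is the Doob ratio up to τ
and 1 afterwards (`compensation_withDensity`). The stopped law is reached by pulling predictable
integrands back along the stopping map.

The hitting time of a merely measurable set is tractable because a pure jump path stays for a while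
in each state that it enters: a countable dense set of times detects the hit. The map `denseStop`
built on this is measurable and agrees with stopping at τ on pure jump paths. -/

noncomputable section

set_option linter.unusedSectionVars false

namespace JumpControl

/-! ### Pure jump paths -/

section Paths

variable {Γ : Type*} [TopologicalSpace Γ]

/-- The times at which a path differs from its left limit. -/
def jumpSet (p : ℝ≥0 → Γ) : Set ℝ≥0 := {u | p u ≠ Function.leftLim p u}

/-- The sum of `f` over all the jump times of `p`. -/
def jumpSum (p : ℝ≥0 → Γ) (f : ℝ≥0 → ℝ≥0∞) : ℝ≥0∞ := ∑' u, (jumpSet p).indicator f u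

theorem zero_notMem_jumpSet (p : ℝ≥0 → Γ) : (0 : ℝ≥0) ∉ jumpSet p := by
  have h : 𝓝[<] (0 : ℝ≥0) = ⊥ := by simp
  simp [jumpSet, leftLim_eq_of_eq_bot p h]

theorem pos_of_mem_jumpSet {p : ℝ≥0 → Γ} {u : ℝ≥0} (h : u ∈ jumpSet p) : 0 < u := by
  rcases eq_or_ne u 0 with rfl | hu
  · exact absurd h (zero_notMem_jumpSet p)
  · exact pos_iff_ne_zero.2 hu

theorem jumpSum_add (p : ℝ≥0 → Γ) (f g : ℝ≥0 → ℝ≥0∞) :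
    jumpSum p (fun u => f u + g u) = jumpSum p f + jumpSum p g := by
  rw [jumpSum, jumpSum, jumpSum, ← ENNReal.tsum_add]
  congr 1
  funext u
  exact congrFun (indicator_add (jumpSet p) f g) u

theorem jumpSum_congr {p : ℝ≥0 → Γ} {f g : ℝ≥0 → ℝ≥0∞} (h : ∀ u ∈ jumpSet p, f u = g u) :
    jumpSum p f = jumpSum p g := by
  unfold jumpSum
  congr 1
  exact indicator_congr h

theorem jumpSum_mono {p : ℝ≥0 → Γ} {f g : ℝ≥0 → ℝ≥0∞} (h : ∀ u ∈ jumpSet p, f u ≤ g u) :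
    jumpSum p f ≤ jumpSum p g :=
  ENNReal.tsum_le_tsum fun u => by
    by_cases hu : u ∈ jumpSet p
    · simpa [hu] using h u hu
    · simp [hu]

theorem jumpSum_zero (p : ℝ≥0 → Γ) : jumpSum p (fun _ => 0) = 0 := by simp [jumpSum]

theorem jumpSum_const_mul (p : ℝ≥0 → Γ) (c : ℝ≥0∞) (f : ℝ≥0 → ℝ≥0∞) :
    jumpSum p (fun u => c * f u) = c * jumpSum p f := by
  rw [jumpSum, jumpSum, ← ENNReal.tsum_mul_left]
  congr 1
  funext u
  by_cases hu : u ∈ jumpSet p <;> simp [hu]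

theorem jumpSum_tsum {ι : Type*} (p : ℝ≥0 → Γ) (f : ι → ℝ≥0 → ℝ≥0∞) :
    jumpSum p (fun u => ∑' i, f i u) = ∑' i, jumpSum p (f i) := by
  unfold jumpSum
  rw [ENNReal.tsum_comm]
  congr 1
  funext u
  by_cases hu : u ∈ jumpSet p <;> simp [hu]

theorem jumpSum_Ioc_add (p : ℝ≥0 → Γ) {a b c : ℝ≥0} (hab : a ≤ b) (hbc : b ≤ c)
    (f : ℝ≥0 → ℝ≥0∞) :
    jumpSum p ((Ioc a b).indicator f) + jumpSum p ((Ioc b c).indicator f) =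
      jumpSum p ((Ioc a c).indicator f) := by
  rw [← jumpSum_add]
  congr 1
  rw [← Ioc_union_Ioc_eq_Ioc hab hbc, indicator_union_of_disjoint]
  exact Set.disjoint_left.2 fun u hu hu' => absurd hu'.1 (not_lt.2 hu.2)

variable [T2Space Γ] {p : ℝ≥0 → Γ}

theorem leftLim_eq_of_eventually {t : ℝ≥0} (ht : 0 < t) {y : Γ}
    (h : ∀ᶠ s in 𝓝[<] t, p s = y) : Function.leftLim p t = y := by
  have : (𝓝[<] t).NeBot := nhdsLT_neBot_of_exists_lt ⟨0, ht⟩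
  exact leftLim_eq_of_tendsto (tendsto_const_nhds.congr' (h.mono fun _ hs => hs.symm))

theorem IsPureJump.eventually_left (hp : IsPureJump p) (t : ℝ≥0) :
    ∀ᶠ s in 𝓝[<] t, p s = Function.leftLim p t := by
  rcases eq_or_ne t 0 with rfl | ht
  · simp
  · obtain ⟨y, hy⟩ := (hp t).2
    rwa [leftLim_eq_of_eventually (pos_iff_ne_zero.2 ht) hy]

/-- One-sided constancy near t makes the path constant on a full neighbourhood of every nearby s ≠
t, and such an s is not a jump time. -/
theorem IsPureJump.eventually_notMem_jumpSet (hp : IsPureJump p) (t : ℝ≥0) :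
    ∀ᶠ s in 𝓝[≠] t, s ∉ jumpSet p := by
  have key : ∀ (s : ℝ≥0) (c : Γ), 0 < s → (∀ᶠ r in 𝓝 s, p r = c) → s ∉ jumpSet p := by
    intro s c hs h
    simp only [jumpSet, mem_ofPred_eq, not_not]
    rw [leftLim_eq_of_eventually hs (mem_nhdsWithin_of_mem_nhds h), h.self_of_nhds]
  have hr : ∀ᶠ s in 𝓝[>] t, s ∉ jumpSet p := by
    have := eventually_eventually_nhdsWithin.2 (hp t).1
    filter_upwards [this, self_mem_nhdsWithin] with s hs hts
    rw [IsOpen.nhdsWithin_eq isOpen_Ioi hts] at hs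
    exact key s _ (lt_of_le_of_lt (zero_le) hts) hs
  have hl : ∀ᶠ s in 𝓝[<] t, s ∉ jumpSet p := by
    have := eventually_eventually_nhdsWithin.2 (hp.eventually_left t)
    filter_upwards [this, self_mem_nhdsWithin] with s hs hts
    rw [IsOpen.nhdsWithin_eq isOpen_Iio hts] at hs
    rcases eq_or_ne s 0 with rfl | h0
    · exact zero_notMem_jumpSet p
    · exact key s _ (pos_iff_ne_zero.2 h0) hs
  rw [← nhdsLT_sup_nhdsGT, eventually_sup]
  exact ⟨hl, hr⟩

/-- Jump times do not accumulate, and [0, t] is compact. -/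
theorem IsPureJump.finite_jumpSet (hp : IsPureJump p) (t : ℝ≥0) :
    (jumpSet p ∩ Iic t).Finite := by
  have : (jumpSet p ∩ Icc 0 t).Finite := by
    refine (isCompact_Icc (a := (0 : ℝ≥0)) (b := t)).induction_on
      (p := fun s => (jumpSet p ∩ s).Finite) (by simp)
      (fun s s' hs h => h.subset (inter_subset_inter_right _ hs))
      (fun s s' h h' => by rw [inter_union_distrib_left]; exact h.union h') ?_
    intro x _
    have h := eventually_nhdsWithin_iff.1 (hp.eventually_notMem_jumpSet x)
    refine ⟨_, mem_nhdsWithin_of_mem_nhds h, (finite_singleton x).subset ?_⟩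
    rintro s ⟨hs, hs'⟩
    by_contra hne
    exact hs' hne hs
  refine this.subset ?_
  rintro s ⟨h1, h2⟩
  exact ⟨h1, zero_le, h2⟩

/-- Without a jump in (a, b] the path is locally constant on the connected interval [a, b]. -/
theorem IsPureJump.eq_of_forall_notMem (hp : IsPureJump p) {a b : ℝ≥0}
    (h : ∀ u ∈ Ioc a b, u ∉ jumpSet p) {u : ℝ≥0} (hu : u ∈ Icc a b) : p u = p a := by
  have hpre : PreconnectedSpace (Icc a b) := Subtype.preconnectedSpace isPreconnected_Icc
  have hloc : IsLocallyConstant (fun x : Icc a b => p x) := by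
    rw [IsLocallyConstant.iff_eventually_eq]
    rintro ⟨x, hx⟩
    rw [eventually_nhds_subtype_iff (Icc a b) ⟨x, hx⟩ (fun y => p y = p x)]
    have h1 := eventually_nhdsWithin_iff.1 (hp x).1
    have h2 := eventually_nhdsWithin_iff.1 (hp.eventually_left x)
    rw [eventually_nhdsWithin_iff]
    filter_upwards [h1, h2] with s hs1 hs2 hs
    rcases lt_trichotomy s x with hsx | rfl | hsx
    · have : x ∉ jumpSet p := h x ⟨lt_of_le_of_lt hs.1 hsx, hx.2⟩
      simp only [jumpSet, mem_ofPred_eq, not_not] at this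
      rw [hs2 hsx, this]
    · rfl
    · exact hs1 hsx
  exact hloc.apply_eq_of_preconnectedSpace ⟨u, hu⟩ ⟨a, ⟨le_rfl, hu.1.trans hu.2⟩⟩

/-- A single jump in (c, d] goes from p c to p d, because the path is constant before and after it;
without a jump both sides vanish, G being zero on the diagonal. -/
theorem IsPureJump.jumpSum_Ioc_of_subsingleton (hp : IsPureJump p) {c d : ℝ≥0} (hcd : c ≤ d)
    (h : ∀ u ∈ Ioc c d, ∀ v ∈ Ioc c d, u ∈ jumpSet p → v ∈ jumpSet p → u = v)
    {G : Γ → Γ → ℝ≥0∞} (hG : ∀ x, G x x = 0) :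
    jumpSum p ((Ioc c d).indicator fun u => G (Function.leftLim p u) (p u)) = G (p c) (p d) := by
  by_cases hj : ∃ u ∈ Ioc c d, u ∈ jumpSet p
  · obtain ⟨u, hu, huj⟩ := hj
    have hleft : Function.leftLim p u = p c := by
      refine leftLim_eq_of_eventually (lt_of_le_of_lt zero_le hu.1) ?_
      filter_upwards [Ioo_mem_nhdsLT hu.1] with s hs
      refine hp.eq_of_forall_notMem (b := s) ?_ ⟨hs.1.le, le_rfl⟩
      intro v hv hvj
      have := h u hu v ⟨hv.1, hv.2.trans (hs.2.le.trans hu.2)⟩ huj hvj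
      exact absurd (hv.2.trans_lt hs.2) (by simp [this])
    have hright : p d = p u := by
      refine hp.eq_of_forall_notMem (b := d) ?_ ⟨hu.2, le_rfl⟩
      intro v hv hvj
      have := h u hu v ⟨hu.1.trans hv.1, hv.2⟩ huj hvj
      exact absurd hv.1 (by simp [this])
    rw [jumpSum, tsum_eq_single u]
    · simp [huj, hu.1, hu.2, hleft, hright]
    · intro v hv
      by_cases hvj : v ∈ jumpSet p
      · by_cases hv' : v ∈ Ioc c d
        · exact absurd (h u hu v hv' huj hvj).symm hv
        · rw [indicator_of_mem hvj, indicator_of_notMem hv']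
      · rw [indicator_of_notMem hvj]
  · push Not at hj
    rw [hp.eq_of_forall_notMem hj ⟨hcd, le_rfl⟩, hG, jumpSum, ENNReal.tsum_eq_zero]
    intro v
    by_cases hvj : v ∈ jumpSet p
    · rw [indicator_of_mem hvj, indicator_of_notMem (fun h => hj v h hvj)]
    · rw [indicator_of_notMem hvj]

theorem IsPureJump.jumpSum_eq_sum (hp : IsPureJump p) {f : ℝ≥0 → ℝ≥0∞} {t : ℝ≥0}
    (hf : ∀ u, t < u → f u = 0) :
    jumpSum p f = ∑ u ∈ (hp.finite_jumpSet t).toFinset, f u := by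
  rw [jumpSum, tsum_eq_sum (s := (hp.finite_jumpSet t).toFinset)]
  · refine Finset.sum_congr rfl fun u hu => ?_
    rw [Finite.mem_toFinset] at hu
    rw [indicator_of_mem hu.1]
  · intro u hu
    rw [Finite.mem_toFinset] at hu
    by_cases hj : u ∈ jumpSet p
    · rw [indicator_of_mem hj, hf u]
      by_contra! h
      exact hu ⟨hj, h⟩
    · rw [indicator_of_notMem hj]

/-- The `j`-th point of the partition of `[a, t]` into `k` intervals of equal length. -/
def gridPt (a t : ℝ≥0) (k j : ℕ) : ℝ≥0 := a + (t - a) * (j / k)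

theorem gridPt_mono (a t : ℝ≥0) (k : ℕ) : Monotone (gridPt a t k) := by
  intro i j hij
  unfold gridPt
  gcongr

theorem gridPt_zero (a t : ℝ≥0) (k : ℕ) : gridPt a t k 0 = a := by simp [gridPt]

theorem gridPt_self {a t : ℝ≥0} (hat : a ≤ t) {k : ℕ} (hk : k ≠ 0) : gridPt a t k k = t := by
  have : (k : ℝ≥0) ≠ 0 := by exact_mod_cast hk
  simp [gridPt, div_self this, add_tsub_cancel_of_le hat]

theorem gridPt_le {a t : ℝ≥0} (hat : a ≤ t) {k j : ℕ} (hj : j ≤ k) : gridPt a t k j ≤ t := by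
  rcases eq_or_ne k 0 with rfl | hk
  · simpa [gridPt] using hat
  · exact (gridPt_mono a t k hj).trans (gridPt_self hat hk).le

theorem gridPt_succ (a t : ℝ≥0) (k j : ℕ) :
    gridPt a t k (j + 1) = gridPt a t k j + (t - a) / k := by
  simp only [gridPt]
  push_cast
  ring

/-- Along fine partitions the sum of the increments is the sum over the jumps. -/
theorem IsPureJump.eventually_sum_grid (hp : IsPureJump p) {a t : ℝ≥0} (hat : a ≤ t)
    {G : Γ → Γ → ℝ≥0∞} (hG : ∀ x, G x x = 0) :
    ∀ᶠ k : ℕ in atTop, ∑ j ∈ Finset.range k, G (p (gridPt a t k j)) (p (gridPt a t k (j + 1))) =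
      jumpSum p ((Ioc a t).indicator fun u => G (Function.leftLim p u) (p u)) := by
  have hfin := hp.finite_jumpSet t
  -- The mesh (t - a)/k is eventually smaller than every gap between the finitely many jump times,
  -- so each cell contains at most one jump.
  have hsep : ∀ᶠ k : ℕ in atTop, ∀ u ∈ jumpSet p ∩ Iic t, ∀ v ∈ jumpSet p ∩ Iic t,
      u < v → u + (t - a) / k < v := by
    rw [hfin.eventually_all]
    intro u hu
    rw [hfin.eventually_all]
    intro v hv
    by_cases huv : u < v
    · have : Tendsto (fun k : ℕ => u + (t - a) / (k : ℝ≥0)) atTop (𝓝 (u + 0)) :=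
        tendsto_const_nhds.add (tendsto_const_div_atTop_nhds_zero_nat _)
      rw [add_zero] at this
      filter_upwards [this.eventually_lt_const huv] with k hk _ using hk
    · exact Eventually.of_forall fun k h => absurd h huv
  filter_upwards [hsep, eventually_ne_atTop 0] with k hk hk0
  have main : ∀ N ≤ k,
      ∑ j ∈ Finset.range N, G (p (gridPt a t k j)) (p (gridPt a t k (j + 1))) =
        jumpSum p ((Ioc a (gridPt a t k N)).indicator
          fun u => G (Function.leftLim p u) (p u)) := by
    intro N
    induction N with
    | zero => intro _; simp [gridPt_zero, jumpSum]
    | succ N ih =>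
      intro hN
      have h1 : a ≤ gridPt a t k N := by
        simpa [gridPt_zero] using gridPt_mono a t k (Nat.zero_le N)
      have h2 := gridPt_mono a t k (Nat.le_succ N)
      rw [Finset.sum_range_succ, ih (by lia), ← jumpSum_Ioc_add p h1 h2,
        hp.jumpSum_Ioc_of_subsingleton h2 ?_ hG]
      have key : ∀ u ∈ Ioc (gridPt a t k N) (gridPt a t k (N + 1)),
          ∀ v ∈ Ioc (gridPt a t k N) (gridPt a t k (N + 1)), u ∈ jumpSet p → v ∈ jumpSet p →
          ¬ u < v := by
        intro u hu v hv huj hvj huv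
        have ht := gridPt_le hat hN
        have := hk u ⟨huj, hu.2.trans ht⟩ v ⟨hvj, hv.2.trans ht⟩ huv
        have h3 := hv.2
        rw [gridPt_succ] at h3
        exact absurd (this.trans_le h3) (not_lt.2 (by gcongr; exact hu.1.le))
      intro u hu v hv huj hvj
      exact le_antisymm (not_lt.1 (key v hv u hu hvj huj)) (not_lt.1 (key u hu v hv huj hvj))
  rw [main k le_rfl, gridPt_self hat hk0]

/-- A function of the path is the sum of its jumps, in subtraction-free form. -/
theorem IsPureJump.add_jumpSum_left (hp : IsPureJump p) {a t : ℝ≥0} (hat : a ≤ t)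
    (f : Γ → ℝ≥0∞) :
    f (p t) + jumpSum p ((Ioc a t).indicator fun u => f (Function.leftLim p u)) =
      f (p a) + jumpSum p ((Ioc a t).indicator fun u => f (p u)) := by
  classical
  -- The increment functions are set to zero on the diagonal, as the grid lemma requires; this is
  -- harmless at jump times. The identity then telescopes along a fine enough grid.
  have h1 := hp.eventually_sum_grid hat (G := fun x y => if x = y then 0 else f x) (by simp)
  have h2 := hp.eventually_sum_grid hat (G := fun x y => if x = y then 0 else f y) (by simp)
  obtain ⟨k, hk1, hk2, hk0⟩ := (h1.and (h2.and (eventually_ne_atTop 0))).exists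
  have e : ∀ g : ℝ≥0 → ℝ≥0∞, jumpSum p ((Ioc a t).indicator fun u =>
      if Function.leftLim p u = p u then 0 else g u) = jumpSum p ((Ioc a t).indicator g) := by
    intro g
    refine jumpSum_congr fun u hu => ?_
    by_cases h : u ∈ Ioc a t
    · simp only [indicator_of_mem h, if_neg (Ne.symm hu)]
    · simp only [indicator_of_notMem h]
  rw [e] at hk1 hk2
  rw [← hk1, ← hk2]
  have main : ∀ N, f (p (gridPt a t k N)) + ∑ j ∈ Finset.range N,
      (if p (gridPt a t k j) = p (gridPt a t k (j + 1)) then 0 else f (p (gridPt a t k j))) =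
      f (p a) + ∑ j ∈ Finset.range N, (if p (gridPt a t k j) = p (gridPt a t k (j + 1)) then 0
        else f (p (gridPt a t k (j + 1)))) := by
    intro N
    induction N with
    | zero => simp [gridPt_zero]
    | succ N ih =>
      rw [Finset.sum_range_succ, Finset.sum_range_succ]
      split_ifs with h
      · rw [add_zero, add_zero, ← h, ih]
      · rw [← add_assoc (f (p a)), ← ih]
        ring
  simpa [gridPt_self hat hk0] using main k

end Paths

/-! ### Measurability of sums over jumps -/

section JumpSumMeasurable

variable {Γ : Type*} [TopologicalSpace Γ]

theorem jumpSum_iSup_of_monotone (p : ℝ≥0 → Γ) {f : ℕ → ℝ≥0 → ℝ≥0∞} (hf : Monotone f) :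
    jumpSum p (fun u => ⨆ n, f n u) = ⨆ n, jumpSum p (f n) := by
  simp only [jumpSum, ENNReal.tsum_eq_iSup_sum]
  rw [iSup_comm]
  refine iSup_congr fun s => ?_
  rw [← ENNReal.finsetSum_iSup_of_monotone]
  · refine Finset.sum_congr rfl fun u _ => ?_
    by_cases hu : u ∈ jumpSet p <;> simp [hu]
  · intro u m n hmn
    exact indicator_le_indicator (hf hmn u)

theorem indicator_one_iUnion_eq_tsum {α : Type*} {f : ℕ → Set α}
    (hf : Pairwise (Function.onFun Disjoint f)) (z : α) :
    (⋃ i, f i).indicator (1 : α → ℝ≥0∞) z = ∑' i, (f i).indicator 1 z := by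
  by_cases h : ∃ i, z ∈ f i
  · obtain ⟨i, hi⟩ := h
    rw [indicator_of_mem (mem_iUnion.2 ⟨i, hi⟩), tsum_eq_single i, indicator_of_mem hi]
    intro j hj
    exact indicator_of_notMem (fun hz => Set.disjoint_left.1 (hf hj) hz hi) _
  · rw [indicator_of_notMem (by simpa using h), eq_comm, ENNReal.tsum_eq_zero]
    exact fun i => indicator_of_notMem (fun hz => h ⟨i, hz⟩) _

theorem measurable_of_forall_eq {α β : Type*} {m : MeasurableSpace α} [MeasurableSpace β]
    {f g : α → β} (hf : Measurable f) (h : ∀ x, f x = g x) : Measurable g :=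
  funext h ▸ hf

theorem IsPureJump.jumpSum_lt_top [T2Space Γ] {p : ℝ≥0 → Γ} (hp : IsPureJump p) {f : ℝ≥0 → ℝ≥0∞} {t : ℝ≥0}
    (hf : ∀ u, t < u → f u = 0) (hf' : ∀ u, f u < ∞) : jumpSum p f < ∞ := by
  rw [hp.jumpSum_eq_sum hf, ENNReal.sum_lt_top]
  exact fun u _ => hf' u

variable [PolishSpace Γ] [MeasurableSpace Γ] [BorelSpace Γ]

theorem isPiSystem_Iic_prod (Ω : Type*) [MeasurableSpace Ω] :
    IsPiSystem (image2 (· ×ˢ ·) (range (Iic : ℝ≥0 → Set ℝ≥0)) {s : Set Ω | MeasurableSet s}) :=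
  isPiSystem_Iic.prod MeasurableSpace.isPiSystem_measurableSet

theorem generateFrom_Iic_prod (Ω : Type*) [MeasurableSpace Ω] :
    MeasurableSpace.generateFrom
      (image2 (· ×ˢ ·) (range (Iic : ℝ≥0 → Set ℝ≥0)) {s : Set Ω | MeasurableSet s}) =
      (inferInstance : MeasurableSpace (ℝ≥0 × Ω)) := by
  rw [← generateFrom_prod_eq, MeasurableSpace.generateFrom_measurableSet, ← borel_eq_generateFrom_Iic,
    ← BorelSpace.measurable_eq (α := ℝ≥0)]
  · refine ⟨fun n => Iic (n : ℝ≥0), fun n => ⟨_, rfl⟩, ?_⟩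
    refine eq_univ_of_forall fun x => mem_iUnion.2 ?_
    exact exists_nat_ge x
  · exact isCountablySpanning_measurableSet

variable {Ω : Type*} [MeasurableSpace Ω]

/-- The sum is the pointwise limit of grid sums of increments, which involve only finitely many
coordinates up to time t. -/
theorem measurable_jumpSum_rect {X : ℝ≥0 → Ω → Γ} {t : ℝ≥0} (hX : ∀ u ≤ t, Measurable (X u))
    (hp : ∀ ω, IsPureJump fun u => X u ω) {C : Set Γ} (hC : MeasurableSet C) :
    Measurable fun ω => jumpSum (fun u => X u ω)
      ((Ioc 0 t).indicator fun u => C.indicator 1 (X u ω)) := by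
  classical
  refine measurable_of_tendsto_metrizable (f := fun (k : ℕ) ω => ∑ j ∈ Finset.range k,
    (fun x y => if x = y then (0 : ℝ≥0∞) else C.indicator 1 y) (X (gridPt 0 t k j) ω)
      (X (gridPt 0 t k (j + 1)) ω)) ?_ ?_
  · intro k
    refine Finset.measurable_fun_sum _ fun j hj => ?_
    have hj := Finset.mem_range.1 hj
    have h1 := hX _ (gridPt_le (zero_le (a := t)) hj.le)
    have h2 := hX _ (gridPt_le (zero_le (a := t)) (Nat.succ_le_of_lt hj))
    exact Measurable.ite (measurableSet_eq_fun h1 h2) measurable_const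
      ((measurable_one.indicator hC).comp h2)
  · rw [tendsto_pi_nhds]
    intro ω
    have := (hp ω).eventually_sum_grid (zero_le (a := t))
      (G := fun x y => if x = y then (0 : ℝ≥0∞) else C.indicator 1 y) (by simp)
    refine (tendsto_congr' this).2 ?_
    have e : jumpSum (fun u => X u ω) ((Ioc 0 t).indicator fun u =>
        if Function.leftLim (fun u => X u ω) u = X u ω then 0 else C.indicator 1 (X u ω)) =
        jumpSum (fun u => X u ω) ((Ioc 0 t).indicator fun u => C.indicator 1 (X u ω)) := by
      refine jumpSum_congr fun u hu => ?_
      by_cases h : u ∈ Ioc 0 t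
      · simp only [indicator_of_mem h, if_neg (Ne.symm hu)]
      · simp only [indicator_of_notMem h]
    rw [e]
    exact tendsto_const_nhds

/-- Monotone class argument starting from the rectangles (Iic b × F) × C, where the sum is that of
`measurable_jumpSum_rect` up to time min b t, cut off by F. -/
theorem measurable_jumpSum {X : ℝ≥0 → Ω → Γ} {t : ℝ≥0} (hX : ∀ u ≤ t, Measurable (X u))
    (hp : ∀ ω, IsPureJump fun u => X u ω) {H : (ℝ≥0 × Ω) × Γ → ℝ≥0∞} (hH : Measurable H) :
    Measurable fun ω => jumpSum (fun u => X u ω)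
      ((Iic t).indicator fun u => H ((u, ω), X u ω)) := by
  have hset : ∀ E : Set ((ℝ≥0 × Ω) × Γ), MeasurableSet E → Measurable fun ω =>
      jumpSum (fun u => X u ω) ((Iic t).indicator fun u => E.indicator 1 ((u, ω), X u ω)) := by
    have hfin : ∀ (E : Set ((ℝ≥0 × Ω) × Γ)) ω, jumpSum (fun u => X u ω)
        ((Iic t).indicator fun u => E.indicator 1 ((u, ω), X u ω)) < ∞ := by
      intro E ω
      refine (hp ω).jumpSum_lt_top (f := (Iic t).indicator fun u => E.indicator 1 ((u, ω), X u ω))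
        (t := t) (fun u hu => ?_) (fun u => ?_)
      · simp [indicator, not_le.2 hu]
      · by_cases h3 : u ≤ t <;> by_cases h4 : ((u, ω), X u ω) ∈ E <;> simp [indicator, *]
    have hrect : ∀ (b : ℝ≥0) (F : Set Ω) (C : Set Γ), MeasurableSet F → MeasurableSet C →
        Measurable fun ω => jumpSum (fun u => X u ω)
          ((Iic t).indicator fun u => ((Iic b ×ˢ F) ×ˢ C).indicator 1 ((u, ω), X u ω)) := by
      intro b F C hF hC
      have h1 := measurable_jumpSum_rect (t := min b t)
        (fun u hu => hX u (hu.trans (min_le_right _ _))) hp hC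
      have h2 : (fun ω => jumpSum (fun u => X u ω)
          ((Iic t).indicator fun u => ((Iic b ×ˢ F) ×ˢ C).indicator 1 ((u, ω), X u ω))) =
          F.indicator fun ω => jumpSum (fun u => X u ω)
            ((Ioc 0 (min b t)).indicator fun u => C.indicator 1 (X u ω)) := by
        funext ω
        by_cases hω : ω ∈ F
        · rw [indicator_of_mem hω]
          refine jumpSum_congr fun u hu => ?_
          have := pos_of_mem_jumpSet hu
          by_cases h3 : u ≤ t <;> by_cases h4 : u ≤ b <;> by_cases h5 : X u ω ∈ C <;>
            simp [indicator, *]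
        · rw [indicator_of_notMem hω, ← jumpSum_zero fun u => X u ω]
          refine jumpSum_congr fun u hu => ?_
          simp [indicator, hω]
      rw [h2]
      exact h1.indicator hF
    have hgen : (inferInstance : MeasurableSpace ((ℝ≥0 × Ω) × Γ)) = MeasurableSpace.generateFrom
        (image2 (· ×ˢ ·) (image2 (· ×ˢ ·) (range (Iic : ℝ≥0 → Set ℝ≥0))
          {s : Set Ω | MeasurableSet s}) {s : Set Γ | MeasurableSet s}) := by
      rw [← generateFrom_prod_eq, MeasurableSpace.generateFrom_measurableSet,
        generateFrom_Iic_prod Ω]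
      · refine ⟨fun n => Iic (n : ℝ≥0) ×ˢ univ, fun n => ⟨_, ⟨_, rfl⟩, _, .univ, rfl⟩, ?_⟩
        refine eq_univ_of_forall fun x => mem_iUnion.2 ?_
        obtain ⟨n, hn⟩ := exists_nat_ge x.1
        exact ⟨n, hn, mem_univ _⟩
      · exact isCountablySpanning_measurableSet
    intro E hE
    induction E, hE using MeasurableSpace.induction_on_inter hgen
      ((isPiSystem_Iic_prod Ω).prod MeasurableSpace.isPiSystem_measurableSet) with
    | empty => simp [jumpSum]
    | basic E hE =>
      obtain ⟨_, ⟨_, ⟨b, rfl⟩, F, hF, rfl⟩, C, hC, rfl⟩ := hE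
      exact hrect b F C hF hC
    -- The total number of jumps up to t is finite, so the complement is treated by subtraction.
    | compl E hE ih =>
      have h1 := hrect t univ univ .univ .univ
      refine measurable_of_forall_eq (h1.sub ih) fun ω => ?_
      refine ENNReal.sub_eq_of_eq_add (hfin E ω).ne ?_
      rw [← jumpSum_add]
      refine jumpSum_congr fun u hu => ?_
      by_cases h3 : u ≤ t <;> by_cases h4 : ((u, ω), X u ω) ∈ E <;> simp [indicator, *]
    | iUnion f hd hf ih =>
      refine measurable_of_forall_eq (Measurable.tsum (L := SummationFilter.unconditional ℕ) ih) fun ω => ?_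
      rw [← jumpSum_tsum]
      refine jumpSum_congr fun u hu => ?_
      by_cases h3 : u ≤ t
      · simp only [indicator_of_mem (mem_Iic.2 h3)]
        exact (indicator_one_iUnion_eq_tsum hd _).symm
      · simp [indicator, h3]
  refine Measurable.ennreal_induction (motive := fun H => Measurable fun ω =>
    jumpSum (fun u => X u ω) ((Iic t).indicator fun u => H ((u, ω), X u ω))) ?_ ?_ ?_ hH
  · intro c s hs
    refine measurable_of_forall_eq ((hset s hs).const_mul c) fun ω => ?_
    rw [← jumpSum_const_mul]
    refine jumpSum_congr fun u hu => ?_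
    by_cases h3 : u ≤ t <;> by_cases h4 : ((u, ω), X u ω) ∈ s <;> simp [indicator, *]
  · intro f g hd hf hg ihf ihg
    refine measurable_of_forall_eq (ihf.add ihg) fun ω => ?_
    simp only [Pi.add_apply]
    rw [← jumpSum_add]
    refine jumpSum_congr fun u hu => ?_
    by_cases h3 : u ≤ t <;> simp [h3]
  · intro f hf hmono ih
    refine measurable_of_forall_eq (Measurable.iSup ih) fun ω => ?_
    rw [← jumpSum_iSup_of_monotone]
    · refine jumpSum_congr fun u hu => ?_
      by_cases h3 : u ≤ t <;> simp [h3]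
    · intro m n hmn u
      exact indicator_le_indicator (hmono hmn _)

/-- On pure jump paths, sums over the jumps up to time `t` are measurable with respect to any
σ-algebra that makes the coordinates up to time `t` measurable. -/
theorem exists_measurable_eq_jumpSum {m : MeasurableSpace (PathSpace Γ)} {t : ℝ≥0}
    (hX : ∀ u ≤ t, Measurable[m] (canon u : PathSpace Γ → Γ))
    {H : (ℝ≥0 × PathSpace Γ) × Γ → ℝ≥0∞}
    (hH : Measurable[(MeasurableSpace.prod inferInstance m).prod inferInstance] H) :
    ∃ Y : PathSpace Γ → ℝ≥0∞, Measurable[m] Y ∧ ∀ ω : PathSpace Γ, IsPureJump ω.1 →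
      jumpSum ω.1 ((Iic t).indicator fun u => H ((u, ω), ω.1 u)) = Y ω := by
  -- The set of pure jump paths need not belong to m. One works on the subtype with the trace
  -- σ-algebra and extends the result to an m-measurable function on all paths.
  let m₀ : MeasurableSpace {ω : PathSpace Γ // IsPureJump ω.1} := m.comap Subtype.val
  have hval : @Measurable _ _ m₀ m (Subtype.val : {ω : PathSpace Γ // IsPureJump ω.1} → _) :=
    comap_measurable _
  have := measurable_jumpSum (Ω := {ω : PathSpace Γ // IsPureJump ω.1})
    (X := fun u ω => ω.1.1 u) (t := t) (fun u hu => (hX u hu).comp hval) (fun ω => ω.2)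
    (H := fun z => H ((z.1.1, z.1.2.1), z.2)) (by
      refine hH.comp (Measurable.prodMk ?_ measurable_snd)
      exact Measurable.prodMk (measurable_fst.comp measurable_fst)
        (hval.comp (measurable_snd.comp measurable_fst)))
  obtain ⟨Y, hY, hY'⟩ := @Measurable.exists_eq_measurable_comp _ _ _ m Subtype.val _ _ _ _ this
  exact ⟨Y, hY, fun ω hω => congrFun hY' ⟨ω, hω⟩⟩

end JumpSumMeasurable

/-! ### Measurability of the set of pure jump paths -/

section PureJumpMeasurable

/-- A dense sequence of times. -/
def denseTime : ℕ → ℝ≥0 := TopologicalSpace.denseSeq ℝ≥0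

theorem exists_denseTime_between {a b : ℝ≥0} (h : a < b) : ∃ i, a < denseTime i ∧ denseTime i < b := by
  obtain ⟨_, ⟨i, rfl⟩, hi⟩ := (TopologicalSpace.denseRange_denseSeq ℝ≥0).exists_between h
  exact ⟨i, hi⟩

/-- Before time `q` there are `m` successive changes of the path along the dense sequence. -/
def HasChanges {Γ : Type*} (p : ℝ≥0 → Γ) : ℕ → ℝ≥0 → Prop
  | 0, _ => True
  | m + 1, q => ∃ i j, denseTime i < denseTime j ∧ denseTime j ≤ q ∧
      HasChanges p m (denseTime i) ∧ p (denseTime i) ≠ p (denseTime j)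

theorem HasChanges.mono {Γ : Type*} {p : ℝ≥0 → Γ} {m : ℕ} {q r : ℝ≥0} (hqr : q ≤ r)
    (h : HasChanges p m q) : HasChanges p m r := by
  cases m with
  | zero => trivial
  | succ m =>
    obtain ⟨i, j, h1, h2, h3⟩ := h
    exact ⟨i, j, h1, h2.trans hqr, h3⟩

variable {Γ : Type*} [TopologicalSpace Γ] [PolishSpace Γ] {p : ℝ≥0 → Γ}

/-- Each change forces a jump between its two times, after all the earlier changes. -/
theorem HasChanges.le_ncard (hp : IsPureJump p) {m : ℕ} {q : ℝ≥0} (h : HasChanges p m q) :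
    m ≤ (jumpSet p ∩ Iic q).ncard := by
  induction m generalizing q with
  | zero => exact Nat.zero_le _
  | succ m ih =>
    obtain ⟨i, j, h1, h2, h3, h4⟩ := h
    have h5 : ∃ u ∈ Ioc (denseTime i) (denseTime j), u ∈ jumpSet p := by
      by_contra! hcon
      exact h4 (hp.eq_of_forall_notMem hcon ⟨h1.le, le_rfl⟩).symm
    obtain ⟨u, hu, huj⟩ := h5
    have h6 : (jumpSet p ∩ Iic (denseTime i)).ncard < (jumpSet p ∩ Iic q).ncard := by
      refine ncard_lt_ncard ?_ (hp.finite_jumpSet q)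
      refine ⟨inter_subset_inter_right _ (Iic_subset_Iic.2 (h1.le.trans h2)), fun hs => ?_⟩
      exact absurd (hs ⟨huj, hu.2.trans h2⟩).2 (not_le.2 hu.1)
    exact lt_of_le_of_lt (ih h3) h6

/-- Right continuity carries constancy from the dense times to all times of the interval. -/
theorem eventuallyEq_right_of_denseTime (hc : IsCadlag p) {t c : ℝ≥0}
    (h : ∀ i j, denseTime i < denseTime j → t < denseTime i → denseTime j < c →
      p (denseTime i) = p (denseTime j)) {s : ℝ≥0} (hs : s ∈ Ico t c) {i : ℕ}
    (hi : denseTime i ∈ Ioo t c) : p s = p (denseTime i) := by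
  have h1 : Tendsto p (𝓝[>] s) (𝓝 (p s)) := ((hc s).1.mono Ioi_subset_Ici_self).tendsto
  have h2 : ∃ᶠ r in 𝓝[>] s, p r = p (denseTime i) := by
    rw [frequently_iff]
    intro U hU
    obtain ⟨b, hb, hbU⟩ := (mem_nhdsGT_iff_exists_Ioo_subset' hs.2).1 hU
    obtain ⟨j, hj1, hj2⟩ := exists_denseTime_between (lt_min hb hs.2)
    refine ⟨denseTime j, hbU ⟨hj1, hj2.trans_le (min_le_left _ _)⟩, ?_⟩
    have hj3 := hj2.trans_le (min_le_right _ _)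
    rcases lt_trichotomy (denseTime i) (denseTime j) with hij | hij | hij
    · exact (h i j hij hi.1 hj3).symm
    · rw [hij]
    · exact h j i hij (hs.1.trans_lt hj1) hi.2
  by_contra hne
  have h3 : ∀ᶠ r in 𝓝[>] s, p r ≠ p (denseTime i) := h1.eventually_ne hne
  exact h2 h3

/-- Being pure jump is the same as having boundedly many changes along the dense times in bounded
time, a condition that involves countably many coordinates only. -/
theorem isPureJump_iff (hc : IsCadlag p) :
    IsPureJump p ↔ ∀ T : ℕ, ∃ m, ¬ HasChanges p m T := by
  constructor
  · intro hp T
    refine ⟨(jumpSet p ∩ Iic (T : ℝ≥0)).ncard + 1, fun h => ?_⟩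
    have := h.le_ncard hp
    lia
  · intro h t
    classical
    obtain ⟨T, hT⟩ := exists_nat_gt t
    obtain ⟨m₀, hm₀⟩ := h T
    constructor
    -- For the least m + 1 that fails at some c > t, m changes occur before every time after t. One
    -- more change inside (t, c) would make m + 1, so the path is constant there.
    · have hex : ∃ m, ∃ q, t < q ∧ ¬ HasChanges p m q := ⟨m₀, T, hT, hm₀⟩
      obtain ⟨c, htc, hmc⟩ := Nat.find_spec hex
      have hmin := fun {k} (hk : k < Nat.find hex) => Nat.find_min hex hk
      generalize Nat.find hex = m at hmc hmin
      cases m with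
      | zero => exact absurd trivial hmc
      | succ m =>
        have hconst : ∀ i j, denseTime i < denseTime j → t < denseTime i → denseTime j < c →
            p (denseTime i) = p (denseTime j) := by
          intro i j hij hti hjc
          by_contra hne
          have : HasChanges p m (denseTime i) := by
            by_contra hcon
            exact hmin (Nat.lt_succ_self m) ⟨_, hti, hcon⟩
          exact hmc ⟨i, j, hij, hjc.le, this, hne⟩
        obtain ⟨i, hi⟩ := exists_denseTime_between htc
        filter_upwards [Ioo_mem_nhdsGT htc] with s hs
        rw [eventuallyEq_right_of_denseTime hc hconst ⟨hs.1.le, hs.2⟩ hi,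
          eventuallyEq_right_of_denseTime hc hconst ⟨le_rfl, htc⟩ hi]
    · rcases eq_or_ne t 0 with rfl | ht0
      · exact ⟨p 0, by simp⟩
      have ht0 : 0 < t := pos_iff_ne_zero.2 ht0
      -- Mirror argument on the left: for the least m + 1 that fails at all times before t, m
      -- changes are complete at some c < t, so none is left in (c, t).
      have hex : ∃ m, ∀ q, q < t → ¬ HasChanges p m q :=
        ⟨m₀, fun q hq hcon => hm₀ (hcon.mono (hq.trans hT).le)⟩
      have hmc := Nat.find_spec hex
      have hmin := fun {k} (hk : k < Nat.find hex) => Nat.find_min hex hk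
      generalize Nat.find hex = m at hmc hmin
      cases m with
      | zero => exact absurd trivial (hmc 0 ht0)
      | succ m =>
        have := hmin (Nat.lt_succ_self m)
        push Not at this
        obtain ⟨c, hct, hc'⟩ := this
        have hconst : ∀ i j, denseTime i < denseTime j → c < denseTime i → denseTime j < t →
            p (denseTime i) = p (denseTime j) := by
          intro i j hij hti hjc
          by_contra hne
          exact hmc _ hjc ⟨i, j, hij, le_rfl, hc'.mono hti.le, hne⟩
        obtain ⟨i, hi⟩ := exists_denseTime_between hct
        refine ⟨p (denseTime i), ?_⟩
        filter_upwards [Ioo_mem_nhdsLT hct] with s hs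
        exact eventuallyEq_right_of_denseTime hc hconst ⟨hs.1.le, hs.2⟩ hi

theorem measurable_canon {Γ : Type*} [TopologicalSpace Γ] [MeasurableSpace Γ] (u : ℝ≥0) :
    Measurable (canon u : PathSpace Γ → Γ) :=
  (measurable_pi_apply u).comp measurable_subtype_coe

variable [MeasurableSpace Γ] [BorelSpace Γ]

theorem measurableSet_isPureJump : MeasurableSet {ω : PathSpace Γ | IsPureJump ω.1} := by
  have h1 : ∀ m q, MeasurableSet {ω : PathSpace Γ | HasChanges ω.1 m q} := by
    intro m
    induction m with
    | zero => intro q; simp [HasChanges]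
    | succ m ih =>
      intro q
      simp only [HasChanges]
      refine measurableSet_setOfPred.2 (Measurable.exists fun i => Measurable.exists fun j => ?_)
      refine measurable_const.and (measurable_const.and (Measurable.and ?_ ?_))
      · exact measurableSet_setOfPred.1 (ih _)
      · exact (measurableSet_setOfPred.1 (measurableSet_eq_fun (measurable_canon _)
          (measurable_canon _))).not
  have h2 : {ω : PathSpace Γ | IsPureJump ω.1} =
      ⋂ T : ℕ, ⋃ m, {ω : PathSpace Γ | HasChanges ω.1 m T}ᶜ := by
    ext ω
    simp [isPureJump_iff ω.2]
  rw [h2]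
  exact .iInter fun T => .iUnion fun m => (h1 m _).compl

end PureJumpMeasurable

/-! ### Predictable processes -/

section Predictable

/-- Index of the left-open cell of mesh 1/K that contains u. As u is positive the ceiling is at
least 1 and the truncated subtraction is genuine. -/
theorem ceil_sub_one_eq_iff {K : ℝ≥0} (hK : 0 < K) {u : ℝ≥0} (hu : 0 < u) {j : ℕ} :
    ⌈u * K⌉₊ - 1 = j ↔ u ∈ Ioc ((j : ℝ≥0) / K) ((j + 1) / K) := by
  have h0 : 0 < ⌈u * K⌉₊ := Nat.ceil_pos.2 (mul_pos hu hK)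
  rw [mem_Ioc, div_lt_iff₀ hK, le_div_iff₀ hK, ← Nat.lt_ceil]
  have : u * K ≤ (j : ℝ≥0) + 1 ↔ ⌈u * K⌉₊ ≤ j + 1 := by
    rw [Nat.ceil_le]; push_cast; rfl
  rw [this]
  lia

/-- The last point before `u` of the grid of mesh `1 / (k + 1)`. -/
def leftPt (k : ℕ) (u : ℝ≥0) : ℝ≥0 := (⌈u * (k + 1)⌉₊ - 1 : ℕ) / (k + 1)

theorem leftPt_zero (k : ℕ) : leftPt k 0 = 0 := by simp [leftPt]

theorem leftPt_mem {u : ℝ≥0} (hu : 0 < u) (k : ℕ) :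
    leftPt k u < u ∧ u ≤ leftPt k u + 1 / (k + 1) := by
  have := (ceil_sub_one_eq_iff (K := k + 1) (by positivity) hu).1 rfl
  refine ⟨this.1, this.2.trans (le_of_eq ?_)⟩
  rw [leftPt, ← add_div]

theorem tendsto_leftPt {u : ℝ≥0} (hu : 0 < u) :
    Tendsto (fun k => leftPt k u) atTop (𝓝[<] u) := by
  refine tendsto_nhdsWithin_iff.2 ⟨?_, Eventually.of_forall fun k => (leftPt_mem hu k).1⟩
  have h1 : Tendsto (fun k : ℕ => u - 1 / ((k : ℝ≥0) + 1)) atTop (𝓝 (u - 0)) :=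
    tendsto_const_nhds.sub tendsto_one_div_add_atTop_nhds_zero_nat
  rw [tsub_zero] at h1
  refine tendsto_of_tendsto_of_tendsto_of_le_of_le h1 tendsto_const_nhds (fun k => ?_)
    fun k => (leftPt_mem hu k).1.le
  exact tsub_le_iff_right.2 (leftPt_mem hu k).2

variable {Ω β : Type*} {mΩ : MeasurableSpace Ω} {𝔉 : Filtration ℝ≥0 mΩ} [MeasurableSpace β]

/-- On the cell (j/(k+1), (j+1)/(k+1)] the process is frozen at its left end, so a preimage is a
countable union of cells times events known there, plus a piece at time 0. -/
theorem measurable_predictable_leftPt {Y : ℝ≥0 → Ω → β} (hY : ∀ t, Measurable[𝔉 t] (Y t)) (k : ℕ) :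
    Measurable[𝔉.predictable] fun z : ℝ≥0 × Ω => Y (leftPt k z.1) z.2 := by
  intro C hC
  have : (fun z : ℝ≥0 × Ω => Y (leftPt k z.1) z.2) ⁻¹' C = ({⊥} ×ˢ (Y 0 ⁻¹' C)) ∪
      ⋃ j : ℕ, Ioc ((j : ℝ≥0) / (k + 1)) ((j + 1) / (k + 1)) ×ˢ (Y (j / (k + 1)) ⁻¹' C) := by
    ext ⟨u, ω⟩
    simp only [mem_preimage, mem_union, mem_prod, mem_singleton_iff, mem_iUnion]
    rcases eq_or_ne u 0 with rfl | hu
    · simp [leftPt_zero]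
    · have hu' := pos_iff_ne_zero.2 hu
      constructor
      · intro h
        exact Or.inr ⟨_, (ceil_sub_one_eq_iff (K := (k : ℝ≥0) + 1) (by positivity) hu').1 rfl, h⟩
      · rintro (h | ⟨j, hj, h⟩)
        · exact absurd h.1 hu
        · have := (ceil_sub_one_eq_iff (K := (k : ℝ≥0) + 1) (by positivity) hu').2 hj
          rwa [leftPt, this]
  rw [this]
  refine MeasurableSet.union ?_ (MeasurableSet.iUnion fun j => ?_)
  · exact measurableSet_predictable_singleton_bot_prod (hY 0 hC)
  · exact measurableSet_predictable_Ioc_prod _ _ (hY _ hC)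

/-- The left limits of an adapted process are limits of the predictable step processes sampled at
`leftPt`. -/
theorem measurable_predictable_of_tendsto [TopologicalSpace β] [TopologicalSpace.PseudoMetrizableSpace β]
    [BorelSpace β] {Y Z : ℝ≥0 → Ω → β} (hY : ∀ t, Measurable[𝔉 t] (Y t))
    (h0 : ∀ ω, Z 0 ω = Y 0 ω)
    (hZ : ∀ ω u, 0 < u → Tendsto (fun s => Y s ω) (𝓝[<] u) (𝓝 (Z u ω))) :
    Measurable[𝔉.predictable] fun z : ℝ≥0 × Ω => Z z.1 z.2 := by
  let : MeasurableSpace (ℝ≥0 × Ω) := 𝔉.predictable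
  refine measurable_of_tendsto_metrizable (fun k => measurable_predictable_leftPt hY k) ?_
  rw [tendsto_pi_nhds]
  rintro ⟨u, ω⟩
  rcases eq_or_ne u 0 with rfl | hu
  · simp only [leftPt_zero, h0]
    exact tendsto_const_nhds
  · exact (hZ ω u (pos_iff_ne_zero.2 hu)).comp (tendsto_leftPt (pos_iff_ne_zero.2 hu))

/-- Predictable processes are progressive: frozen at t, they are jointly measurable with respect to
the information at time t. It suffices to look at the generators. -/
theorem measurable_min_predictable (t : ℝ≥0) :
    @Measurable (ℝ≥0 × Ω) (ℝ≥0 × Ω) (MeasurableSpace.prod inferInstance (𝔉 t)) 𝔉.predictable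
      fun z => (min z.1 t, z.2) := by
  rw [measurable_iff_comap_le]
  refine MeasurableSpace.comap_le_iff_le_map.2 <|
    measurableSpace_le_predictable_of_measurableSet ?_ ?_
  · intro A hA
    have : (fun z : ℝ≥0 × Ω => (min z.1 t, z.2)) ⁻¹' ({⊥} ×ˢ A) =
      {u | min u t = 0} ×ˢ A := by ext; simp
    rw [MeasurableSpace.map_def, this]
    have h1 : MeasurableSet {u : ℝ≥0 | min u t = 0} :=
      measurableSet_eq_fun (by fun_prop) measurable_const
    exact @MeasurableSet.prod _ _ _ (𝔉 t) _ _ h1 (𝔉.mono bot_le _ hA)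
  · intro r A hA
    rw [MeasurableSpace.map_def]
    rcases le_or_gt t r with h | h
    · have : (fun z : ℝ≥0 × Ω => (min z.1 t, z.2)) ⁻¹' (Ioi r ×ˢ A) = ∅ := by
        ext z
        simp [h]
      rw [this]
      exact @MeasurableSet.empty _ (MeasurableSpace.prod inferInstance (𝔉 t))
    · have : (fun z : ℝ≥0 × Ω => (min z.1 t, z.2)) ⁻¹' (Ioi r ×ˢ A) = Ioi r ×ˢ A := by
        ext z
        simp [h]
      rw [this]
      exact @MeasurableSet.prod _ _ _ (𝔉 t) _ _ measurableSet_Ioi (𝔉.mono h.le _ hA)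

theorem predictable_le_prod : 𝔉.predictable ≤ MeasurableSpace.prod inferInstance mΩ :=
  measurableSpace_le_predictable_of_measurableSet
    (fun _ hA => (measurableSet_singleton _).prod (𝔉.le _ _ hA))
    fun _ _ hA => measurableSet_Ioi.prod (𝔉.le _ _ hA)

end Predictable

/-! ### Stopping at the hitting time -/

section Stopping

variable {Γ : Type*} [TopologicalSpace Γ]

/-- The infimum of the times of the dense sequence at which the path is in `E`. -/
def denseHitTime (E : Set Γ) (ω : PathSpace Γ) : ℝ≥0∞ :=
  ⨅ i, ⨅ _ : ω.1 (denseTime i) ∈ E, (denseTime i : ℝ≥0∞)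

/-- The time `t ∧ denseHitTime`. -/
def denseStopTime (E : Set Γ) (t : ℝ≥0) (ω : PathSpace Γ) : ℝ≥0 :=
  (min (t : ℝ≥0∞) (denseHitTime E ω)).toNNReal

theorem isCadlag_denseStop (E : Set Γ) (ω : PathSpace Γ) :
    IsCadlag fun t => ω.1 (denseStopTime E t ω) := by
  rcases eq_or_ne (denseHitTime E ω) ∞ with h | h
  · simp only [denseStopTime, h, min_top_right, ENNReal.toNNReal_coe]
    exact ω.2
  · lift denseHitTime E ω to ℝ≥0 using h with r hr
    simp only [denseStopTime, ← hr, ← ENNReal.coe_min, ENNReal.toNNReal_coe]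
    exact isCadlag_min ω.2 r

/-- The path stopped at `denseHitTime`; on pure jump paths this is the path stopped at the hitting
time, and it is measurable. -/
def denseStop (E : Set Γ) (ω : PathSpace Γ) : PathSpace Γ :=
  ⟨fun t => ω.1 (denseStopTime E t ω), isCadlag_denseStop E ω⟩

theorem denseStop_apply_zero (E : Set Γ) (ω : PathSpace Γ) : (denseStop E ω).1 0 = ω.1 0 := by
  simp [denseStop, denseStopTime]

/-- The times `u` such that `E` is not visited along the dense sequence before time `u`. -/
def aliveSet (E : Set Γ) : Set (ℝ≥0 × PathSpace Γ) :=
  {z | ∀ i, denseTime i < z.1 → z.2.1 (denseTime i) ∉ E}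

/-- The path is constant just after the infimum, so the infimum is attained without any closedness
of E. -/
theorem exists_mem_of_hit {Γ : Type*} {p : ℝ≥0 → Γ} (hp : IsPureJump p) {E : Set Γ} (h : ∃ s, p s ∈ E) :
    p (sInf {s | p s ∈ E}) ∈ E := by
  set r := sInf {s | p s ∈ E}
  by_contra hr
  have h1 := (hp r).1
  obtain ⟨c, hc, hc'⟩ := (mem_nhdsGT_iff_exists_Ioo_subset).1 h1
  have h2 : c ≤ r := by
    refine le_csInf h fun s hs => ?_
    by_contra! hsc
    have hrs : r ≤ s := csInf_le (OrderBot.bddBelow _) hs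
    rcases hrs.eq_or_lt with h3 | h3
    · exact hr (h3 ▸ hs)
    · have : p s = p r := hc' ⟨h3, hsc⟩
      exact hr (this ▸ hs)
  exact absurd hc (not_lt.2 h2)

/-- After entering E at r the path stays in the same state for a while, and a dense time falls into
this while; hence both hitting times are r. The dichotomy mediates between `WithTop ℝ≥0` and `ℝ≥0∞`.
-/
theorem hitTime_cases {ω : PathSpace Γ} (hω : IsPureJump ω.1) (A B : Set Γ) :
    ((∀ s, ω.1 s ∉ A ∪ B) ∧ hitTime A B ω = ⊤ ∧ denseHitTime (A ∪ B) ω = ∞) ∨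
    ∃ r : ℝ≥0, hitTime A B ω = r ∧ denseHitTime (A ∪ B) ω = r ∧ ω.1 r ∈ A ∪ B ∧
      ∀ s < r, ω.1 s ∉ A ∪ B := by
  classical
  by_cases h : ∃ s, ω.1 s ∈ A ∪ B
  · right
    have hmem := exists_mem_of_hit hω h
    have hlt : ∀ s < sInf {s | ω.1 s ∈ A ∪ B}, ω.1 s ∉ A ∪ B :=
      fun s hs =>
      notMem_of_lt_csInf (s := {s | ω.1 s ∈ A ∪ B}) hs (OrderBot.bddBelow _)
    refine ⟨sInf {s | ω.1 s ∈ A ∪ B}, ?_, ?_, hmem, hlt⟩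
    · rw [hitTime, hittingAfter, if_pos]
      · congr 2
        ext s
        simp [canon]
      · obtain ⟨s, hs⟩ := h
        exact ⟨s, zero_le, hs⟩
    · refine le_antisymm ?_ ?_
      · refine le_of_forall_gt fun c hc => ?_
        obtain ⟨d, hd1, hd2⟩ := ENNReal.lt_iff_exists_nnreal_btwn.1 hc
        have h1 := (hω (sInf {s | ω.1 s ∈ A ∪ B})).1
        rw [ENNReal.coe_lt_coe] at hd1
        obtain ⟨e, he, he'⟩ := (mem_nhdsGT_iff_exists_Ioo_subset).1 h1
        obtain ⟨i, hi1, hi2⟩ := exists_denseTime_between (lt_min hd1 he)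
        have h2 : ω.1 (denseTime i) ∈ A ∪ B := by
          have : ω.1 (denseTime i) = _ := he' ⟨hi1, hi2.trans_le (min_le_right _ _)⟩
          rw [this]
          exact hmem
        refine lt_of_le_of_lt (iInf₂_le i h2) (lt_trans ?_ hd2)
        exact ENNReal.coe_lt_coe.2 (hi2.trans_le (min_le_left _ _))
      · refine le_iInf₂ fun i hi => ENNReal.coe_le_coe.2 ?_
        by_contra! hcon
        exact hlt _ hcon hi
  · left
    push Not at h
    refine ⟨h, ?_, ?_⟩
    · rw [hitTime, hittingAfter, if_neg]
      rintro ⟨s, _, hs⟩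
      exact h s hs
    · simp [denseHitTime, h]

/-- Allows the stopped path to be replaced, almost surely, by a map known to be measurable. -/
theorem stopPath_eq_denseStop {ω : PathSpace Γ} (hω : IsPureJump ω.1) (A B : Set Γ) :
    stopPath A B ω = denseStop (A ∪ B) ω := by
  apply Subtype.ext
  funext t
  change ω.1 (min (t : WithTop ℝ≥0) (hitTime A B ω)).untopA =
    ω.1 (min (t : ℝ≥0∞) (denseHitTime (A ∪ B) ω)).toNNReal
  rcases hitTime_cases hω A B with ⟨_, h1, h2⟩ | ⟨r, h1, h2, _⟩
  · rw [h1, h2, min_top_right, min_top_right, ENNReal.toNNReal_coe]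
    rfl
  · rw [h1, h2, ← ENNReal.coe_min, ENNReal.toNNReal_coe, ← WithTop.coe_min]
    rfl

theorem mem_aliveSet_iff {ω : PathSpace Γ} (hω : IsPureJump ω.1) {E : Set Γ} {u : ℝ≥0} :
    (u, ω) ∈ aliveSet E ↔ ∀ s < u, ω.1 s ∉ E := by
  constructor
  · intro h s hsu hs
    obtain ⟨c, hc, hc'⟩ := (mem_nhdsGT_iff_exists_Ioo_subset).1 (hω s).1
    obtain ⟨i, hi1, hi2⟩ := exists_denseTime_between (lt_min hc hsu)
    have : ω.1 (denseTime i) = ω.1 s := hc' ⟨hi1, hi2.trans_le (min_le_left _ _)⟩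
    exact h i (hi2.trans_le (min_le_right _ _)) (this ▸ hs)
  · intro h i hi
    exact h _ hi

/-- The interval is closed at τ, so that the jump into A ∪ B counts among the jumps of the stopped
path. -/
theorem mem_aliveSet_iff_le_hitTime {ω : PathSpace Γ} (hω : IsPureJump ω.1) {A B : Set Γ}
    {u : ℝ≥0} : (u, ω) ∈ aliveSet (A ∪ B) ↔ (u : WithTop ℝ≥0) ≤ hitTime A B ω := by
  rw [mem_aliveSet_iff hω]
  rcases hitTime_cases hω A B with ⟨h0, h1, h2⟩ | ⟨r, h1, h2, h3, h4⟩
  · simp only [h1, le_top, iff_true]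
    exact fun s _ => h0 s
  · rw [h1, WithTop.coe_le_coe]
    constructor
    · intro h
      by_contra! hcon
      exact h r hcon h3
    · exact fun h s hs => h4 s (hs.trans_le h)

theorem denseStopTime_of_alive {ω : PathSpace Γ} (hω : IsPureJump ω.1) {A B : Set Γ}
    {u : ℝ≥0} (h : (u, ω) ∈ aliveSet (A ∪ B)) : denseStopTime (A ∪ B) u ω = u := by
  rw [mem_aliveSet_iff_le_hitTime hω] at h
  rw [denseStopTime]
  rcases hitTime_cases hω A B with ⟨h0, h1, h2⟩ | ⟨r, h1, h2, h3, h4⟩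
  · simp [h2]
  · rw [h1, WithTop.coe_le_coe] at h
    simp [h2, h]

theorem denseStop_of_alive {ω : PathSpace Γ} (hω : IsPureJump ω.1) {A B : Set Γ}
    {u : ℝ≥0} (h : (u, ω) ∈ aliveSet (A ∪ B)) : (denseStop (A ∪ B) ω).1 u = ω.1 u := by
  change ω.1 (denseStopTime (A ∪ B) u ω) = ω.1 u
  rw [denseStopTime_of_alive hω h]

theorem aliveSet_mono {E : Set Γ} {ω : PathSpace Γ} {s u : ℝ≥0} (hsu : s ≤ u)
    (h : (u, ω) ∈ aliveSet E) : (s, ω) ∈ aliveSet E :=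
  fun i hi => h i (hi.trans_le hsu)

/-- After the hitting time the stopped path is constant, with value `hitValue`. -/
theorem denseStop_of_not_alive {ω : PathSpace Γ} (hω : IsPureJump ω.1) {A B : Set Γ}
    {u : ℝ≥0} (h : (u, ω) ∉ aliveSet (A ∪ B)) :
    (denseStop (A ∪ B) ω).1 u = hitValue A B ω ∧ hitValue A B ω ∈ A ∪ B := by
  rw [mem_aliveSet_iff_le_hitTime hω] at h
  rcases hitTime_cases hω A B with ⟨h0, h1, h2⟩ | ⟨r, h1, h2, h3, h4⟩
  · exact absurd (h1 ▸ le_top) h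
  · rw [h1, WithTop.coe_le_coe, not_le] at h
    have h5 : hitValue A B ω = ω.1 r := by
      change ω.1 (hitTime A B ω).untopA = ω.1 r
      rw [h1]
      rfl
    rw [h5]
    refine ⟨?_, h3⟩
    change ω.1 (min (u : ℝ≥0∞) (denseHitTime (A ∪ B) ω)).toNNReal = _
    rw [h2, ← ENNReal.coe_min, ENNReal.toNNReal_coe, min_eq_right h.le]

theorem eventually_not_alive {ω : PathSpace Γ} (hω : IsPureJump ω.1) {A B : Set Γ}
    (h : hitTime A B ω ≠ ⊤) : ∀ᶠ u : ℝ≥0 in atTop, (u, ω) ∉ aliveSet (A ∪ B) := by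
  obtain ⟨r, hr⟩ := WithTop.ne_top_iff_exists.1 h
  filter_upwards [eventually_gt_atTop r] with u hu
  rw [mem_aliveSet_iff_le_hitTime hω, ← hr, WithTop.coe_le_coe, not_le]
  exact hu

theorem isPureJump_denseStop {ω : PathSpace Γ} (hω : IsPureJump ω.1) (A B : Set Γ) :
    IsPureJump (denseStop (A ∪ B) ω).1 := by
  have e : (denseStop (A ∪ B) ω).1 = fun t => ω.1 (denseStopTime (A ∪ B) t ω) := rfl
  rcases hitTime_cases hω A B with ⟨_, h1, h2⟩ | ⟨r, h1, h2, _⟩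
  · simp only [e, denseStopTime, h2, min_top_right, ENNReal.toNNReal_coe]
    exact hω
  · simp only [e, denseStopTime, h2, ← ENNReal.coe_min, ENNReal.toNNReal_coe]
    intro t
    constructor
    · rcases lt_or_ge t r with h | h
      · filter_upwards [(hω t).1, Ioo_mem_nhdsGT h] with s hs hs'
        rw [min_eq_left hs'.2.le, min_eq_left h.le, hs]
      · filter_upwards [self_mem_nhdsWithin] with s hs
        rw [min_eq_right h, min_eq_right (h.trans (le_of_lt hs))]
    · rcases le_or_gt t r with h | h
      · obtain ⟨y, hy⟩ := (hω t).2
        refine ⟨y, ?_⟩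
        filter_upwards [hy, self_mem_nhdsWithin] with s hs hs'
        rw [min_eq_left ((le_of_lt hs').trans h), hs]
      · refine ⟨ω.1 r, ?_⟩
        filter_upwards [Ioo_mem_nhdsLT h] with s hs
        rw [min_eq_right hs.1.le]

section

variable [T2Space Γ]

theorem leftLim_denseStop_of_alive {ω : PathSpace Γ} (hω : IsPureJump ω.1) {A B : Set Γ}
    {u : ℝ≥0} (h : (u, ω) ∈ aliveSet (A ∪ B)) :
    Function.leftLim (denseStop (A ∪ B) ω).1 u = Function.leftLim ω.1 u := by
  rcases eq_or_ne u 0 with rfl | hu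
  · have hb : 𝓝[<] (0 : ℝ≥0) = ⊥ := by simp
    rw [leftLim_eq_of_eq_bot _ hb, leftLim_eq_of_eq_bot _ hb, denseStop_apply_zero]
  · refine leftLim_eq_of_eventually (pos_iff_ne_zero.2 hu) ?_
    filter_upwards [hω.eventually_left u, self_mem_nhdsWithin] with s hs hsu
    rw [denseStop_of_alive hω (aliveSet_mono (le_of_lt hsu) h), hs]

/-- Just before any time u ≤ τ the path is still off A ∪ B; this is where the harmonic equation
becomes available. -/
theorem leftLim_notMem_of_alive {ω : PathSpace Γ} (hω : IsPureJump ω.1) {A B : Set Γ}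
    {u : ℝ≥0} (hu : 0 < u) (h : (u, ω) ∈ aliveSet (A ∪ B)) :
    Function.leftLim ω.1 u ∉ A ∪ B := by
  have : (𝓝[<] u).NeBot := nhdsLT_neBot_of_exists_lt ⟨0, hu⟩
  obtain ⟨s, hs, hsu⟩ := ((hω.eventually_left u).and self_mem_nhdsWithin).exists
  rw [← hs]
  exact (mem_aliveSet_iff hω).1 h s hsu

theorem leftLim_denseStop_of_not_alive {ω : PathSpace Γ} (hω : IsPureJump ω.1) {A B : Set Γ}
    {u : ℝ≥0} (h : (u, ω) ∉ aliveSet (A ∪ B)) :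
    Function.leftLim (denseStop (A ∪ B) ω).1 u = hitValue A B ω := by
  have h0 := h
  rw [mem_aliveSet_iff_le_hitTime hω] at h
  rcases hitTime_cases hω A B with ⟨_, h1, _⟩ | ⟨r, h1, _⟩
  · exact absurd (h1 ▸ le_top) h
  · rw [h1, WithTop.coe_le_coe, not_le] at h
    refine leftLim_eq_of_eventually (lt_of_le_of_lt zero_le h) ?_
    filter_upwards [Ioo_mem_nhdsLT h] with s hs
    refine (denseStop_of_not_alive hω ?_).1
    rw [mem_aliveSet_iff_le_hitTime hω, h1, WithTop.coe_le_coe, not_le]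
    exact hs.1

/-- The jumps of the stopped path are those of the path up to the hitting time. -/
theorem jumpSum_denseStop {ω : PathSpace Γ} (hω : IsPureJump ω.1) {A B : Set Γ}
    (f : ℝ≥0 → Γ → Γ → ℝ≥0∞) :
    jumpSum (denseStop (A ∪ B) ω).1 (fun u => f u (Function.leftLim (denseStop (A ∪ B) ω).1 u)
      ((denseStop (A ∪ B) ω).1 u)) =
    jumpSum ω.1 ({u | (u, ω) ∈ aliveSet (A ∪ B)}.indicator
      fun u => f u (Function.leftLim ω.1 u) (ω.1 u)) := by
  unfold jumpSum
  congr 1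
  funext u
  by_cases h : (u, ω) ∈ aliveSet (A ∪ B)
  · have h1 := denseStop_of_alive hω h
    have h2 := leftLim_denseStop_of_alive hω h
    have h3 : u ∈ jumpSet (denseStop (A ∪ B) ω).1 ↔ u ∈ jumpSet ω.1 := by
      simp only [jumpSet, mem_ofPred_eq, h1, h2]
    by_cases h4 : u ∈ jumpSet ω.1
    · rw [indicator_of_mem (h3.2 h4), indicator_of_mem h4, h1, h2, indicator_of_mem]
      exact h
    · rw [indicator_of_notMem (fun h => h4 (h3.1 h)), indicator_of_notMem h4]
  · have h1 : u ∉ jumpSet (denseStop (A ∪ B) ω).1 := by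
      simp only [jumpSet, mem_ofPred_eq, not_not]
      rw [leftLim_denseStop_of_not_alive hω h, (denseStop_of_not_alive hω h).1]
    rw [indicator_of_notMem h1]
    by_cases h4 : u ∈ jumpSet ω.1
    · rw [indicator_of_mem h4, indicator_of_notMem]
      exact h
    · rw [indicator_of_notMem h4]

theorem tendsto_leftLim (ω : PathSpace Γ) {u : ℝ≥0} (hu : 0 < u) :
    Tendsto ω.1 (𝓝[<] u) (𝓝 (Function.leftLim ω.1 u)) := by
  have : (𝓝[<] u).NeBot := nhdsLT_neBot_of_exists_lt ⟨0, hu⟩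
  obtain ⟨y, hy⟩ := (ω.2 u).2
  rwa [leftLim_eq_of_tendsto hy]

end

theorem canonLeft_zero (ω : PathSpace Γ) : canonLeft 0 ω = ω.1 0 :=
  leftLim_eq_of_eq_bot _ (by simp)

variable [MeasurableSpace Γ]

section

variable {m : MeasurableSpace (PathSpace Γ)} {u : ℝ≥0}

/-- The minimum with u is unaffected by dense times after u, so only coordinates up to u enter. -/
theorem measurable_denseStopTime (hX : ∀ s ≤ u, Measurable[m] (canon s : PathSpace Γ → Γ))
    {E : Set Γ} (hE : MeasurableSet E) : Measurable[m] (denseStopTime E u) := by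
  refine ENNReal.measurable_toNNReal.comp ?_
  have : (fun ω => min (u : ℝ≥0∞) (denseHitTime E ω)) = fun ω => ⨅ i,
      min (u : ℝ≥0∞) (⨅ _ : ω.1 (denseTime i) ∈ E, (denseTime i : ℝ≥0∞)) := by
    funext ω
    exact inf_iInf
  rw [this]
  refine Measurable.iInf fun i => ?_
  classical
  rcases le_or_gt (denseTime i) u with h | h
  · have e : (fun ω : PathSpace Γ => min (u : ℝ≥0∞)
        (⨅ _ : ω.1 (denseTime i) ∈ E, (denseTime i : ℝ≥0∞))) =
        fun ω => if ω ∈ canon (denseTime i) ⁻¹' E then (denseTime i : ℝ≥0∞) else u := by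
      funext ω
      by_cases hω : ω.1 (denseTime i) ∈ E
      · simp [hω, canon, h]
      · simp [hω, canon]
    rw [e]
    exact Measurable.ite (hX _ h hE) measurable_const measurable_const
  · have e : (fun ω : PathSpace Γ => min (u : ℝ≥0∞)
        (⨅ _ : ω.1 (denseTime i) ∈ E, (denseTime i : ℝ≥0∞))) = fun ω => (u : ℝ≥0∞) := by
      funext ω
      refine min_eq_left (le_iInf fun _ => ENNReal.coe_le_coe.2 h.le)
    rw [e]
    exact measurable_const

theorem denseStopTime_le (E : Set Γ) (u : ℝ≥0) (ω : PathSpace Γ) : denseStopTime E u ω ≤ u :=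
  (ENNReal.toNNReal_mono ENNReal.coe_ne_top (min_le_left _ _)).trans (ENNReal.toNNReal_coe u).le

variable [PolishSpace Γ] [BorelSpace Γ]

theorem measurable_canon_denseStop (hX : ∀ s ≤ u, Measurable[m] (canon s : PathSpace Γ → Γ))
    {E : Set Γ} (hE : MeasurableSet E) : Measurable[m] fun ω => canon u (denseStop E ω) := by
  have hσ := measurable_denseStopTime hX hE
  -- The stopping time is approximated from the right by grid points, for right continuity; the cap
  -- at u keeps the approximations within the coordinates that m knows.
  refine measurable_of_tendsto_metrizable (f := fun (k : ℕ) ω =>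
    canon (min u (((⌊denseStopTime E u ω * (k + 1)⌋₊ + 1 : ℕ) : ℝ≥0) / (k + 1))) ω)
    (fun k => ?_) ?_
  · have h1 : Measurable fun z : ℕ × PathSpace Γ => canon (min u ((z.1 : ℝ≥0) / (k + 1))) z.2 :=
      measurable_from_prod_countable_right fun j =>
        hX (min u ((j : ℝ≥0) / (k + 1))) (min_le_left _ _)
    have h2 : Measurable[m] fun ω => ⌊denseStopTime E u ω * (k + 1)⌋₊ + 1 :=
      (Nat.measurable_floor.comp (hσ.mul_const _)).add_const 1
    exact h1.comp (h2.prodMk measurable_id)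
  · rw [tendsto_pi_nhds]
    intro ω
    set s := denseStopTime E u ω with hs
    have h1 : Tendsto (fun k : ℕ => min u (((⌊s * (k + 1)⌋₊ + 1 : ℕ) : ℝ≥0) / (k + 1))) atTop
        (𝓝[≥] s) := by
      have hle : ∀ k : ℕ, s ≤ ((⌊s * (k + 1)⌋₊ + 1 : ℕ) : ℝ≥0) / (k + 1) := by
        intro k
        rw [le_div_iff₀ (by positivity)]
        push_cast
        exact (Nat.lt_floor_add_one _).le
      refine tendsto_nhdsWithin_iff.2 ⟨?_, Eventually.of_forall fun k =>
        le_min (denseStopTime_le E u ω) (hle k)⟩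
      have h2 : Tendsto (fun k : ℕ => s + 1 / ((k : ℝ≥0) + 1)) atTop (𝓝 (s + 0)) :=
        tendsto_const_nhds.add tendsto_one_div_add_atTop_nhds_zero_nat
      rw [add_zero] at h2
      refine tendsto_of_tendsto_of_tendsto_of_le_of_le tendsto_const_nhds h2
        (fun k => le_min (denseStopTime_le E u ω) (hle k))
        (fun k => (min_le_right _ _).trans ?_)
      rw [div_le_iff₀ (by positivity), add_mul, one_div, inv_mul_cancel₀ (by positivity)]
      push_cast
      gcongr
      exact Nat.floor_le zero_le
    exact ((ω.2 s).1.tendsto).comp h1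

end

variable {𝔉 : Filtration ℝ≥0 (inferInstance : MeasurableSpace (PathSpace Γ))}

theorem measurableSet_predictable_aliveSet
    (hX : ∀ t, Measurable[𝔉 t] (canon t : PathSpace Γ → Γ)) {E : Set Γ} (hE : MeasurableSet E) :
    MeasurableSet[𝔉.predictable] (aliveSet E) := by
  have : aliveSet E =
      ⋂ i, (Ioi (denseTime i) ×ˢ ((canon (denseTime i) : PathSpace Γ → Γ) ⁻¹' E))ᶜ := by
    ext z
    simp [aliveSet, canon]
  rw [this]
  exact MeasurableSet.iInter fun i => (measurableSet_predictable_Ioi_prod (hX _ hE)).compl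

variable [PolishSpace Γ] [BorelSpace Γ]

theorem measurable_denseStop {E : Set Γ} (hE : MeasurableSet E) : Measurable (denseStop E) := by
  refine Measurable.subtype_mk (measurable_pi_lambda _ fun u => ?_)
  exact measurable_canon_denseStop (u := u) (fun s _ => measurable_canon s) hE

theorem measurable_predictable_canonLeft
    (hX : ∀ t, Measurable[𝔉 t] (canon t : PathSpace Γ → Γ)) :
    Measurable[𝔉.predictable] fun z : ℝ≥0 × PathSpace Γ => canonLeft z.1 z.2 :=
  measurable_predictable_of_tendsto hX canonLeft_zero fun ω _ hu => tendsto_leftLim ω hu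

theorem measurable_predictable_canonLeft_denseStop
    (hX : ∀ t, Measurable[𝔉 t] (canon t : PathSpace Γ → Γ)) {E : Set Γ} (hE : MeasurableSet E) :
    Measurable[𝔉.predictable] fun z : ℝ≥0 × PathSpace Γ => canonLeft z.1 (denseStop E z.2) :=
  measurable_predictable_of_tendsto (Y := fun t ω => canon t (denseStop E ω))
    (Z := fun t ω => canonLeft t (denseStop E ω))
    (fun _ => measurable_canon_denseStop (fun s hs => (hX s).mono (𝔉.mono hs) le_rfl) hE)
    (fun _ => canonLeft_zero _) fun _ _ hu => tendsto_leftLim _ hu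

end Stopping

/-! ### The compensation formula -/

section Compensation

variable {Γ : Type*} [TopologicalSpace Γ] [MeasurableSpace Γ]

/-- The integral of `H` against `L(X_{s-}, dy) ds` on `(0, t] × Γ`. -/
def rateIntegral (L : Kernel Γ Γ) (t : ℝ≥0) (H : (ℝ≥0 × PathSpace Γ) × Γ → ℝ≥0∞)
    (ω : PathSpace Γ) : ℝ≥0∞ :=
  ∫⁻ s in Ioc (0 : ℝ) t, ∫⁻ y, H ((s.toNNReal, ω), y) ∂(L (canonLeft s.toNNReal ω))

/-- The sum of `H` over the jumps up to time `t`. -/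
def jumpIntegral (t : ℝ≥0) (H : (ℝ≥0 × PathSpace Γ) × Γ → ℝ≥0∞) (ω : PathSpace Γ) : ℝ≥0∞ :=
  jumpSum ω.1 ((Iic t).indicator fun u => H ((u, ω), ω.1 u))

/-- Under `P` the jumps have the compensator `k L(X_{s-}, dy) ds`. -/
def CompensationFormula (L : Kernel Γ Γ)
    (𝔉 : Filtration ℝ≥0 (inferInstance : MeasurableSpace (PathSpace Γ)))
    (P : Measure (PathSpace Γ)) (k : (ℝ≥0 × PathSpace Γ) × Γ → ℝ≥0∞) : Prop :=
  ∀ (t : ℝ≥0) (H : (ℝ≥0 × PathSpace Γ) × Γ → ℝ≥0∞),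
    Measurable[𝔉.predictable.prod inferInstance] H →
    ∫⁻ ω, jumpIntegral t H ω ∂P = ∫⁻ ω, rateIntegral L t (fun z => H z * k z) ω ∂P

/-! ### Algebra and measurability of jump sums and rate integrals -/

section RateIntegral

theorem measurable_lintegral_rate {Γ : Type*} [MeasurableSpace Γ] {L : Kernel Γ Γ} [IsSFiniteKernel L] {Z : Type*}
    {mZ : MeasurableSpace Z} {l : Z → Γ}
    (hl : Measurable l) {H : Z × Γ → ℝ≥0∞} (hH : Measurable H) :
    Measurable fun z => ∫⁻ y, H (z, y) ∂(L (l z)) :=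
  Measurable.lintegral_kernel_prod_right' (κ := L.comap l hl) hH

theorem rateIntegral_congr {L : Kernel Γ Γ} {t : ℝ≥0} {H H' : (ℝ≥0 × PathSpace Γ) × Γ → ℝ≥0∞} {ω : PathSpace Γ}
    (h : ∀ u, 0 < u → u ≤ t → ∀ y, H ((u, ω), y) = H' ((u, ω), y)) :
    rateIntegral L t H ω = rateIntegral L t H' ω := by
  refine setLIntegral_congr_fun measurableSet_Ioc fun s hs => ?_
  refine lintegral_congr fun y => h _ (Real.toNNReal_pos.2 hs.1) ?_ y
  exact Real.toNNReal_le_iff_le_coe.2 hs.2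

theorem jumpIntegral_congr {t : ℝ≥0} {H H' : (ℝ≥0 × PathSpace Γ) × Γ → ℝ≥0∞} {ω : PathSpace Γ}
    (h : ∀ u ∈ jumpSet ω.1, u ≤ t → H ((u, ω), ω.1 u) = H' ((u, ω), ω.1 u)) :
    jumpIntegral t H ω = jumpIntegral t H' ω := by
  refine jumpSum_congr fun u hu => ?_
  by_cases h3 : u ≤ t
  · simp [h3, h u hu h3]
  · simp [h3]

theorem jumpIntegral_add (t : ℝ≥0) (H H' : (ℝ≥0 × PathSpace Γ) × Γ → ℝ≥0∞) (ω : PathSpace Γ) :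
    jumpIntegral t (fun z => H z + H' z) ω = jumpIntegral t H ω + jumpIntegral t H' ω := by
  rw [jumpIntegral, jumpIntegral, jumpIntegral, ← jumpSum_add]
  refine jumpSum_congr fun u _ => ?_
  by_cases h3 : u ≤ t <;> simp [h3]

theorem jumpIntegral_const_mul (t : ℝ≥0) (H : (ℝ≥0 × PathSpace Γ) × Γ → ℝ≥0∞)
    (c : PathSpace Γ → ℝ≥0∞) (ω : PathSpace Γ) :
    jumpIntegral t (fun z => c z.1.2 * H z) ω = c ω * jumpIntegral t H ω := by
  rw [jumpIntegral, jumpIntegral, ← jumpSum_const_mul]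
  refine jumpSum_congr fun u _ => ?_
  by_cases h3 : u ≤ t <;> simp [h3]

theorem jumpIntegral_lt_top [T2Space Γ] {t : ℝ≥0} {H : (ℝ≥0 × PathSpace Γ) × Γ → ℝ≥0∞}
    (hH : ∀ z, H z < ∞) {ω : PathSpace Γ} (hω : IsPureJump ω.1) : jumpIntegral t H ω < ∞ := by
  refine hω.jumpSum_lt_top (f := (Iic t).indicator fun u => H ((u, ω), ω.1 u)) (t := t) ?_ ?_
  · intro u hu
    simp [indicator, not_le.2 hu]
  · intro u
    by_cases h3 : u ≤ t <;> simp [indicator, h3, hH]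

theorem rateIntegral_le {L : Kernel Γ Γ} (t : ℝ≥0) {H : (ℝ≥0 × PathSpace Γ) × Γ → ℝ≥0∞} {c : ℝ≥0∞}
    (hH : ∀ z, H z ≤ c) (ω : PathSpace Γ) : rateIntegral L t H ω ≤ c * L.bound * t := by
  calc rateIntegral L t H ω ≤ ∫⁻ _ in Ioc (0 : ℝ) t, c * L.bound := by
        refine lintegral_mono fun s => ?_
        calc _ ≤ ∫⁻ _, c ∂(L (canonLeft s.toNNReal ω)) := lintegral_mono fun y => hH _
          _ ≤ c * L.bound := by
            rw [lintegral_const]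
            gcongr
            exact Kernel.measure_le_bound _ _ _
    _ = c * L.bound * t := by simp

variable [PolishSpace Γ] [BorelSpace Γ]

theorem measurable_canonLeft :
    Measurable fun z : ℝ≥0 × PathSpace Γ => canonLeft z.1 z.2 :=
  (measurable_predictable_canonLeft (𝔉 := ⊤) measurable_canon).mono predictable_le_prod le_rfl

theorem measurable_canonLeft_left (ω : PathSpace Γ) : Measurable fun u => canonLeft u ω :=
  measurable_canonLeft.comp measurable_prodMk_right

variable {L : Kernel Γ Γ} [IsFiniteKernel L]

section

variable {H : (ℝ≥0 × PathSpace Γ) × Γ → ℝ≥0∞}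

theorem measurable_rate_left {ω : PathSpace Γ} (hH : Measurable fun z : ℝ≥0 × Γ => H ((z.1, ω), z.2)) :
    Measurable fun s : ℝ =>
      ∫⁻ y, H ((s.toNNReal, ω), y) ∂(L (canonLeft s.toNNReal ω)) := by
  have h2 : Measurable fun u : ℝ≥0 => ∫⁻ y, H ((u, ω), y) ∂(L (canonLeft u ω)) :=
    measurable_lintegral_rate (H := fun z => H ((z.1, ω), z.2)) (measurable_canonLeft_left ω) hH
  exact h2.comp measurable_real_toNNReal

theorem measurable_section_left (hH : Measurable H) (ω : PathSpace Γ) :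
    Measurable fun z : ℝ≥0 × Γ => H ((z.1, ω), z.2) := by
  refine hH.comp (Measurable.prodMk (measurable_prodMk_right.comp measurable_fst) measurable_snd)

theorem rateIntegral_add (t : ℝ≥0) (hH : Measurable H) (H' : (ℝ≥0 × PathSpace Γ) × Γ → ℝ≥0∞)
    (ω : PathSpace Γ) :
    rateIntegral L t (fun z => H z + H' z) ω = rateIntegral L t H ω + rateIntegral L t H' ω := by
  rw [rateIntegral, rateIntegral, rateIntegral,
    ← lintegral_add_left (measurable_rate_left (measurable_section_left hH ω))]
  refine lintegral_congr fun s => lintegral_add_left ?_ _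
  exact hH.comp measurable_prodMk_left

theorem rateIntegral_const_mul (t : ℝ≥0) (hH : Measurable H) (c : PathSpace Γ → ℝ≥0∞)
    (ω : PathSpace Γ) :
    rateIntegral L t (fun z => c z.1.2 * H z) ω = c ω * rateIntegral L t H ω := by
  rw [rateIntegral, rateIntegral,
    ← lintegral_const_mul _ (measurable_rate_left (measurable_section_left hH ω))]
  refine lintegral_congr fun s => lintegral_const_mul (c ω) ?_
  exact hH.comp measurable_prodMk_left

end

theorem rateIntegral_iSup (t : ℝ≥0) {f : ℕ → (ℝ≥0 × PathSpace Γ) × Γ → ℝ≥0∞}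
    (hf : ∀ n, Measurable (f n)) (hmono : Monotone f) (ω : PathSpace Γ) :
    rateIntegral L t (fun z => ⨆ n, f n z) ω = ⨆ n, rateIntegral L t (f n) ω := by
  simp only [rateIntegral]
  rw [← lintegral_iSup (fun n => measurable_rate_left (measurable_section_left (hf n) ω))]
  · refine lintegral_congr fun s => lintegral_iSup (fun n => ?_) fun m n hmn y => hmono hmn _
    exact (hf n).comp measurable_prodMk_left
  · exact fun m n hmn s => lintegral_mono fun y => hmono hmn _

theorem rateIntegral_tsum (t : ℝ≥0) {f : ℕ → (ℝ≥0 × PathSpace Γ) × Γ → ℝ≥0∞}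
    (hf : ∀ n, Measurable (f n)) (ω : PathSpace Γ) :
    rateIntegral L t (fun z => ∑' n, f n z) ω = ∑' n, rateIntegral L t (f n) ω := by
  simp only [rateIntegral]
  rw [← lintegral_tsum
    (fun n => (measurable_rate_left (measurable_section_left (hf n) ω)).aemeasurable)]
  refine lintegral_congr fun s => lintegral_tsum (fun n => ?_)
  exact ((hf n).comp measurable_prodMk_left).aemeasurable

/-- Only times s ≤ t contribute, so s may be replaced by min s t; the hypotheses ask for
measurability after this replacement. -/
theorem measurable_rateIntegral_of_prod {m : MeasurableSpace (PathSpace Γ)} (t : ℝ≥0)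
    {H : (ℝ≥0 × PathSpace Γ) × Γ → ℝ≥0∞}
    (hl : @Measurable _ _ (MeasurableSpace.prod inferInstance m) _
      fun z : ℝ≥0 × PathSpace Γ => canonLeft (min z.1 t) z.2)
    (hH : Measurable[(MeasurableSpace.prod inferInstance m).prod inferInstance]
      fun z : (ℝ≥0 × PathSpace Γ) × Γ => H ((min z.1.1 t, z.1.2), z.2)) :
    Measurable[m] (rateIntegral L t H) := by
  have h1 := measurable_lintegral_rate (L := L) hl hH
  have h2 : @Measurable _ _ (MeasurableSpace.prod m inferInstance) _ fun z : PathSpace Γ × ℝ =>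
      ∫⁻ y, H ((min z.2.toNNReal t, z.1), y) ∂(L (canonLeft (min z.2.toNNReal t) z.1)) :=
    h1.comp (Measurable.prodMk (measurable_real_toNNReal.comp measurable_snd) measurable_fst)
  have h3 := Measurable.lintegral_prod_right' (ν := volume.restrict (Ioc (0 : ℝ) t)) h2
  refine measurable_of_forall_eq h3 fun ω => ?_
  refine setLIntegral_congr_fun measurableSet_Ioc fun s hs => ?_
  have : min s.toNNReal t = s.toNNReal := min_eq_left (Real.toNNReal_le_iff_le_coe.2 hs.2)
  simp only [this]

variable {𝔉 : Filtration ℝ≥0 (inferInstance : MeasurableSpace (PathSpace Γ))}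
  {H : (ℝ≥0 × PathSpace Γ) × Γ → ℝ≥0∞}

theorem measurable_min_predictable_prod (t : ℝ≥0)
    (hH : Measurable[𝔉.predictable.prod inferInstance] H) :
    Measurable[(MeasurableSpace.prod inferInstance (𝔉 t)).prod inferInstance]
      fun z : (ℝ≥0 × PathSpace Γ) × Γ => H ((min z.1.1 t, z.1.2), z.2) := by
  have h1 := measurable_min_predictable (𝔉 := 𝔉) t
  refine hH.comp (Measurable.prodMk ?_ (measurable_snd))
  exact h1.comp measurable_fst

theorem measurable_of_predictable (hH : Measurable[𝔉.predictable.prod inferInstance] H) :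
    Measurable H :=
  hH.mono (sup_le_sup (MeasurableSpace.comap_mono predictable_le_prod) le_rfl) le_rfl

theorem measurable_rateIntegral (hX : ∀ t, Measurable[𝔉 t] (canon t : PathSpace Γ → Γ)) (t : ℝ≥0)
    (hH : Measurable[𝔉.predictable.prod inferInstance] H) :
    Measurable[𝔉 t] (rateIntegral L t H) :=
  measurable_rateIntegral_of_prod t
    ((measurable_predictable_canonLeft hX).comp (measurable_min_predictable t))
    (measurable_min_predictable_prod t hH)

theorem exists_measurable_eq_jumpIntegral (hX : ∀ t, Measurable[𝔉 t] (canon t : PathSpace Γ → Γ))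
    (t : ℝ≥0) (hH : Measurable[𝔉.predictable.prod inferInstance] H) :
    ∃ Y : PathSpace Γ → ℝ≥0∞, Measurable[𝔉 t] Y ∧ ∀ ω : PathSpace Γ, IsPureJump ω.1 →
      jumpIntegral t H ω = Y ω := by
  obtain ⟨Y, hY, h⟩ := exists_measurable_eq_jumpSum
    (fun u hu => (hX u).mono (𝔉.mono hu) le_rfl) (measurable_min_predictable_prod t hH)
  refine ⟨Y, hY, fun ω hω => ?_⟩
  rw [← h ω hω]
  refine jumpSum_congr fun u _ => ?_
  by_cases h3 : u ≤ t <;> simp [h3]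

theorem aemeasurable_jumpIntegral (hX : ∀ t, Measurable[𝔉 t] (canon t : PathSpace Γ → Γ))
    (t : ℝ≥0) (hH : Measurable[𝔉.predictable.prod inferInstance] H) {P : Measure (PathSpace Γ)}
    (hP : ∀ᵐ ω ∂P, IsPureJump ω.1) : AEMeasurable (jumpIntegral t H) P := by
  obtain ⟨Y, hY, h⟩ := exists_measurable_eq_jumpIntegral hX t hH
  exact ⟨Y, hY.mono (𝔉.le t) le_rfl, hP.mono fun ω hω => h ω hω⟩

end RateIntegral

end Compensation

/-! ### From the martingale problem to the compensation formula -/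

section MartingaleToCompensation

variable {Γ : Type*} [TopologicalSpace Γ] [PolishSpace Γ] [MeasurableSpace Γ] [BorelSpace Γ]

theorem tsum_jumpTimes {ω : PathSpace Γ} (hω : IsPureJump ω.1) (t : ℝ≥0) (f : ℝ≥0 → ℝ) :
    ∑' s : jumpTimes t ω, f s = ∑ u ∈ (hω.finite_jumpSet t).toFinset, f u := by
  have : jumpTimes t ω = ((hω.finite_jumpSet t).toFinset : Set ℝ≥0) := by
    rw [Finite.coe_toFinset]
    ext u
    simp only [jumpTimes, jumpSet, mem_ofPred_eq, mem_inter_iff, mem_Iic, canon, canonLeft]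
    exact and_comm
  rw [tsum_congr_set_coe f this, Finset.tsum_subtype']

theorem tsum_jumpTimes_eq_toReal {ω : PathSpace Γ} (hω : IsPureJump ω.1) (t : ℝ≥0) {f : ℝ≥0 → ℝ}
    (hf : ∀ u, 0 ≤ f u) : ∑' s : jumpTimes t ω, f s =
      (jumpSum ω.1 ((Iic t).indicator fun u => ENNReal.ofReal (f u))).toReal := by
  rw [tsum_jumpTimes hω, hω.jumpSum_eq_sum (t := t), ENNReal.toReal_sum]
  · refine Finset.sum_congr rfl fun u hu => ?_
    rw [Finite.mem_toFinset] at hu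
    rw [indicator_of_mem hu.2, ENNReal.toReal_ofReal (hf u)]
  · intro u _
    by_cases h : u ≤ t <;> simp [indicator, h]
  · intro u hu
    simp [indicator, not_le.2 hu]

/-- The integrand on `(time × path) × Γ` corresponding to `φ_s(X_{s-}, y)`. -/
def pathIntegrand (φ : ℝ≥0 × Γ × Γ → ℝ) (z : (ℝ≥0 × PathSpace Γ) × Γ) : ℝ≥0∞ :=
  ENNReal.ofReal (φ (z.1.1, canonLeft z.1.1 z.1.2, z.2))

theorem measurable_pathIntegrand
    {𝔉 : Filtration ℝ≥0 (inferInstance : MeasurableSpace (PathSpace Γ))}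
    (hX : ∀ t, Measurable[𝔉 t] (canon t : PathSpace Γ → Γ)) {φ : ℝ≥0 × Γ × Γ → ℝ}
    (hφ : Measurable φ) :
    Measurable[𝔉.predictable.prod inferInstance] (pathIntegrand φ) := by
  have h1 := measurable_predictable_canonLeft hX
  have h2 : Measurable[𝔉.predictable] (Prod.fst : ℝ≥0 × PathSpace Γ → ℝ≥0) := by
    have := measurable_predictable_of_tendsto (𝔉 := 𝔉) (Y := fun t _ => t) (Z := fun t _ => t)
      (fun t => measurable_const) (fun _ => rfl)
      fun _ u _ => tendsto_id.mono_left nhdsWithin_le_nhds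
    exact this
  refine ENNReal.measurable_ofReal.comp (hφ.comp ?_)
  exact (h2.comp measurable_fst).prodMk ((h1.comp measurable_fst).prodMk measurable_snd)

theorem measurable_predictable_indicator_one
    {𝔉 : Filtration ℝ≥0 (inferInstance : MeasurableSpace (PathSpace Γ))}
    {E : Set ((ℝ≥0 × PathSpace Γ) × Γ)} (hE : MeasurableSet[𝔉.predictable.prod inferInstance] E) :
    Measurable[𝔉.predictable.prod inferInstance]
      (E.indicator (1 : (ℝ≥0 × PathSpace Γ) × Γ → ℝ≥0∞)) := by
  have h : Measurable[𝔉.predictable.prod inferInstance]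
    (fun _ : (ℝ≥0 × PathSpace Γ) × Γ => (1 : ℝ≥0∞)) := measurable_const
  exact h.indicator hE

variable {L : Kernel Γ Γ} [IsFiniteKernel L]

theorem rateIntegral_lt_top {t : ℝ≥0} {H : (ℝ≥0 × PathSpace Γ) × Γ → ℝ≥0∞} {c : ℝ≥0∞}
    (hc : c ≠ ∞) (hH : ∀ z, H z ≤ c) (ω : PathSpace Γ) : rateIntegral L t H ω < ∞ :=
  (rateIntegral_le t hH ω).trans_lt <|
    ENNReal.mul_lt_top (ENNReal.mul_lt_top hc.lt_top L.bound_lt_top) ENNReal.coe_lt_top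

theorem integral_eq_toReal_of_eq_withDensity {ω : PathSpace Γ} {u : ℝ≥0}
    {K : PathSpace Γ → ℝ≥0 → Measure Γ} {k : (ℝ≥0 × PathSpace Γ) × Γ → ℝ≥0∞} (hk : Measurable k)
    (hK : K ω u = (L (canonLeft u ω)).withDensity fun y => k ((u, ω), y))
    {φ : ℝ≥0 × Γ × Γ → ℝ} (hφ : Measurable φ) (h0 : ∀ z, 0 ≤ φ z) :
    ∫ y, φ (u, canonLeft u ω, y) ∂K ω u =
      (∫⁻ y, pathIntegrand φ ((u, ω), y) * k ((u, ω), y) ∂L (canonLeft u ω)).toReal := by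
  have hm : Measurable fun y => φ (u, canonLeft u ω, y) := hφ.comp (by fun_prop)
  rw [integral_eq_lintegral_of_nonneg_ae (ae_of_all _ fun _ => h0 _) hm.aestronglyMeasurable, hK,
    lintegral_withDensity_eq_lintegral_mul _
      (show Measurable fun y => k ((u, ω), y) from hk.comp measurable_prodMk_left)
      (show Measurable fun y => ENNReal.ofReal (φ (u, canonLeft u ω, y)) from
        ENNReal.measurable_ofReal.comp hm)]
  congr 1
  refine lintegral_congr fun y => ?_
  simp [pathIntegrand, mul_comm]

/-- For a nonnegative integrand, the compensated sum as a difference of Lebesgue integrals. -/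
theorem compensatedSum_eq {ω : PathSpace Γ} (hω : IsPureJump ω.1) {t : ℝ≥0}
    {K : PathSpace Γ → ℝ≥0 → Measure Γ} {k : (ℝ≥0 × PathSpace Γ) × Γ → ℝ≥0∞} (hk : Measurable k)
    {c : ℝ≥0∞} (hc : c ≠ ∞) (hkc : ∀ z, k z ≤ c)
    (hK : ∀ᵐ s : ℝ, s ∈ Ioc (0 : ℝ) t → K ω s.toNNReal =
      (L (canonLeft s.toNNReal ω)).withDensity fun y => k ((s.toNNReal, ω), y))
    {φ : ℝ≥0 × Γ × Γ → ℝ} (hφ : Measurable φ) (h0 : ∀ z, 0 ≤ φ z) {C : ℝ} (hC : ∀ z, φ z ≤ C) :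
    compensatedSum K φ t ω = (jumpIntegral t (pathIntegrand φ) ω).toReal -
      (rateIntegral L t (fun z => pathIntegrand φ z * k z) ω).toReal := by
  have hpi : Measurable (pathIntegrand φ : (ℝ≥0 × PathSpace Γ) × Γ → ℝ≥0∞) :=
    measurable_of_predictable (𝔉 := ⊤) (measurable_pathIntegrand measurable_canon hφ)
  rw [compensatedSum, tsum_jumpTimes_eq_toReal hω t
    (f := fun s => φ (s, canonLeft s ω, canon s ω)) fun _ => h0 _]
  congr 1
  have h1 : ∫ s in Ioc (0 : ℝ) t, ∫ y, φ (s.toNNReal, canonLeft s.toNNReal ω, y) ∂K ω s.toNNReal =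
      ∫ s in Ioc (0 : ℝ) t, (∫⁻ y, pathIntegrand φ ((s.toNNReal, ω), y) * k ((s.toNNReal, ω), y)
        ∂L (canonLeft s.toNNReal ω)).toReal := by
    refine integral_congr_ae ?_
    filter_upwards [(ae_restrict_iff' measurableSet_Ioc).2 hK] with s hs
    exact integral_eq_toReal_of_eq_withDensity hk hs hφ h0
  rw [h1, integral_toReal]
  · rfl
  · exact (measurable_rate_left (H := fun z => pathIntegrand φ z * k z)
      (measurable_section_left (hpi.mul hk) ω)).aemeasurable
  · refine ae_of_all _ fun s => ?_
    calc _ ≤ ∫⁻ _, ENNReal.ofReal C * c ∂L (canonLeft s.toNNReal ω) :=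
          lintegral_mono fun y => mul_le_mul' (ENNReal.ofReal_le_ofReal (hC _)) (hkc _)
      _ < ∞ := by
        rw [lintegral_const]
        exact ENNReal.mul_lt_top (ENNReal.mul_lt_top ENNReal.ofReal_lt_top hc.lt_top)
          (measure_lt_top _ _)

variable {𝔉 : Filtration ℝ≥0 (inferInstance : MeasurableSpace (PathSpace Γ))}
  {P : Measure (PathSpace Γ)}

/-- The martingale of the indicator of (r, ∞) × C vanishes at time r, so its mean over an event F
known at r is zero at time t as well. -/
theorem lintegral_jumpIntegral_rect [IsProbabilityMeasure P]
    (hP : ∀ᵐ ω ∂P, IsPureJump ω.1) (hX : ∀ t, Measurable[𝔉 t] (canon t : PathSpace Γ → Γ))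
    (hM : ∀ φ : ℝ≥0 × Γ × Γ → ℝ, Measurable φ → (∃ C : ℝ, ∀ z, |φ z| ≤ C) →
      ∃ M : ℝ≥0 → PathSpace Γ → ℝ,
        Martingale M 𝔉 P ∧ ∀ t, M t =ᵐ[P] compensatedSum (refKernel L) φ t)
    (t r : ℝ≥0) {F : Set (PathSpace Γ)} (hF : MeasurableSet[𝔉 r] F) {C : Set Γ}
    (hC : MeasurableSet C) :
    ∫⁻ ω, jumpIntegral t (((Ioi r ×ˢ F) ×ˢ C).indicator 1) ω ∂P =
      ∫⁻ ω, rateIntegral L t (((Ioi r ×ˢ F) ×ˢ C).indicator 1) ω ∂P := by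
  rcases le_or_gt t r with htr | hrt
  · have h1 : ∀ ω : PathSpace Γ, jumpIntegral t (((Ioi r ×ˢ F) ×ˢ C).indicator 1) ω = 0 := by
      intro ω
      rw [← jumpSum_zero ω.1]
      refine jumpSum_congr fun u _ => ?_
      by_cases h : u ≤ t
      · simp [indicator, h, not_lt.2 (h.trans htr)]
      · simp [indicator, h]
    have h2 : ∀ ω : PathSpace Γ, rateIntegral L t (((Ioi r ×ˢ F) ×ˢ C).indicator 1) ω = 0 := by
      intro ω
      rw [rateIntegral_congr (H' := fun _ => 0)]
      · simp [rateIntegral]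
      · intro u _ hu y
        simp [indicator, not_lt.2 (hu.trans htr)]
    simp only [h1, h2]
  have hFm : MeasurableSet F := 𝔉.le r _ hF
  set φ : ℝ≥0 × Γ × Γ → ℝ := (Ioi r ×ˢ (univ ×ˢ C)).indicator 1 with hφdef
  have hφ : Measurable φ :=
    measurable_one.indicator (measurableSet_Ioi.prod (MeasurableSet.univ.prod hC))
  have h0 : ∀ z, 0 ≤ φ z := fun z => indicator_nonneg (fun _ _ => zero_le_one) z
  have h1 : ∀ z, φ z ≤ 1 := fun z => indicator_le_self' (fun _ _ => zero_le_one) z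
  obtain ⟨M, hMm, hMe⟩ := hM φ hφ ⟨1, fun z => by rw [abs_of_nonneg (h0 z)]; exact h1 z⟩
  have hdecomp : ∀ z, ((Ioi r ×ˢ F) ×ˢ C).indicator (1 : (ℝ≥0 × PathSpace Γ) × Γ → ℝ≥0∞) z =
      F.indicator 1 z.1.2 * pathIntegrand φ z := by
    rintro ⟨⟨u, ω⟩, y⟩
    by_cases hω : ω ∈ F <;> by_cases hu : r < u <;> by_cases hy : y ∈ C <;>
      simp [pathIntegrand, φ, indicator, hω, hu, hy]
  have hpred := measurable_pathIntegrand hX hφ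
  have hpi := measurable_of_predictable hpred
  set S : PathSpace Γ → ℝ≥0∞ := jumpIntegral t (pathIntegrand φ)
  set A : PathSpace Γ → ℝ≥0∞ := rateIntegral L t (pathIntegrand φ)
  have hSm : AEMeasurable S P := aemeasurable_jumpIntegral hX t hpred hP
  have hAm : Measurable A := (measurable_rateIntegral hX t hpred).mono (𝔉.le t) le_rfl
  have hpi1 : ∀ z : (ℝ≥0 × PathSpace Γ) × Γ, pathIntegrand φ z ≤ 1 := fun z => by
    rw [← ENNReal.ofReal_one]
    exact ENNReal.ofReal_le_ofReal (h1 _)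
  have hAlt : ∀ ω, A ω < ∞ := rateIntegral_lt_top ENNReal.one_ne_top hpi1
  have hSlt : ∀ᵐ ω ∂P, S ω < ∞ := hP.mono fun ω hω =>
    jumpIntegral_lt_top (fun z => (hpi1 z).trans_lt ENNReal.one_lt_top) hω
  have hcs : ∀ s, ∀ᵐ ω ∂P, M s ω = (jumpIntegral s (pathIntegrand φ) ω).toReal -
      (rateIntegral L s (pathIntegrand φ) ω).toReal := by
    intro s
    filter_upwards [hMe s, hP] with ω h2 h3
    rw [h2, compensatedSum_eq (L := L) h3 (k := fun _ => 1) measurable_const ENNReal.one_ne_top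
      (fun _ => le_rfl) (by simp [refKernel]) hφ h0 h1]
    simp
  have hAint : Integrable (fun ω => (A ω).toReal) P := by
    refine integrable_toReal_of_lintegral_ne_top hAm.aemeasurable ?_
    have : ∫⁻ ω, A ω ∂P ≤ ∫⁻ _, 1 * L.bound * t ∂P := lintegral_mono fun ω => rateIntegral_le t hpi1 ω
    refine (this.trans_lt ?_).ne
    rw [lintegral_const, measure_univ, mul_one]
    exact ENNReal.mul_lt_top (ENNReal.mul_lt_top ENNReal.one_lt_top L.bound_lt_top)
      ENNReal.coe_lt_top
  -- Integrability of the number of jumps is not assumed: it follows from that of the martingale and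
  -- of the bounded compensator.
  have hSint : Integrable (fun ω => (S ω).toReal) P := by
    refine ((hMm.integrable t).add hAint).congr ?_
    filter_upwards [hcs t] with ω h2
    simp only [Pi.add_apply, h2]
    exact sub_add_cancel _ _
  have hMr : ∫ ω in F, M r ω ∂P = 0 := by
    refine integral_eq_zero_of_ae (ae_restrict_of_ae ?_)
    filter_upwards [hcs r] with ω h2
    have h3 : jumpIntegral r (pathIntegrand φ) ω = 0 := by
      rw [← jumpSum_zero ω.1]
      refine jumpSum_congr fun u _ => ?_
      by_cases h : u ≤ r
      · simp [indicator, h, pathIntegrand, hφdef]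
      · simp [indicator, h]
    have h4 : rateIntegral L r (pathIntegrand φ) ω = 0 := by
      rw [rateIntegral_congr (H' := fun _ => 0)]
      · simp [rateIntegral]
      · intro u _ hu y
        simp [not_lt.2 hu, pathIntegrand, hφdef]
    simp [h2, h3, h4]
  have hMt : ∫ ω in F, (S ω).toReal ∂P = ∫ ω in F, (A ω).toReal ∂P := by
    have h2 := hMm.setIntegral_eq hrt.le hF
    rw [hMr] at h2
    have h3 : ∫ ω in F, M t ω ∂P = ∫ ω in F, ((S ω).toReal - (A ω).toReal) ∂P :=
      integral_congr_ae (ae_restrict_of_ae (hcs t))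
    rw [h3, integral_sub hSint.integrableOn hAint.integrableOn] at h2
    linarith
  have hL : ∫⁻ ω in F, S ω ∂P = ∫⁻ ω in F, A ω ∂P := by
    rw [integral_toReal hSm.restrict (ae_restrict_of_ae hSlt),
      integral_toReal hAm.aemeasurable (ae_of_all _ hAlt)] at hMt
    have hfinS : ∫⁻ ω in F, S ω ∂P ≠ ∞ := by
      have h5 := (hasFiniteIntegral_iff_ofReal (ae_of_all _ fun ω => ENNReal.toReal_nonneg)).1
        hSint.2
      refine (lt_of_le_of_lt (setLIntegral_le_lintegral F S) (lt_of_eq_of_lt ?_ h5)).ne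
      exact lintegral_congr_ae (hSlt.mono fun ω h6 => (ENNReal.ofReal_toReal h6.ne).symm)
    have hfinA : ∫⁻ ω in F, A ω ∂P ≠ ∞ := by
      have h5 := (hasFiniteIntegral_iff_ofReal (ae_of_all _ fun ω => ENNReal.toReal_nonneg)).1
        hAint.2
      refine (lt_of_le_of_lt (setLIntegral_le_lintegral F A) (lt_of_eq_of_lt ?_ h5)).ne
      exact lintegral_congr fun ω => (ENNReal.ofReal_toReal (hAlt ω).ne).symm
    exact (ENNReal.toReal_eq_toReal_iff' hfinS hfinA).1 hMt
  have e1 : ∀ ω, jumpIntegral t (((Ioi r ×ˢ F) ×ˢ C).indicator 1) ω = F.indicator S ω := by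
    intro ω
    rw [show ((Ioi r ×ˢ F) ×ˢ C).indicator (1 : (ℝ≥0 × PathSpace Γ) × Γ → ℝ≥0∞) = _ from funext hdecomp,
      jumpIntegral_const_mul]
    by_cases hω : ω ∈ F <;> simp [hω, S]
  have e2 : ∀ ω, rateIntegral L t (((Ioi r ×ˢ F) ×ˢ C).indicator 1) ω = F.indicator A ω := by
    intro ω
    rw [show ((Ioi r ×ˢ F) ×ˢ C).indicator (1 : (ℝ≥0 × PathSpace Γ) × Γ → ℝ≥0∞) = _ from funext hdecomp,
      rateIntegral_const_mul t hpi]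
    by_cases hω : ω ∈ F <;> simp [hω, A]
  simp only [e1, e2]
  rw [lintegral_indicator hFm, lintegral_indicator hFm, hL]

theorem isPiSystem_predictable :
    IsPiSystem ({s | ∃ A, MeasurableSet[𝔉 ⊥] A ∧ s = {⊥} ×ˢ A} ∪
      {s | ∃ i A, MeasurableSet[𝔉 i] A ∧ s = Set.Ioi i ×ˢ A}) := by
  rintro _ (⟨A, hA, rfl⟩ | ⟨i, A, hA, rfl⟩) _ (⟨B, hB, rfl⟩ | ⟨j, B, hB, rfl⟩) hne
  · exact Or.inl ⟨A ∩ B, MeasurableSet.inter hA hB, by rw [prod_inter_prod, inter_self]⟩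
  · obtain ⟨z, ⟨h1, _⟩, h2, _⟩ := hne
    rw [mem_singleton_iff] at h1
    exact absurd h2 (by simp [h1])
  · obtain ⟨z, ⟨h2, _⟩, h1, _⟩ := hne
    rw [mem_singleton_iff] at h1
    exact absurd h2 (by simp [h1])
  · refine Or.inr ⟨max i j, A ∩ B, ?_, by rw [prod_inter_prod, Ioi_inter_Ioi]⟩
    exact MeasurableSet.inter (𝔉.mono (le_max_left i j) _ hA) (𝔉.mono (le_max_right i j) _ hB)

theorem generateFrom_predictable_prod :
    𝔉.predictable.prod (inferInstance : MeasurableSpace Γ) = MeasurableSpace.generateFrom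
      (image2 (· ×ˢ ·) ({s | ∃ A, MeasurableSet[𝔉 ⊥] A ∧ s = {⊥} ×ˢ A} ∪
        {s | ∃ i A, MeasurableSet[𝔉 i] A ∧ s = Set.Ioi i ×ˢ A}) {s : Set Γ | MeasurableSet s}) := by
  rw [← generateFrom_prod_eq, MeasurableSpace.generateFrom_measurableSet]
  · rfl
  · refine ⟨fun n => if n = 0 then {⊥} ×ˢ univ else Ioi 0 ×ˢ univ, fun n => ?_, ?_⟩
    · rcases eq_or_ne n 0 with rfl | hn
      · exact Or.inl ⟨univ, MeasurableSet.univ, rfl⟩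
      · exact Or.inr ⟨0, univ, MeasurableSet.univ, by simp [hn]⟩
    · refine eq_univ_of_forall fun z => mem_iUnion.2 ?_
      rcases eq_or_ne z.1 0 with hz | hz
      · exact ⟨0, by simp [hz]⟩
      · exact ⟨1, by simp [pos_iff_ne_zero, hz]⟩
  · exact isCountablySpanning_measurableSet

/-- Under a solution of the martingale problem of the reference kernel, the compensation formula
holds for all predictable integrands. -/
theorem compensationFormula_of_martingale [IsProbabilityMeasure P]
    (hP : ∀ᵐ ω ∂P, IsPureJump ω.1) (hX : ∀ t, Measurable[𝔉 t] (canon t : PathSpace Γ → Γ))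
    (hM : ∀ φ : ℝ≥0 × Γ × Γ → ℝ, Measurable φ → (∃ C : ℝ, ∀ z, |φ z| ≤ C) →
      ∃ M : ℝ≥0 → PathSpace Γ → ℝ,
        Martingale M 𝔉 P ∧ ∀ t, M t =ᵐ[P] compensatedSum (refKernel L) φ t) :
    CompensationFormula L 𝔉 P fun _ => 1 := by
  intro t H hH
  simp only [mul_one]
  have hset : ∀ E : Set ((ℝ≥0 × PathSpace Γ) × Γ),
      MeasurableSet[𝔉.predictable.prod inferInstance] E →
      ∫⁻ ω, jumpIntegral t (E.indicator 1) ω ∂P = ∫⁻ ω, rateIntegral L t (E.indicator 1) ω ∂P := by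
    -- The case of the whole space, needed for complements: time 0 carries neither a jump nor
    -- Lebesgue mass, so the rectangle over (0, ∞) already is everything.
    have huniv : ∫⁻ ω, jumpIntegral t (fun _ => 1) ω ∂P =
        ∫⁻ ω, rateIntegral L t (fun _ => 1) ω ∂P := by
      have := lintegral_jumpIntegral_rect (L := L) hP hX hM t 0 (F := univ) MeasurableSet.univ
        MeasurableSet.univ
      refine Eq.trans ?_ (this.trans ?_)
      · refine lintegral_congr fun ω => jumpIntegral_congr fun u hu _ => ?_
        simp [pos_of_mem_jumpSet hu]
      · refine lintegral_congr fun ω => rateIntegral_congr fun u hu _ _ => ?_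
        simp [hu]
    intro E hE
    induction E, hE using MeasurableSpace.induction_on_inter (generateFrom_predictable_prod (𝔉 := 𝔉))
      (isPiSystem_predictable.prod MeasurableSpace.isPiSystem_measurableSet) with
    | empty => simp [jumpIntegral, jumpSum, rateIntegral]
    | basic E hE =>
      obtain ⟨_, ⟨F, hF, rfl⟩ | ⟨r, F, hF, rfl⟩, C, hC, rfl⟩ := hE
      · have h1 : ∀ ω : PathSpace Γ, jumpIntegral t ((({⊥} ×ˢ F) ×ˢ C).indicator 1) ω = 0 := by
          intro ω
          rw [← jumpSum_zero ω.1]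
          refine jumpSum_congr fun u hu => ?_
          simp [indicator, (pos_of_mem_jumpSet hu).ne']
        have h2 : ∀ ω : PathSpace Γ,
            rateIntegral L t ((({⊥} ×ˢ F) ×ˢ C).indicator 1) ω = 0 := by
          intro ω
          rw [rateIntegral_congr (H' := fun _ => 0)]
          · simp [rateIntegral]
          · intro u hu _ y
            simp [indicator, hu.ne']
        simp only [h1, h2]
      · exact lintegral_jumpIntegral_rect hP hX hM t r hF hC
    | compl E hE ih =>
      have hEm : Measurable[𝔉.predictable.prod inferInstance]
          (E.indicator (1 : (ℝ≥0 × PathSpace Γ) × Γ → ℝ≥0∞)) :=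
        measurable_predictable_indicator_one hE
      have hsum : (fun _ => (1 : ℝ≥0∞)) = fun z => E.indicator 1 z + Eᶜ.indicator 1 z := by
        funext z
        by_cases hz : z ∈ E <;> simp [hz]
      -- Bounded rates make the common term finite, so it can be cancelled in `ℝ≥0∞`.
      have hfin : ∫⁻ ω, rateIntegral L t (E.indicator 1) ω ∂P ≠ ∞ := by
        have : ∫⁻ ω, rateIntegral L t (E.indicator 1) ω ∂P ≤ ∫⁻ _, 1 * L.bound * t ∂P :=
          lintegral_mono fun ω => rateIntegral_le t (fun z => indicator_le_self' (by simp) z) ω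
        refine (this.trans_lt ?_).ne
        rw [lintegral_const, measure_univ, mul_one]
        exact ENNReal.mul_lt_top (ENNReal.mul_lt_top ENNReal.one_lt_top L.bound_lt_top)
          ENNReal.coe_lt_top
      rw [hsum] at huniv
      simp only [jumpIntegral_add, rateIntegral_add t (measurable_of_predictable hEm)] at huniv
      rw [lintegral_add_left' (aemeasurable_jumpIntegral hX t hEm hP),
        lintegral_add_left ((measurable_rateIntegral hX t hEm).mono (𝔉.le t) le_rfl), ih] at huniv
      exact (ENNReal.add_right_inj hfin).1 huniv
    | iUnion f hd hf ih =>
      have hfm : ∀ i, Measurable[𝔉.predictable.prod inferInstance]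
          ((f i).indicator (1 : (ℝ≥0 × PathSpace Γ) × Γ → ℝ≥0∞)) := fun i =>
        measurable_predictable_indicator_one (hf i)
      have e : (⋃ i, f i).indicator (1 : (ℝ≥0 × PathSpace Γ) × Γ → ℝ≥0∞) = fun z => ∑' i, (f i).indicator 1 z :=
        funext fun z => indicator_one_iUnion_eq_tsum hd z
      have e1 : ∀ ω : PathSpace Γ, jumpIntegral t (fun z => ∑' i, (f i).indicator 1 z) ω =
          ∑' i, jumpIntegral t ((f i).indicator 1) ω := by
        intro ω
        unfold jumpIntegral
        rw [← jumpSum_tsum]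
        refine jumpSum_congr fun u _ => ?_
        by_cases h3 : u ≤ t <;> simp [h3]
      simp only [e, e1, rateIntegral_tsum t fun i => measurable_of_predictable (hfm i)]
      rw [lintegral_tsum fun i => aemeasurable_jumpIntegral hX t (hfm i) hP, lintegral_tsum fun i =>
        ((measurable_rateIntegral hX t (hfm i)).mono (𝔉.le t) le_rfl).aemeasurable]
      exact tsum_congr ih
  refine @Measurable.ennreal_induction _ (𝔉.predictable.prod inferInstance) (fun H =>
    ∫⁻ ω, jumpIntegral t H ω ∂P = ∫⁻ ω, rateIntegral L t H ω ∂P) ?_ ?_ ?_ H hH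
  · intro c s hs
    have hsm : Measurable[𝔉.predictable.prod inferInstance]
      (s.indicator (1 : (ℝ≥0 × PathSpace Γ) × Γ → ℝ≥0∞)) :=
      measurable_predictable_indicator_one hs
    have e : s.indicator (fun _ => c) = fun z => (fun _ => c) z.1.2 * s.indicator 1 z := by
      funext z
      by_cases hz : z ∈ s <;> simp [hz]
    simp only [e, jumpIntegral_const_mul t _ (fun _ => c),
      rateIntegral_const_mul t (measurable_of_predictable hsm) (fun _ => c)]
    rw [lintegral_const_mul'' _ (aemeasurable_jumpIntegral hX t hsm hP),
      lintegral_const_mul _ ((measurable_rateIntegral hX t hsm).mono (𝔉.le t) le_rfl), hset s hs]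
  · intro f g _ hf hg ihf ihg
    have e1 : ∀ ω, jumpIntegral t (f + g) ω = _ := fun ω => jumpIntegral_add t f g ω
    have e2 : ∀ ω, rateIntegral L t (f + g) ω = _ := fun ω =>
      rateIntegral_add t (measurable_of_predictable hf) g ω
    simp only [e1, e2]
    rw [lintegral_add_left' (aemeasurable_jumpIntegral hX t hf hP),
      lintegral_add_left ((measurable_rateIntegral hX t hf).mono (𝔉.le t) le_rfl), ihf, ihg]
  · intro f hf hmono ih
    have e1 : ∀ ω : PathSpace Γ, jumpIntegral t (fun z => ⨆ n, f n z) ω =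
        ⨆ n, jumpIntegral t (f n) ω := by
      intro ω
      unfold jumpIntegral
      rw [← jumpSum_iSup_of_monotone]
      · refine jumpSum_congr fun u _ => ?_
        by_cases h3 : u ≤ t <;> simp [h3]
      · exact fun m n hmn u => indicator_le_indicator (hmono hmn _)
    simp only [e1, rateIntegral_iSup t (fun n => measurable_of_predictable (hf n)) hmono]
    rw [lintegral_iSup' (fun n => aemeasurable_jumpIntegral hX t (hf n) hP)
      (ae_of_all _ fun ω m n hmn => jumpSum_mono fun u _ => indicator_le_indicator (hmono hmn _)),
      lintegral_iSup (fun n => (measurable_rateIntegral hX t (hf n)).mono (𝔉.le t) le_rfl)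
      (fun m n hmn ω => lintegral_mono fun s => lintegral_mono fun y => hmono hmn _)]
    exact iSup_congr ih

end MartingaleToCompensation

/-! ### Dynkin's formula for the stopped process -/

section Dynkin

variable {Γ : Type*} [TopologicalSpace Γ] [PolishSpace Γ] [MeasurableSpace Γ] [BorelSpace Γ]
  {L : Kernel Γ Γ} [IsFiniteKernel L]
  {𝔉 : Filtration ℝ≥0 (inferInstance : MeasurableSpace (PathSpace Γ))}
  {P : Measure (PathSpace Γ)} {A B : Set Γ}

/-- The indicator of the times in `(s, τ]`, on the event `F`. -/
def gate (E : Set Γ) (s : ℝ≥0) (F : Set (PathSpace Γ)) (z : ℝ≥0 × PathSpace Γ) : ℝ≥0∞ :=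
  (aliveSet E ∩ Ioi s ×ˢ F).indicator 1 z

theorem gate_le_one (E : Set Γ) (s : ℝ≥0) (F : Set (PathSpace Γ)) (z : ℝ≥0 × PathSpace Γ) :
    gate E s F z ≤ 1 :=
  indicator_le_self' (fun _ _ => zero_le) z

theorem measurable_gate (hX : ∀ t, Measurable[𝔉 t] (canon t : PathSpace Γ → Γ)) {E : Set Γ}
    (hE : MeasurableSet E) {s : ℝ≥0} {F : Set (PathSpace Γ)} (hF : MeasurableSet[𝔉 s] F) :
    Measurable[𝔉.predictable] (gate E s F) := by
  have h : Measurable[𝔉.predictable] (fun _ : ℝ≥0 × PathSpace Γ => (1 : ℝ≥0∞)) := measurable_const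
  exact h.indicator (MeasurableSet.inter (measurableSet_predictable_aliveSet hX hE)
    (measurableSet_predictable_Ioi_prod hF))

theorem measurable_gate_mul_left (hX : ∀ t, Measurable[𝔉 t] (canon t : PathSpace Γ → Γ))
    {E : Set Γ} (hE : MeasurableSet E) {s : ℝ≥0} {F : Set (PathSpace Γ)}
    (hF : MeasurableSet[𝔉 s] F) {w : Γ → ℝ≥0∞} (hw : Measurable w) :
    Measurable[𝔉.predictable] fun z => gate E s F z * w (canonLeft z.1 z.2) :=
  (measurable_gate hX hE hF).mul (hw.comp (measurable_predictable_canonLeft hX))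

theorem measurable_gate_mul_right (hX : ∀ t, Measurable[𝔉 t] (canon t : PathSpace Γ → Γ))
    {E : Set Γ} (hE : MeasurableSet E) {s : ℝ≥0} {F : Set (PathSpace Γ)}
    (hF : MeasurableSet[𝔉 s] F) {w : Γ → ℝ≥0∞} (hw : Measurable w) :
    Measurable[𝔉.predictable.prod inferInstance] fun z : (ℝ≥0 × PathSpace Γ) × Γ =>
      gate E s F z.1 * w z.2 :=
  ((measurable_gate hX hE hF).comp measurable_fst).mul (hw.comp measurable_snd)

theorem gate_canonLeft_notMem {ω : PathSpace Γ} (hω : IsPureJump ω.1) {u s : ℝ≥0} (hu : 0 < u)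
    {F : Set (PathSpace Γ)} (h : gate (A ∪ B) s F (u, ω) ≠ 0) : canonLeft u ω ∉ A ∪ B := by
  have : (u, ω) ∈ aliveSet (A ∪ B) ∩ Ioi s ×ˢ F := by
    by_contra hcon
    exact h (indicator_of_notMem hcon _)
  exact leftLim_notMem_of_alive hω hu this.1

/-- Pathwise telescoping of w along the stopped path between s and t; the states left by the jumps
stand on one side and the states entered on the other, to avoid subtraction. -/
theorem stop_add_jumpIntegral {ω : PathSpace Γ} (hω : IsPureJump ω.1) {s t : ℝ≥0} (hst : s ≤ t)
    {F : Set (PathSpace Γ)} (w : Γ → ℝ≥0∞) :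
    F.indicator 1 ω * w ((denseStop (A ∪ B) ω).1 t) +
      jumpIntegral t (fun z => gate (A ∪ B) s F z.1 * w (canonLeft z.1.1 z.1.2)) ω =
    F.indicator 1 ω * w ((denseStop (A ∪ B) ω).1 s) +
      jumpIntegral t (fun z => gate (A ∪ B) s F z.1 * w z.2) ω := by
  have h := (isPureJump_denseStop hω A B).add_jumpSum_left hst w
  have h1 := jumpSum_denseStop hω (A := A) (B := B)
    (fun u x _ => (Ioc s t).indicator (fun _ => w x) u)
  have h2 := jumpSum_denseStop hω (A := A) (B := B)
    (fun u _ y => (Ioc s t).indicator (fun _ => w y) u)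
  have e1 : jumpIntegral t (fun z => gate (A ∪ B) s F z.1 * w (canonLeft z.1.1 z.1.2)) ω =
      F.indicator 1 ω * jumpSum (denseStop (A ∪ B) ω).1
        ((Ioc s t).indicator fun u => w (Function.leftLim (denseStop (A ∪ B) ω).1 u)) := by
    have h3 := Eq.trans (jumpSum_congr fun u _ => rfl) h1
    rw [show jumpSum (denseStop (A ∪ B) ω).1 ((Ioc s t).indicator fun u =>
      w (Function.leftLim (denseStop (A ∪ B) ω).1 u)) = _ from h3, ← jumpSum_const_mul]
    refine jumpSum_congr fun u _ => ?_
    by_cases h4 : u ≤ t <;> by_cases h5 : s < u <;> by_cases h6 : (u, ω) ∈ aliveSet (A ∪ B) <;>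
      by_cases h7 : ω ∈ F <;> simp [indicator, gate, h4, h5, h6, h7, canonLeft]
  have e2 : jumpIntegral t (fun z => gate (A ∪ B) s F z.1 * w z.2) ω =
      F.indicator 1 ω * jumpSum (denseStop (A ∪ B) ω).1
        ((Ioc s t).indicator fun u => w ((denseStop (A ∪ B) ω).1 u)) := by
    have h3 := Eq.trans (jumpSum_congr fun u _ => rfl) h2
    rw [show jumpSum (denseStop (A ∪ B) ω).1 ((Ioc s t).indicator fun u =>
      w ((denseStop (A ∪ B) ω).1 u)) = _ from h3, ← jumpSum_const_mul]
    refine jumpSum_congr fun u _ => ?_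
    by_cases h4 : u ≤ t <;> by_cases h5 : s < u <;> by_cases h6 : (u, ω) ∈ aliveSet (A ∪ B) <;>
      by_cases h7 : ω ∈ F <;> simp [indicator, gate, h4, h5, h6, h7]
  rw [e1, e2, ← mul_add, ← mul_add, h]

theorem measurable_stop (hE : MeasurableSet (A ∪ B)) {w : Γ → ℝ≥0∞} (hw : Measurable w) (t : ℝ≥0) :
    Measurable fun ω : PathSpace Γ => w ((denseStop (A ∪ B) ω).1 t) :=
  hw.comp ((measurable_canon t).comp (measurable_denseStop hE))

/-- Take means in the telescoping identity and compensate both jump sums. Both integrands are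
predictable, as `gate` is a predictable set cut at τ. -/
theorem dynkin (hP : ∀ᵐ ω ∂P, IsPureJump ω.1)
    (hX : ∀ t, Measurable[𝔉 t] (canon t : PathSpace Γ → Γ))
    (hC : CompensationFormula L 𝔉 P fun _ => 1) (hE : MeasurableSet (A ∪ B)) {s t : ℝ≥0}
    (hst : s ≤ t) {F : Set (PathSpace Γ)} (hF : MeasurableSet[𝔉 s] F) {w : Γ → ℝ≥0∞}
    (hw : Measurable w) :
    ∫⁻ ω in F, w ((denseStop (A ∪ B) ω).1 t) ∂P + ∫⁻ ω, rateIntegral L t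
      (fun z => gate (A ∪ B) s F z.1 * w (canonLeft z.1.1 z.1.2)) ω ∂P =
    ∫⁻ ω in F, w ((denseStop (A ∪ B) ω).1 s) ∂P + ∫⁻ ω, rateIntegral L t
      (fun z => gate (A ∪ B) s F z.1 * w z.2) ω ∂P := by
  have hFm := 𝔉.le s _ hF
  have h1 := hC t (fun z => gate (A ∪ B) s F z.1 * w (canonLeft z.1.1 z.1.2))
    ((measurable_gate_mul_left hX hE hF hw).comp measurable_fst)
  have h2 := hC t _ (measurable_gate_mul_right hX hE hF hw)
  simp only [mul_one] at h1 h2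
  have h3 : ∀ r, ∫⁻ ω in F, w ((denseStop (A ∪ B) ω).1 r) ∂P =
      ∫⁻ ω, F.indicator 1 ω * w ((denseStop (A ∪ B) ω).1 r) ∂P := by
    intro r
    rw [← lintegral_indicator hFm]
    refine lintegral_congr fun ω => ?_
    by_cases hω : ω ∈ F <;> simp [hω]
  have h4 : ∀ r, Measurable fun ω => F.indicator 1 ω * w ((denseStop (A ∪ B) ω).1 r) :=
    fun r => (measurable_one.indicator hFm).mul (measurable_stop hE hw r)
  rw [← h1, ← h2, h3, h3, ← lintegral_add_left (h4 t), ← lintegral_add_left (h4 s)]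
  exact lintegral_congr_ae (hP.mono fun ω hω => stop_add_jumpIntegral hω hst w)

/-- A function that is harmonic off `A ∪ B` gives a martingale of the stopped process. -/
theorem setLIntegral_stop_eq [IsFiniteMeasure P] (hP : ∀ᵐ ω ∂P, IsPureJump ω.1)
    (hX : ∀ t, Measurable[𝔉 t] (canon t : PathSpace Γ → Γ))
    (hC : CompensationFormula L 𝔉 P fun _ => 1) (hE : MeasurableSet (A ∪ B)) {s t : ℝ≥0}
    (hst : s ≤ t) {F : Set (PathSpace Γ)} (hF : MeasurableSet[𝔉 s] F) {w : Γ → ℝ≥0∞}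
    (hw : Measurable w) {c : ℝ≥0∞} (hc : c ≠ ∞) (hwc : ∀ x, w x ≤ c)
    (hharm : ∀ x, x ∉ A ∪ B → ∫⁻ y, w y ∂(L x) = w x * L x univ) :
    ∫⁻ ω in F, w ((denseStop (A ∪ B) ω).1 t) ∂P =
      ∫⁻ ω in F, w ((denseStop (A ∪ B) ω).1 s) ∂P := by
  have h := dynkin hP hX hC hE hst hF hw
  have e : ∫⁻ ω, rateIntegral L t
      (fun z => gate (A ∪ B) s F z.1 * w (canonLeft z.1.1 z.1.2)) ω ∂P =
      ∫⁻ ω, rateIntegral L t (fun z => gate (A ∪ B) s F z.1 * w z.2) ω ∂P := by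
    refine lintegral_congr_ae (hP.mono fun ω hω => ?_)
    refine setLIntegral_congr_fun measurableSet_Ioc fun u hu => ?_
    simp only
    rw [lintegral_const, lintegral_const_mul _ hw]
    -- Where the gate is open, u ≤ τ and the left limit is off A ∪ B, so harmonicity makes the two
    -- rate integrands equal.
    by_cases h0 : gate (A ∪ B) s F (u.toNNReal, ω) = 0
    · simp [h0]
    · rw [hharm _ (gate_canonLeft_notMem hω (Real.toNNReal_pos.2 hu.1) h0), mul_assoc]
  rw [e] at h
  refine (ENNReal.add_left_inj ?_).1 h
  have : ∫⁻ ω, rateIntegral L t (fun z => gate (A ∪ B) s F z.1 * w z.2) ω ∂P ≤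
      ∫⁻ _, 1 * c * L.bound * t ∂P :=
    lintegral_mono fun ω => rateIntegral_le t
      (fun z => mul_le_mul' (gate_le_one _ _ _ _) (hwc _)) ω
  refine (this.trans_lt ?_).ne
  rw [lintegral_const]
  have := L.bound_lt_top
  have := hc.lt_top
  have := measure_lt_top P univ
  finiteness

end Dynkin

/-! ### The hitting time is almost surely finite -/

section HitFinite

variable {Γ : Type*} [TopologicalSpace Γ] [PolishSpace Γ] [MeasurableSpace Γ] [BorelSpace Γ]
  {L : Kernel Γ Γ} [IsFiniteKernel L]
  {𝔉 : Filtration ℝ≥0 (inferInstance : MeasurableSpace (PathSpace Γ))}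
  {P : Measure (PathSpace Γ)} {A B : Set Γ}

/-- A function that vanishes on A ∪ B performs the killing at τ by itself, so the gate can be
dropped in favour of the stopped path. -/
theorem gate_univ_mul_left {ω : PathSpace Γ} (hω : IsPureJump ω.1) {s u : ℝ≥0} (hsu : s < u)
    {w : Γ → ℝ≥0∞} (hw0 : ∀ x ∈ A ∪ B, w x = 0) :
    gate (A ∪ B) s univ (u, ω) * w (canonLeft u ω) = w (canonLeft u (denseStop (A ∪ B) ω)) := by
  by_cases h : (u, ω) ∈ aliveSet (A ∪ B)
  · have h1 : canonLeft u (denseStop (A ∪ B) ω) = canonLeft u ω := leftLim_denseStop_of_alive hω h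
    simp [gate, h, hsu, h1]
  · have h1 : canonLeft u (denseStop (A ∪ B) ω) = hitValue A B ω :=
      leftLim_denseStop_of_not_alive hω h
    simp [gate, h, h1, hw0 _ (denseStop_of_not_alive hω h).2]

/-- Uniformization: w' is (1 + L/l) w off A ∪ B, and Dynkin's formula becomes that of a chain
jumping at the constant rate l. -/
theorem dynkin_resolvent [IsFiniteMeasure P] (hP : ∀ᵐ ω ∂P, IsPureJump ω.1)
    (hX : ∀ t, Measurable[𝔉 t] (canon t : PathSpace Γ → Γ))
    (hC : CompensationFormula L 𝔉 P fun _ => 1) (hE : MeasurableSet (A ∪ B)) {s t : ℝ≥0}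
    (hst : s ≤ t) {w w' : Γ → ℝ≥0∞} (hw : Measurable w) (hw' : Measurable w')
    (hw0 : ∀ x ∈ A ∪ B, w x = 0) (hw'0 : ∀ x ∈ A ∪ B, w' x = 0)
    {l : ℝ≥0} (hl : ∀ x, L x univ ≤ l)
    (hT : ∀ x, x ∉ A ∪ B → ∫⁻ y, w y ∂(L x) + (l - L x univ) * w x = l * w' x) :
    ∫⁻ ω, w ((denseStop (A ∪ B) ω).1 t) ∂P +
      l * ∫⁻ u in Ioc (s : ℝ) t, ∫⁻ ω, w (canonLeft u.toNNReal (denseStop (A ∪ B) ω)) ∂P =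
    ∫⁻ ω, w ((denseStop (A ∪ B) ω).1 s) ∂P +
      l * ∫⁻ u in Ioc (s : ℝ) t, ∫⁻ ω, w' (canonLeft u.toNNReal (denseStop (A ∪ B) ω)) ∂P := by
  have h := dynkin hP hX hC hE hst (F := univ) MeasurableSet.univ hw
  rw [setLIntegral_univ, setLIntegral_univ] at h
  have hLm : Measurable fun x => (l : ℝ≥0∞) - L x univ :=
    measurable_const.sub (L.measurable_coe MeasurableSet.univ)
  set v : Γ → ℝ≥0∞ := fun x => (l - L x univ) * w x with hv
  have hvm : Measurable v := hLm.mul hw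
  have hgm : ∀ {f : Γ → ℝ≥0∞}, Measurable f → Measurable fun z : ℝ≥0 × PathSpace Γ =>
      gate (A ∪ B) s univ z * f (canonLeft z.1 z.2) := fun hf =>
    (measurable_gate_mul_left hX hE MeasurableSet.univ hf).mono predictable_le_prod le_rfl
  have hgm' : ∀ {f : Γ → ℝ≥0∞}, Measurable f → Measurable fun z : PathSpace Γ × ℝ =>
      gate (A ∪ B) s univ (z.2.toNNReal, z.1) * f (canonLeft z.2.toNNReal z.1) := fun hf =>
    (hgm hf).comp ((measurable_real_toNNReal.comp measurable_snd).prodMk measurable_fst)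
  have hgmω : ∀ {f : Γ → ℝ≥0∞} (ω : PathSpace Γ), Measurable f → Measurable fun u : ℝ =>
      gate (A ∪ B) s univ (u.toNNReal, ω) * f (canonLeft u.toNNReal ω) := fun ω hf =>
    (hgm' hf).comp measurable_prodMk_left
  have hD : Measurable fun ω => ∫⁻ u in Ioc (0 : ℝ) t,
      gate (A ∪ B) s univ (u.toNNReal, ω) * v (canonLeft u.toNNReal ω) :=
    (hgm' hvm).lintegral_prod_right'
  -- The mean time integral of (l - L(x, Γ)) w, that is, of fictitious jumps that do not move. Added
  -- to both sides it completes the rates to l; it is never cancelled, so its finiteness does not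
  -- matter.
  set D := ∫⁻ ω, (∫⁻ u in Ioc (0 : ℝ) t,
    gate (A ∪ B) s univ (u.toNNReal, ω) * v (canonLeft u.toNNReal ω)) ∂P
  have hconv : ∀ {f : Γ → ℝ≥0∞}, Measurable f → (∀ x ∈ A ∪ B, f x = 0) →
      ∫⁻ ω, (∫⁻ u in Ioc (0 : ℝ) t, gate (A ∪ B) s univ (u.toNNReal, ω) *
        (l * f (canonLeft u.toNNReal ω))) ∂P =
      l * ∫⁻ u in Ioc (s : ℝ) t, ∫⁻ ω, f (canonLeft u.toNNReal (denseStop (A ∪ B) ω)) ∂P := by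
    intro f hf hf0
    rw [lintegral_lintegral_swap (hgm' (hf.const_mul (l : ℝ≥0∞))).aemeasurable,
      ← lintegral_const_mul' _ _ ENNReal.coe_ne_top, ← lintegral_indicator measurableSet_Ioc,
      ← lintegral_indicator measurableSet_Ioc]
    refine lintegral_congr fun u => ?_
    by_cases hu0 : u ∈ Ioc (0 : ℝ) t
    · rw [indicator_of_mem hu0]
      by_cases hsu : (s : ℝ) < u
      · rw [indicator_of_mem (show u ∈ Ioc (s : ℝ) t from ⟨hsu, hu0.2⟩), ← lintegral_const_mul' _ _ ENNReal.coe_ne_top]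
        refine lintegral_congr_ae (hP.mono fun ω hω => ?_)
        have := gate_univ_mul_left hω (s := s) (u := u.toNNReal)
          (Real.lt_toNNReal_iff_coe_lt.2 hsu) hf0
        simp only
        rw [← this]
        ring
      · rw [indicator_of_notMem fun h => hsu h.1]
        have h1 : ¬ s < u.toNNReal := fun h => hsu (Real.lt_toNNReal_iff_coe_lt.1 h)
        simp [gate, indicator, h1]
    · rw [indicator_of_notMem hu0, indicator_of_notMem]
      exact fun h => hu0 ⟨lt_of_le_of_lt s.2 h.1, h.2⟩
  have e1 : ∫⁻ ω, rateIntegral L t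
      (fun z => gate (A ∪ B) s univ z.1 * w (canonLeft z.1.1 z.1.2)) ω ∂P + D =
      l * ∫⁻ u in Ioc (s : ℝ) t, ∫⁻ ω, w (canonLeft u.toNNReal (denseStop (A ∪ B) ω)) ∂P := by
    rw [← hconv hw hw0, ← lintegral_add_right _ hD]
    refine lintegral_congr fun ω => ?_
    rw [rateIntegral, ← lintegral_add_right _ (hgmω ω hvm)]
    refine lintegral_congr fun u => ?_
    simp only
    rw [lintegral_const, hv]
    simp only
    rw [mul_assoc, ← mul_add, mul_comm (w _), ← add_mul, add_tsub_cancel_of_le (hl _)]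
  have e2 : ∫⁻ ω, rateIntegral L t
      (fun z => gate (A ∪ B) s univ z.1 * w z.2) ω ∂P + D =
      l * ∫⁻ u in Ioc (s : ℝ) t, ∫⁻ ω, w' (canonLeft u.toNNReal (denseStop (A ∪ B) ω)) ∂P := by
    rw [← hconv hw' hw'0, ← lintegral_add_right _ hD]
    refine lintegral_congr_ae (hP.mono fun ω hω => ?_)
    simp only
    rw [rateIntegral, ← lintegral_add_right _ (hgmω ω hvm)]
    refine setLIntegral_congr_fun measurableSet_Ioc fun u hu => ?_
    simp only
    rw [lintegral_const_mul _ hw, hv]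
    simp only
    rw [← mul_add]
    by_cases h0 : gate (A ∪ B) s univ (u.toNNReal, ω) = 0
    · simp [h0]
    · rw [hT _ (gate_canonLeft_notMem hω (Real.toNNReal_pos.2 hu.1) h0)]
  rw [← e1, ← e2, ← add_assoc, ← add_assoc, h]

theorem tendsto_lintegral_stop [IsFiniteMeasure P] (hP : ∀ᵐ ω ∂P, IsPureJump ω.1)
    (hE : MeasurableSet (A ∪ B)) {w : Γ → ℝ≥0∞} (hw : Measurable w) (hw1 : ∀ x, w x ≤ 1)
    {u : ℝ≥0} : Tendsto (fun r => ∫⁻ ω, w ((denseStop (A ∪ B) ω).1 r) ∂P) (𝓝[<] u)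
      (𝓝 (∫⁻ ω, w (canonLeft u (denseStop (A ∪ B) ω)) ∂P)) := by
  refine tendsto_lintegral_filter_of_dominated_convergence (fun _ => 1)
    (Eventually.of_forall fun r => measurable_stop hE hw r)
    (Eventually.of_forall fun r => ae_of_all _ fun ω => hw1 _)
    (by simp) (hP.mono fun ω hω => ?_)
  refine tendsto_const_nhds.congr' ?_
  filter_upwards [(isPureJump_denseStop hω A B).eventually_left u] with r hr
  rw [hr]
  rfl

/-- If the iterates of the killed transition operator tend to zero, then the hitting time is almost
surely finite. -/
theorem ae_hitTime_ne_top [IsProbabilityMeasure P] (hP : ∀ᵐ ω ∂P, IsPureJump ω.1)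
    (hX : ∀ t, Measurable[𝔉 t] (canon t : PathSpace Γ → Γ))
    (hC : CompensationFormula L 𝔉 P fun _ => 1) (hE : MeasurableSet (A ∪ B))
    {x : Γ} (hx : ∀ᵐ ω ∂P, ω.1 0 = x) {l : ℝ≥0} (hl0 : 0 < l) (hl : ∀ y, L y univ ≤ l)
    {w : ℕ → Γ → ℝ≥0∞} (hw : ∀ k, Measurable (w k)) (hw1 : ∀ k y, w k y ≤ 1)
    (hwb : ∀ k, ∀ y ∈ A ∪ B, w k y = 0) (hw0 : ∀ y, y ∉ A ∪ B → w 0 y = 1)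
    (hmono : ∀ k y, w (k + 1) y ≤ w k y)
    (hT : ∀ k, ∀ y, y ∉ A ∪ B →
      ∫⁻ z, w k z ∂(L y) + (l - L y univ) * w k y = l * w (k + 1) y)
    (hlim : Tendsto (fun k => w k x) atTop (𝓝 0)) :
    ∀ᵐ ω ∂P, hitTime A B ω ≠ ⊤ := by
  set a : ℕ → ℝ≥0 → ℝ≥0∞ := fun k t => ∫⁻ ω, w k ((denseStop (A ∪ B) ω).1 t) ∂P with ha
  set b : ℕ → ℝ≥0 → ℝ≥0∞ := fun k t => ∫⁻ ω, w k (canonLeft t (denseStop (A ∪ B) ω)) ∂P with hb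
  have hdyn : ∀ k s t, s ≤ t → a k t + l * ∫⁻ u in Ioc (s : ℝ) t, b k u.toNNReal =
      a k s + l * ∫⁻ u in Ioc (s : ℝ) t, b (k + 1) u.toNNReal := fun k s t hst =>
    dynkin_resolvent hP hX hC hE hst (hw k) (hw (k + 1)) (hwb k) (hwb (k + 1)) hl (hT k)
  have ha1 : ∀ k t, a k t ≤ 1 := fun k t => by
    calc a k t ≤ ∫⁻ _, 1 ∂P := lintegral_mono fun ω => hw1 k _
      _ = 1 := by simp
  have hb1 : ∀ k t, b k t ≤ 1 := fun k t => by
    calc b k t ≤ ∫⁻ _, 1 ∂P := lintegral_mono fun ω => hw1 k _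
      _ = 1 := by simp
  have hab : ∀ k u, Tendsto (a k) (𝓝[<] u) (𝓝 (b k u)) := fun k u =>
    tendsto_lintegral_stop hP hE (hw k) (hw1 k)
  set p := P {ω | hitTime A B ω = ⊤} with hp
  have hp1 : p ≤ 1 := prob_le_one
  -- The means b at left limits are left limits of the means a, so lower bounds pass from a to b.
  have hball : ∀ k, (∀ t, p ≤ a k t) → ∀ t, 0 < t → p ≤ b k t := by
    intro k h t ht
    have : (𝓝[<] t).NeBot := nhdsLT_neBot_of_exists_lt ⟨0, ht⟩
    exact ge_of_tendsto (hab k t) (Eventually.of_forall h)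
  have hmain : ∀ k t, p ≤ a k t := by
    intro k
    induction k with
    -- On {τ = ∞} the stopped path is never in A ∪ B, and there the zeroth iterate is 1.
    | zero =>
      intro t
      have h1 : p ≤ ∫⁻ ω, {ω | w 0 ((denseStop (A ∪ B) ω).1 t) = 1}.indicator 1 ω ∂P := by
        have hm : MeasurableSet {ω : PathSpace Γ | w 0 ((denseStop (A ∪ B) ω).1 t) = 1} :=
          measurable_stop hE (hw 0) t (measurableSet_singleton 1)
        rw [lintegral_indicator_one hm]
        refine measure_mono_ae (hP.mono fun ω hω hτ => ?_)
        refine hw0 _ ?_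
        have halive : (t, ω) ∈ aliveSet (A ∪ B) := by
          rw [mem_aliveSet_iff_le_hitTime hω, show hitTime A B ω = ⊤ from hτ]
          exact le_top
        rw [denseStop_of_alive hω halive]
        rcases hitTime_cases hω A B with ⟨h0, _⟩ | ⟨r, h2, _⟩
        · exact h0 t
        · rw [show hitTime A B ω = ⊤ from hτ] at h2
          exact absurd h2 (WithTop.top_ne_coe)
      refine h1.trans (lintegral_mono fun ω => ?_)
      by_cases h : w 0 ((denseStop (A ∪ B) ω).1 t) = 1
      · simp [indicator, h]
      · simp [indicator, h]
    | succ k ih =>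
      -- If a (k+1) falls to q < p at t₀ it stays below q, because the iterates decrease in k. Then
      -- b (k+1) ≤ q while b k ≥ p after t₀, and the Dynkin identity for k gives l (p - q) d ≤ 1 for
      -- every duration d.
      by_contra! hcon
      obtain ⟨t₀, ht₀⟩ := hcon
      set q := a (k + 1) t₀ with hq
      have hanti : ∀ t, t₀ ≤ t → a (k + 1) t ≤ q := by
        intro t ht
        have h1 := hdyn (k + 1) t₀ t ht
        have h2 : l * ∫⁻ u in Ioc (t₀ : ℝ) t, b (k + 1 + 1) u.toNNReal ≤
            l * ∫⁻ u in Ioc (t₀ : ℝ) t, b (k + 1) u.toNNReal :=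
          mul_le_mul_right (lintegral_mono fun u => lintegral_mono fun ω => hmono (k + 1) _) _
        have h3 : l * ∫⁻ u in Ioc (t₀ : ℝ) t, b (k + 1) u.toNNReal ≠ ∞ := by
          have : ∫⁻ u in Ioc (t₀ : ℝ) t, b (k + 1) u.toNNReal ≤ ∫⁻ _ in Ioc (t₀ : ℝ) t, 1 :=
            lintegral_mono fun u => hb1 _ _
          refine (ENNReal.mul_lt_top ENNReal.coe_lt_top (this.trans_lt ?_)).ne
          simp
        exact (ENNReal.add_le_add_iff_right h3).1 (h1.trans_le (by gcongr))
      have hbq : ∀ t, t₀ < t → b (k + 1) t ≤ q := by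
        intro t ht
        have : (𝓝[<] t).NeBot := nhdsLT_neBot_of_exists_lt ⟨0, lt_of_le_of_lt zero_le ht⟩
        refine le_of_tendsto (hab (k + 1) t) ?_
        filter_upwards [Ioo_mem_nhdsLT ht] with r hr using hanti r hr.1.le
      have hbp := hball k ih
      have hineq : ∀ d : ℝ≥0, (l : ℝ≥0∞) * (p * d) ≤ 1 + l * (q * d) := by
        intro d
        have hvol : volume (Ioc (t₀ : ℝ) ((t₀ + d : ℝ≥0) : ℝ)) = d := by simp
        calc (l : ℝ≥0∞) * (p * d)
            = l * ∫⁻ _ in Ioc (t₀ : ℝ) ((t₀ + d : ℝ≥0) : ℝ), p := by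
              rw [setLIntegral_const, hvol]
          _ ≤ l * ∫⁻ u in Ioc (t₀ : ℝ) ((t₀ + d : ℝ≥0) : ℝ), b k u.toNNReal := by
              gcongr l * ?_
              refine setLIntegral_mono' measurableSet_Ioc fun u hu => hbp _ ?_
              exact Real.toNNReal_pos.2 (lt_of_le_of_lt t₀.2 hu.1)
          _ ≤ a k (t₀ + d) + l * ∫⁻ u in Ioc (t₀ : ℝ) ((t₀ + d : ℝ≥0) : ℝ), b k u.toNNReal :=
              le_add_self
          _ = a k t₀ +
              l * ∫⁻ u in Ioc (t₀ : ℝ) ((t₀ + d : ℝ≥0) : ℝ), b (k + 1) u.toNNReal :=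
              hdyn k t₀ (t₀ + d) le_self_add
          _ ≤ 1 + l * ∫⁻ _ in Ioc (t₀ : ℝ) ((t₀ + d : ℝ≥0) : ℝ), q := by
              gcongr ?_ + l * ?_
              · exact ha1 _ _
              · refine setLIntegral_mono' measurableSet_Ioc fun u hu => hbq _ ?_
                exact Real.lt_toNNReal_iff_coe_lt.2 hu.1
          _ = 1 + l * (q * d) := by rw [setLIntegral_const, hvol]
      lift p to ℝ≥0 using (hp1.trans_lt ENNReal.one_lt_top).ne with p' hp'
      have hqtop : q ≠ ∞ := ((ha1 _ _).trans_lt ENNReal.one_lt_top).ne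
      lift q to ℝ≥0 using hqtop with q' hq'
      have hpq : q' < p' := ENNReal.coe_lt_coe.1 ht₀
      have hd : 0 < (p' : ℝ) - q' := sub_pos.2 hpq
      -- With this duration the bound reads 2 ≤ 1.
      have h5 := hineq (2 / (l * (p' - q')))
      rw [← ENNReal.coe_mul, ← ENNReal.coe_mul, ← ENNReal.coe_mul, ← ENNReal.coe_mul,
        ← ENNReal.coe_one, ← ENNReal.coe_add, ENNReal.coe_le_coe, ← NNReal.coe_le_coe] at h5
      push_cast [NNReal.coe_sub hpq.le] at h5
      have hl0' : (0 : ℝ) < l := hl0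
      have h6 : (l : ℝ) * (((p' : ℝ) - q') * (2 / (l * (p' - q')))) = 2 := by
        field_simp
      have h7 : (l : ℝ) * (p' * (2 / (l * (p' - q')))) - l * (q' * (2 / (l * (p' - q')))) = 2 := by
        linear_combination h6
      linarith
  refine ae_iff.2 ?_
  simp only [not_not]
  refine le_antisymm ?_ zero_le
  refine ge_of_tendsto hlim (Eventually.of_forall fun k => ?_)
  refine (hmain k 0).trans (le_of_eq ?_)
  calc a k 0 = ∫⁻ _, w k x ∂P := lintegral_congr_ae (hx.mono fun ω hω => by
        simp only [denseStop_apply_zero, hω])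
    _ = w k x := by simp

end HitFinite

/-! ### Monotone iteration for the boundary value problem -/

section BoundaryValue

variable {Γ : Type*} [MeasurableSpace Γ] {L : Kernel Γ Γ} {E : Set Γ} {b : Γ → ℝ} {l m M : ℝ}

open Classical in
/-- The transition operator `1 + l⁻¹ L` off `E`, with the boundary values `b` on `E`. -/
def bvpStep (L : Kernel Γ Γ) (E : Set Γ) (b : Γ → ℝ) (l : ℝ) (g : Γ → ℝ) (y : Γ) : ℝ :=
  if y ∈ E then b y else (1 - (L y).real univ / l) * g y + l⁻¹ * ∫ z, g z ∂(L y)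

/-- The iterates of `bvpStep`, started from the constant `m`. -/
def bvpIter (L : Kernel Γ Γ) (E : Set Γ) (b : Γ → ℝ) (l m : ℝ) : ℕ → Γ → ℝ
  | 0 => fun _ => m
  | k + 1 => bvpStep L E b l (bvpIter L E b l m k)

theorem integrable_of_mem_Icc {μ : Measure Γ} [IsFiniteMeasure μ] {g : Γ → ℝ} (hg : Measurable g)
    (h : ∀ y, g y ∈ Icc m M) : Integrable g μ :=
  Integrable.of_mem_Icc m M hg.aemeasurable (ae_of_all _ h)

variable [IsFiniteKernel L]

theorem measurable_bvpStep (hE : MeasurableSet E) (hb : Measurable b) {g : Γ → ℝ}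
    (hg : Measurable g) : Measurable (bvpStep L E b l g) := by
  classical
  refine Measurable.ite hE hb ?_
  have h1 : Measurable fun y => ∫ z, g z ∂(L y) :=
    (hg.stronglyMeasurable.integral_kernel (κ := L)).measurable
  have h2 : Measurable fun y => (L y).real univ :=
    (L.measurable_coe MeasurableSet.univ).ennreal_toReal
  fun_prop

theorem measurable_bvpIter (hE : MeasurableSet E) (hb : Measurable b) (k : ℕ) :
    Measurable (bvpIter L E b l m k) := by
  induction k with
  | zero => exact measurable_const
  | succ k ih => exact measurable_bvpStep hE hb ih

/-- As l dominates the total rates, the weight 1 - L(y, Γ)/l is nonnegative and the operator is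
positive. -/
theorem bvpStep_mono (hl0 : 0 < l) (hl : ∀ y, (L y).real univ ≤ l) {f g : Γ → ℝ}
    (hf : ∀ y, Integrable f (L y)) (hg : ∀ y, Integrable g (L y)) (hfg : ∀ y, f y ≤ g y) (y : Γ) :
    bvpStep L E b l f y ≤ bvpStep L E b l g y := by
  unfold bvpStep
  split_ifs
  · exact le_rfl
  · have h1 : 0 ≤ 1 - (L y).real univ / l := sub_nonneg.2 ((div_le_one hl0).2 (hl y))
    have h2 : ∫ z, f z ∂(L y) ≤ ∫ z, g z ∂(L y) := integral_mono (hf y) (hg y) hfg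
    have h3 := hfg y
    have h4 : 0 ≤ l⁻¹ := by positivity
    gcongr

theorem bvpStep_const (hl0 : 0 < l) (c : ℝ) {y : Γ} (hy : y ∉ E) :
    bvpStep L E b l (fun _ => c) y = c := by
  rw [bvpStep, if_neg hy, integral_const, smul_eq_mul]
  field_simp
  ring

/-- The step is monotone and preserves constants off E, so it preserves the interval [m, M] as soon
as the boundary values lie in it. -/
theorem bvpIter_mem (hE : MeasurableSet E) (hb : Measurable b) (hl0 : 0 < l)
    (hl : ∀ y, (L y).real univ ≤ l) (hmM : m ≤ M) (hbm : ∀ y ∈ E, b y ∈ Icc m M) (k : ℕ) (y : Γ) :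
    bvpIter L E b l m k y ∈ Icc m M := by
  induction k generalizing y with
  | zero => exact ⟨le_rfl, hmM⟩
  | succ k ih =>
    by_cases hy : y ∈ E
    · simp only [bvpIter, bvpStep, if_pos hy]
      exact hbm y hy
    · have hi : ∀ y, Integrable (bvpIter L E b l m k) (L y) := fun y =>
        integrable_of_mem_Icc (measurable_bvpIter hE hb k) ih
      constructor
      · have := bvpStep_mono (E := E) (b := b) hl0 hl (fun _ => integrable_const m) hi
          (fun z => (ih z).1) y
        rwa [bvpStep_const hl0 m hy] at this
      · have := bvpStep_mono (E := E) (b := b) hl0 hl hi (fun _ => integrable_const M)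
          (fun z => (ih z).2) y
        rwa [bvpStep_const hl0 M hy] at this

/-- The first step goes up because m is the lower bound; monotonicity of the step propagates this.
-/
theorem bvpIter_le_succ (hE : MeasurableSet E) (hb : Measurable b) (hl0 : 0 < l)
    (hl : ∀ y, (L y).real univ ≤ l) (hmM : m ≤ M) (hbm : ∀ y ∈ E, b y ∈ Icc m M) (k : ℕ) (y : Γ) :
    bvpIter L E b l m k y ≤ bvpIter L E b l m (k + 1) y := by
  induction k generalizing y with
  | zero => exact (bvpIter_mem hE hb hl0 hl hmM hbm 1 y).1
  | succ k ih =>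
    have hi : ∀ k y, Integrable (bvpIter L E b l m k) (L y) := fun k y =>
      integrable_of_mem_Icc (measurable_bvpIter hE hb k) (bvpIter_mem hE hb hl0 hl hmM hbm k)
    exact bvpStep_mono hl0 hl (hi k) (hi (k + 1)) ih y

/-- The iterates converge to a bounded measurable solution of the boundary value problem. -/
theorem exists_tendsto_bvpIter (hE : MeasurableSet E) (hb : Measurable b) (hl0 : 0 < l)
    (hl : ∀ y, (L y).real univ ≤ l) (hmM : m ≤ M) (hbm : ∀ y ∈ E, b y ∈ Icc m M) :
    ∃ g : Γ → ℝ, Measurable g ∧ (∀ y, g y ∈ Icc m M) ∧ (∀ y ∈ E, g y = b y) ∧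
      (∀ y, y ∉ E → ∫ z, (g z - g y) ∂(L y) = 0) ∧
      ∀ y, Tendsto (fun k => bvpIter L E b l m k y) atTop (𝓝 (g y)) := by
  have hmem := bvpIter_mem hE hb hl0 hl hmM hbm
  have hmeas := measurable_bvpIter (L := L) (l := l) (m := m) hE hb
  have hlim : ∀ y, Tendsto (fun k => bvpIter L E b l m k y) atTop
      (𝓝 (⨆ k, bvpIter L E b l m k y)) := fun y =>
    tendsto_atTop_ciSup (monotone_nat_of_le_succ fun k => bvpIter_le_succ hE hb hl0 hl hmM hbm k y)
      ⟨M, by rintro _ ⟨k, rfl⟩; exact (hmem k y).2⟩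
  set g : Γ → ℝ := fun y => ⨆ k, bvpIter L E b l m k y with hg
  have hgm : Measurable g := measurable_of_tendsto_metrizable hmeas (tendsto_pi_nhds.2 hlim)
  have hgI : ∀ y, g y ∈ Icc m M := fun y =>
    isClosed_Icc.mem_of_tendsto (hlim y) (Eventually.of_forall fun k => hmem k y)
  refine ⟨g, hgm, hgI, fun y hy => ?_, fun y hy => ?_, hlim⟩
  · refine tendsto_nhds_unique ((tendsto_add_atTop_iff_nat 1).2 (hlim y)) ?_
    simp only [bvpIter, bvpStep, if_pos hy]
    exact tendsto_const_nhds
  · have h1 : Tendsto (fun k => ∫ z, bvpIter L E b l m k z ∂(L y)) atTop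
        (𝓝 (∫ z, g z ∂(L y))) := by
      refine tendsto_integral_of_dominated_convergence (fun _ => max |m| |M|)
        (fun k => (hmeas k).aestronglyMeasurable) (integrable_const _)
        (fun k => ae_of_all _ fun z => ?_) (ae_of_all _ hlim)
      exact abs_le_max_abs_abs (hmem k z).1 (hmem k z).2
    -- The limit is a fixed point of the step, which off E is the harmonic equation divided by l.
    have h2 : g y = (1 - (L y).real univ / l) * g y + l⁻¹ * ∫ z, g z ∂(L y) := by
      refine tendsto_nhds_unique ((tendsto_add_atTop_iff_nat 1).2 (hlim y)) ?_
      simp only [bvpIter, bvpStep, if_neg hy]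
      exact ((hlim y).const_mul _).add (h1.const_mul _)
    rw [integral_sub (integrable_of_mem_Icc hgm hgI) (integrable_const _), integral_const,
      smul_eq_mul]
    field_simp at h2
    linarith

variable {A B : Set Γ} {ε : ℝ} {h : Γ → ℝ}

theorem bvp_boundary_mem (hAB : Disjoint A B) (hε : ε ≤ 1) {y : Γ} (hy : y ∈ A ∪ B) :
    B.indicator (fun _ => (1 : ℝ)) y + ε * A.indicator (fun _ => (1 : ℝ)) y ∈ Icc ε 1 := by
  rcases hy with hy | hy
  · simp [hy, Set.disjoint_left.1 hAB hy, hε]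
  · simp [hy, Set.disjoint_right.1 hAB hy, hε]

theorem exists_rate_bound (L : Kernel Γ Γ) [IsFiniteKernel L] :
    ∃ l : ℝ≥0, 0 < l ∧ ∀ y, L y univ ≤ l := by
  -- The summand 1 keeps the bound positive even when L is zero.
  refine ⟨L.bound.toNNReal + 1, by positivity, fun y => (L.measure_le_bound y univ).trans ?_⟩
  rw [ENNReal.coe_add, ENNReal.coe_toNNReal L.bound_lt_top.ne]
  exact le_self_add

theorem real_le_of_le {l : ℝ≥0} (hl : ∀ y, L y univ ≤ l) (y : Γ) : (L y).real univ ≤ l :=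
  ENNReal.toReal_mono ENNReal.coe_ne_top (hl y)

/-- The unique solution takes its values between the boundary values. -/
theorem IsUniqueBVPSolution.mem_Icc (hh : IsUniqueBVPSolution L A B ε h) (hA : MeasurableSet A)
    (hB : MeasurableSet B) (hAB : Disjoint A B) (hε : ε ≤ 1) (y : Γ) : h y ∈ Icc ε 1 := by
  obtain ⟨l, hl0, hl⟩ := exists_rate_bound L
  obtain ⟨g, hgm, hgI, hgb, hgh, _⟩ := exists_tendsto_bvpIter (L := L) (E := A ∪ B)
    (b := fun y => B.indicator (fun _ => (1 : ℝ)) y + ε * A.indicator (fun _ => (1 : ℝ)) y)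
    (hA.union hB) ((measurable_const.indicator hB).add
      (measurable_const.mul (measurable_const.indicator hA)))
    (l := l) (NNReal.coe_pos.2 hl0) (real_le_of_le hl) hε (fun y hy => bvp_boundary_mem hAB hε hy)
  have : g = h := hh.2 g ⟨hgm, ⟨max |ε| |1|, fun y => abs_le_max_abs_abs (hgI y).1 (hgI y).2⟩, hgh, hgb⟩
  exact this ▸ hgI y

/-- By uniqueness the iterates of the killed transition operator tend to zero. -/
theorem IsUniqueBVPSolution.exists_killed_iterates (hh : IsUniqueBVPSolution L A B ε h)
    (hA : MeasurableSet A) (hB : MeasurableSet B) {l : ℝ≥0} (hl0 : 0 < l)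
    (hl : ∀ y, L y univ ≤ l) :
    ∃ w : ℕ → Γ → ℝ≥0∞, (∀ k, Measurable (w k)) ∧ (∀ k y, w k y ≤ 1) ∧
      (∀ k, ∀ y ∈ A ∪ B, w k y = 0) ∧ (∀ y, y ∉ A ∪ B → w 0 y = 1) ∧
      (∀ k y, w (k + 1) y ≤ w k y) ∧
      (∀ k, ∀ y, y ∉ A ∪ B →
        ∫⁻ z, w k z ∂(L y) + (l - L y univ) * w k y = l * w (k + 1) y) ∧
      ∀ y, Tendsto (fun k => w k y) atTop (𝓝 0) := by
  have hE := hA.union hB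
  have hl0' : (0 : ℝ) < l := NNReal.coe_pos.2 hl0
  have hl' := real_le_of_le hl
  have hb : Measurable fun _ : Γ => (0 : ℝ) := measurable_const
  -- The iteration is an increasing one, so the killed iterates are obtained with the opposite sign,
  -- from -1 up to the zero boundary value.
  have hbm : ∀ y ∈ A ∪ B, (fun _ : Γ => (0 : ℝ)) y ∈ Icc (-1 : ℝ) 0 := fun _ _ => by simp
  have hmM : (-1 : ℝ) ≤ 0 := by norm_num
  set g := bvpIter L (A ∪ B) (fun _ => 0) l (-1) with hgdef
  have hgm : ∀ k, Measurable (g k) := measurable_bvpIter hE hb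
  have hgI : ∀ k y, g k y ∈ Icc (-1 : ℝ) 0 := bvpIter_mem hE hb hl0' hl' hmM hbm
  have hgs : ∀ k y, g k y ≤ g (k + 1) y := bvpIter_le_succ hE hb hl0' hl' hmM hbm
  obtain ⟨u, hum, huI, hub, huh, hulim⟩ := exists_tendsto_bvpIter hE hb hl0' hl' hmM hbm
  have hu0 : ∀ y, u y = 0 := by
    obtain ⟨hh1, hh2⟩ := hh
    obtain ⟨C, hC⟩ := hh1.bounded
    have hbdd : ∀ y, h y ∈ Icc (-C) C := fun y => abs_le.1 (hC y)
    -- The limit u solves the homogeneous problem, so h + u is another bounded solution and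
    -- uniqueness forces u = 0.
    have := hh2 (fun y => h y + u y) ⟨hh1.measurable.add hum, ⟨C + 1, fun y => ?_⟩,
      fun y hy => ?_, fun y hy => ?_⟩
    · intro y
      have := congrFun this y
      simpa using this
    · have h1 := hbdd y
      have h2 := huI y
      exact abs_le.2 ⟨by linarith [h1.1, h2.1], by linarith [h1.2, h2.2]⟩
    · have h1 : Integrable (fun z => h z - h y) (L y) :=
        (integrable_of_mem_Icc hh1.measurable hbdd).sub (integrable_const _)
      have h2 : Integrable (fun z => u z - u y) (L y) :=
        (integrable_of_mem_Icc hum huI).sub (integrable_const _)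
      have h3 := integral_add h1 h2
      rw [hh1.harmonic y hy, huh y hy, add_zero] at h3
      rw [← h3]
      refine integral_congr_ae (ae_of_all _ fun z => ?_)
      simp only
      ring
    · rw [hh1.boundary y hy, hub y hy, add_zero]
  -- The index is shifted by one because g 0 = -1 also on A ∪ B, where the killed iterates must
  -- vanish.
  refine ⟨fun k y => ENNReal.ofReal (-g (k + 1) y), fun k => (hgm _).neg.ennreal_ofReal,
    fun k y => ?_, fun k y hy => ?_, fun y hy => ?_, fun k y => ?_, fun k y hy => ?_, fun y => ?_⟩
  · rw [← ENNReal.ofReal_one]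
    exact ENNReal.ofReal_le_ofReal (by linarith [(hgI (k + 1) y).1])
  · simp [hgdef, bvpIter, bvpStep, hy]
  · have : g (0 + 1) y = -1 := by
      simp only [hgdef, bvpIter]
      exact bvpStep_const hl0' _ hy
    simp [this]
  · exact ENNReal.ofReal_le_ofReal (by linarith [hgs (k + 1) y])
  · have h0 : ∀ z, 0 ≤ -g (k + 1) z := fun z => by linarith [(hgI (k + 1) z).2]
    have hi : Integrable (g (k + 1)) (L y) := integrable_of_mem_Icc (hgm _) (hgI _)
    have h1 : ∫⁻ z, ENNReal.ofReal (-g (k + 1) z) ∂(L y) =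
        ENNReal.ofReal (∫ z, -g (k + 1) z ∂(L y)) :=
      (ofReal_integral_eq_lintegral_ofReal hi.neg (ae_of_all _ h0)).symm
    have h2 : (l : ℝ≥0∞) - L y univ = ENNReal.ofReal (l - (L y).real univ) := by
      rw [ENNReal.ofReal_sub _ measureReal_nonneg, ENNReal.ofReal_coe_nnreal,
        ofReal_measureReal]
    change ∫⁻ z, ENNReal.ofReal (-g (k + 1) z) ∂(L y) + (l - L y univ) *
      ENNReal.ofReal (-g (k + 1) y) = l * ENNReal.ofReal (-g (k + 1 + 1) y)
    rw [h1, h2, ← ENNReal.ofReal_mul (sub_nonneg.2 (hl' y)), ← ENNReal.ofReal_coe_nnreal,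
      ← ENNReal.ofReal_mul (NNReal.coe_nonneg l), ← ENNReal.ofReal_add (integral_nonneg h0)
        (mul_nonneg (sub_nonneg.2 (hl' y)) (h0 y))]
    congr 1
    have h3 : g (k + 1 + 1) y = (1 - (L y).real univ / l) * g (k + 1) y +
        (l : ℝ)⁻¹ * ∫ z, g (k + 1) z ∂(L y) := by
      simp only [hgdef]
      rw [bvpIter, bvpStep, if_neg hy]
    rw [h3, integral_neg]
    field_simp
    ring
  · have h1 := (hulim y).neg
    rw [hu0 y, neg_zero] at h1
    have h2 := (ENNReal.tendsto_ofReal h1).comp (tendsto_add_atTop_nat 1)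
    rw [ENNReal.ofReal_zero] at h2
    exact h2

end BoundaryValue

/-! ### The density process of a harmonic function -/

section Density

variable {Γ : Type*} [TopologicalSpace Γ] [PolishSpace Γ] [MeasurableSpace Γ] [BorelSpace Γ]
  {L : Kernel Γ Γ} [IsFiniteKernel L]
  {𝔉 : Filtration ℝ≥0 (inferInstance : MeasurableSpace (PathSpace Γ))}
  {P : Measure (PathSpace Γ)} {A B : Set Γ} {w : Γ → ℝ≥0∞} {c : ℝ≥0∞}

theorem ae_eventually_stop_eq_hitValue (hP : ∀ᵐ ω ∂P, IsPureJump ω.1)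
    (hτ : ∀ᵐ ω ∂P, hitTime A B ω ≠ ⊤) :
    ∀ᵐ ω ∂P, ∀ᶠ m : ℕ in atTop, (denseStop (A ∪ B) ω).1 m = hitValue A B ω := by
  filter_upwards [hP, hτ] with ω hω hωτ
  have h := (tendsto_natCast_atTop_atTop (R := ℝ≥0)).eventually (eventually_not_alive hω hωτ)
  filter_upwards [h] with m hm using (denseStop_of_not_alive hω hm).1

theorem aemeasurable_hitValue (hP : ∀ᵐ ω ∂P, IsPureJump ω.1)
    (hτ : ∀ᵐ ω ∂P, hitTime A B ω ≠ ⊤) (hE : MeasurableSet (A ∪ B)) :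
    AEMeasurable (hitValue A B) P := by
  let := TopologicalSpace.upgradeIsCompletelyMetrizable Γ
  refine aemeasurable_of_tendsto_metrizable_ae atTop
    (f := fun (m : ℕ) (ω : PathSpace Γ) => (denseStop (A ∪ B) ω).1 m)
    (fun m => ((measurable_canon _).comp (measurable_denseStop hE)).aemeasurable) ?_
  filter_upwards [ae_eventually_stop_eq_hitValue hP hτ] with ω hω
  exact tendsto_const_nhds.congr' (hω.mono fun m hm => hm.symm)

/-- The bounded martingale w(X_{t∧τ}) is eventually equal to w(X_τ) along almost every path; let the
later time tend to infinity. -/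
theorem setLIntegral_hitValue_eq [IsFiniteMeasure P] (hP : ∀ᵐ ω ∂P, IsPureJump ω.1)
    (hX : ∀ t, Measurable[𝔉 t] (canon t : PathSpace Γ → Γ))
    (hC : CompensationFormula L 𝔉 P fun _ => 1) (hE : MeasurableSet (A ∪ B))
    (hτ : ∀ᵐ ω ∂P, hitTime A B ω ≠ ⊤) (hw : Measurable w) (hc : c ≠ ∞) (hwc : ∀ x, w x ≤ c)
    (hharm : ∀ x, x ∉ A ∪ B → ∫⁻ y, w y ∂(L x) = w x * L x univ)
    {q : ℝ≥0} {F : Set (PathSpace Γ)} (hF : MeasurableSet[𝔉 q] F) :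
    ∫⁻ ω in F, w (hitValue A B ω) ∂P = ∫⁻ ω in F, w ((denseStop (A ∪ B) ω).1 q) ∂P := by
  have h1 : Tendsto (fun m : ℕ => ∫⁻ ω in F, w ((denseStop (A ∪ B) ω).1 m) ∂P) atTop
      (𝓝 (∫⁻ ω in F, w (hitValue A B ω) ∂P)) := by
    refine tendsto_lintegral_of_dominated_convergence (fun _ => c)
      (fun m => measurable_stop hE hw _) (fun m => ae_of_all _ fun ω => hwc _) ?_ ?_
    · rw [lintegral_const]
      exact ENNReal.mul_ne_top hc (measure_ne_top _ _)
    · filter_upwards [ae_restrict_of_ae (ae_eventually_stop_eq_hitValue hP hτ)] with ω hω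
      exact tendsto_const_nhds.congr' (hω.mono fun m hm => by simp only [hm])
  refine tendsto_nhds_unique h1 (tendsto_const_nhds.congr' ?_)
  filter_upwards [(tendsto_natCast_atTop_atTop (R := ℝ≥0)).eventually_ge_atTop q] with m hm
  exact (setLIntegral_stop_eq hP hX hC hE hm hF hw hc hwc hharm).symm

/-- Against functions known at time q the density w(X_τ) can be replaced by w(X_{q∧τ}): the two
weighted measures agree on events known at q. -/
theorem lintegral_withDensity_hitValue [IsFiniteMeasure P] (hP : ∀ᵐ ω ∂P, IsPureJump ω.1)
    (hX : ∀ t, Measurable[𝔉 t] (canon t : PathSpace Γ → Γ))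
    (hC : CompensationFormula L 𝔉 P fun _ => 1) (hE : MeasurableSet (A ∪ B))
    (hτ : ∀ᵐ ω ∂P, hitTime A B ω ≠ ⊤) (hw : Measurable w) (hc : c ≠ ∞) (hwc : ∀ x, w x ≤ c)
    (hharm : ∀ x, x ∉ A ∪ B → ∫⁻ y, w y ∂(L x) = w x * L x univ)
    {q : ℝ≥0} {Y : PathSpace Γ → ℝ≥0∞} (hY : Measurable[𝔉 q] Y) :
    ∫⁻ ω, Y ω ∂(P.withDensity fun ω => w (hitValue A B ω)) =
      ∫⁻ ω, w ((denseStop (A ∪ B) ω).1 q) * Y ω ∂P := by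
  have hle := 𝔉.le q
  have hYm : Measurable Y := hY.mono hle le_rfl
  have htrim : (P.withDensity fun ω => w (hitValue A B ω)).trim hle =
      (P.withDensity fun ω => w ((denseStop (A ∪ B) ω).1 q)).trim hle := by
    refine @Measure.ext _ (𝔉 q) _ _ fun F hF => ?_
    rw [trim_measurableSet_eq hle hF, trim_measurableSet_eq hle hF,
      withDensity_apply _ (hle _ hF), withDensity_apply _ (hle _ hF)]
    exact setLIntegral_hitValue_eq hP hX hC hE hτ hw hc hwc hharm hF
  rw [← lintegral_trim hle hY, htrim, lintegral_trim hle hY,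
    lintegral_withDensity_eq_lintegral_mul _ (measurable_stop hE hw q) hYm]
  rfl

/-- The mean of the density can be computed at time 0, where it is w(x). -/
theorem isProbabilityMeasure_withDensity_hitValue [IsProbabilityMeasure P]
    (hP : ∀ᵐ ω ∂P, IsPureJump ω.1) (hX : ∀ t, Measurable[𝔉 t] (canon t : PathSpace Γ → Γ))
    (hC : CompensationFormula L 𝔉 P fun _ => 1) (hE : MeasurableSet (A ∪ B))
    (hτ : ∀ᵐ ω ∂P, hitTime A B ω ≠ ⊤) (hw : Measurable w) (hc : c ≠ ∞) (hwc : ∀ x, w x ≤ c)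
    (hharm : ∀ x, x ∉ A ∪ B → ∫⁻ y, w y ∂(L x) = w x * L x univ)
    {x : Γ} (hx : ∀ᵐ ω ∂P, ω.1 0 = x) (hwx : w x = 1) :
    IsProbabilityMeasure (P.withDensity fun ω => w (hitValue A B ω)) := by
  constructor
  have h := lintegral_withDensity_hitValue hP hX hC hE hτ hw hc hwc hharm (q := 0)
    (Y := fun _ => 1) measurable_const
  rw [lintegral_one] at h
  rw [h]
  calc ∫⁻ ω, w ((denseStop (A ∪ B) ω).1 0) * 1 ∂P = ∫⁻ _, 1 ∂P :=
        lintegral_congr_ae (hx.mono fun ω hω => by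
          simp only [denseStop_apply_zero, hω, hwx, mul_one])
    _ = 1 := by simp

end Density

/-! ### Change of measure -/

section Girsanov

/-- The right end point of the interval `(j / (k + 1), (j + 1) / (k + 1)]` containing `u`. -/
def rightPt (k : ℕ) (u : ℝ≥0) : ℝ≥0 := (⌈u * (k + 1)⌉₊ : ℝ≥0) / (k + 1)

theorem le_rightPt (k : ℕ) (u : ℝ≥0) : u ≤ rightPt k u := by
  rw [rightPt, le_div_iff₀ (by positivity)]
  exact Nat.le_ceil _

theorem rightPt_le (k : ℕ) (u : ℝ≥0) : rightPt k u ≤ u + 1 / (k + 1) := by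
  have h : (0 : ℝ≥0) < k + 1 := by positivity
  rw [rightPt, div_le_iff₀ h, add_mul, one_div, inv_mul_cancel₀ h.ne']
  exact (Nat.ceil_lt_add_one zero_le).le

theorem tendsto_rightPt (u : ℝ≥0) : Tendsto (fun k => rightPt k u) atTop (𝓝[≥] u) := by
  refine tendsto_nhdsWithin_iff.2 ⟨?_, Eventually.of_forall fun k => le_rightPt k u⟩
  refine tendsto_of_tendsto_of_tendsto_of_le_of_le tendsto_const_nhds (h := fun k : ℕ =>
    u + 1 / ((k : ℝ≥0) + 1)) ?_ (fun k => le_rightPt k u) (fun k => rightPt_le k u)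
  have := (tendsto_one_div_add_atTop_nhds_zero_nat (𝕜 := ℝ≥0)).const_add u
  simpa using this

variable {Γ : Type*} [TopologicalSpace Γ] [MeasurableSpace Γ]

theorem IsPureJump.eventually_rightPt {p : ℝ≥0 → Γ} (hp : IsPureJump p) (u : ℝ≥0) :
    ∀ᶠ k in atTop, p (rightPt k u) = p u := by
  refine (tendsto_rightPt u).eventually (p := fun s => p s = p u) ?_
  rw [← Ioi_insert, nhdsWithin_insert]
  exact eventually_sup.2 ⟨by simp, (hp u).1⟩

theorem jumpIntegral_eq_tsum_grid (k : ℕ) (t : ℝ≥0) (H : (ℝ≥0 × PathSpace Γ) × Γ → ℝ≥0∞)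
    (ω : PathSpace Γ) :
    jumpIntegral t H ω = ∑' j : ℕ, jumpIntegral (((j : ℝ≥0) + 1) / (k + 1)) (fun z =>
      (Ioc ((j : ℝ≥0) / (k + 1)) ((j + 1) / (k + 1)) ∩ Iic t).indicator 1 z.1.1 * H z) ω := by
  simp only [jumpIntegral]
  rw [← jumpSum_tsum]
  refine jumpSum_congr fun u hu => ?_
  have h0 := pos_of_mem_jumpSet hu
  have hk : (0 : ℝ≥0) < k + 1 := by positivity
  rw [tsum_eq_single (⌈u * (k + 1)⌉₊ - 1)]
  · have h1 := (ceil_sub_one_eq_iff hk h0).1 rfl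
    by_cases h2 : u ≤ t
    · simp only [indicator, mem_Iic, h2, h1.2, if_true, mem_inter_iff, h1, and_self, Pi.one_apply,
        one_mul]
    · simp [indicator, h2]
  · intro j hj
    have h1 : u ∉ Ioc ((j : ℝ≥0) / (k + 1)) ((j + 1) / (k + 1)) := fun h =>
      hj ((ceil_sub_one_eq_iff hk h0).2 h).symm
    simp only [indicator, mem_inter_iff, h1, false_and, if_false, zero_mul, ite_self]

/-- On each cell the sampled factor D has the constant value at the right end and leaves the sum. -/
theorem jumpIntegral_rightPt_mul_eq_tsum_grid (k : ℕ) (t : ℝ≥0)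
    (H : (ℝ≥0 × PathSpace Γ) × Γ → ℝ≥0∞) (D : ℝ≥0 → PathSpace Γ → ℝ≥0∞) (ω : PathSpace Γ) :
    jumpIntegral t (fun z => D (rightPt k z.1.1) z.1.2 * H z) ω =
      ∑' j : ℕ, D (((j : ℝ≥0) + 1) / (k + 1)) ω * jumpIntegral (((j : ℝ≥0) + 1) / (k + 1)) (fun z =>
      (Ioc ((j : ℝ≥0) / (k + 1)) ((j + 1) / (k + 1)) ∩ Iic t).indicator 1 z.1.1 * H z) ω := by
  rw [jumpIntegral_eq_tsum_grid k]
  refine tsum_congr fun j => ?_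
  rw [← jumpIntegral_const_mul]
  refine jumpIntegral_congr fun u hu _ => ?_
  have h0 := pos_of_mem_jumpSet hu
  have hk : (0 : ℝ≥0) < k + 1 := by positivity
  simp only
  by_cases h : u ∈ Ioc ((j : ℝ≥0) / (k + 1)) ((j + 1) / (k + 1)) ∩ Iic t
  · have h1 := (ceil_sub_one_eq_iff hk h0).2 h.1
    have h2 : 0 < ⌈u * (k + 1)⌉₊ := Nat.ceil_pos.2 (by positivity)
    have h3 : ⌈u * (k + 1)⌉₊ = j + 1 := by omega
    simp only [rightPt, h3]
    push_cast
    ring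
  · simp only [indicator_of_notMem h, zero_mul, mul_zero]

variable [PolishSpace Γ] [BorelSpace Γ]
  {L : Kernel Γ Γ} [IsFiniteKernel L]
  {𝔉 : Filtration ℝ≥0 (inferInstance : MeasurableSpace (PathSpace Γ))}
  {P : Measure (PathSpace Γ)} {A B : Set Γ} {w : Γ → ℝ≥0∞} {c : ℝ≥0∞}

theorem measurable_uncurry_canon : Measurable fun z : ℝ≥0 × PathSpace Γ => canon z.1 z.2 := by
  let := TopologicalSpace.upgradeIsCompletelyMetrizable Γ
  refine measurable_of_tendsto_metrizable
    (f := fun (k : ℕ) (z : ℝ≥0 × PathSpace Γ) => canon (rightPt k z.1) z.2) (fun k => ?_)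
    (tendsto_pi_nhds.2 fun z => ?_)
  · have h1 : Measurable fun z : ℕ × PathSpace Γ => canon ((z.1 : ℝ≥0) / (k + 1)) z.2 :=
      measurable_from_prod_countable_right fun j => measurable_canon ((j : ℝ≥0) / (k + 1))
    have h2 : Measurable fun z : ℝ≥0 × PathSpace Γ => (⌈z.1 * (k + 1)⌉₊, z.2) :=
      (Nat.measurable_ceil.comp (measurable_fst.mul_const _)).prodMk measurable_snd
    exact h1.comp h2
  · exact (z.2.2 z.1).1.tendsto.comp (tendsto_rightPt z.1)

theorem measurable_predictable_indicator_time {S : Set ℝ≥0} {a b : ℝ≥0} (hS : S = Ioc a b) :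
    Measurable[𝔉.predictable] fun z : ℝ≥0 × PathSpace Γ => S.indicator (1 : ℝ≥0 → ℝ≥0∞) z.1 := by
  have h1 : MeasurableSet[𝔉.predictable] (Ioi a ×ˢ univ : Set (ℝ≥0 × PathSpace Γ)) :=
    measurableSet_predictable_Ioi_prod MeasurableSet.univ
  have h2 : MeasurableSet[𝔉.predictable] (Ioi b ×ˢ univ : Set (ℝ≥0 × PathSpace Γ)) :=
    measurableSet_predictable_Ioi_prod MeasurableSet.univ
  have h3 : Measurable[𝔉.predictable] (fun _ : ℝ≥0 × PathSpace Γ => (1 : ℝ≥0∞)) :=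
    measurable_const
  refine measurable_of_forall_eq (h3.indicator (h1.diff h2)) fun z => ?_
  by_cases h4 : a < z.1 <;> by_cases h5 : b < z.1 <;> simp [hS, indicator, h4, h5, not_le.2, not_lt.1]

/-- The sum over one cell is known at the right end of the cell, so there the density may be
replaced by its value at that time; then the cells are added up. -/
theorem lintegral_jumpIntegral_withDensity_grid [IsFiniteMeasure P]
    (hP : ∀ᵐ ω ∂P, IsPureJump ω.1) (hX : ∀ t, Measurable[𝔉 t] (canon t : PathSpace Γ → Γ))
    (hC : CompensationFormula L 𝔉 P fun _ => 1) (hE : MeasurableSet (A ∪ B))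
    (hτ : ∀ᵐ ω ∂P, hitTime A B ω ≠ ⊤) (hw : Measurable w) (hc : c ≠ ∞) (hwc : ∀ x, w x ≤ c)
    (hharm : ∀ x, x ∉ A ∪ B → ∫⁻ y, w y ∂(L x) = w x * L x univ) (k : ℕ) (t : ℝ≥0)
    {H : (ℝ≥0 × PathSpace Γ) × Γ → ℝ≥0∞} (hH : Measurable[𝔉.predictable.prod inferInstance] H) :
    AEMeasurable (jumpIntegral t
      (fun z => w ((denseStop (A ∪ B) z.1.2).1 (rightPt k z.1.1)) * H z)) P ∧
    ∫⁻ ω, jumpIntegral t H ω ∂(P.withDensity fun ω => w (hitValue A B ω)) =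
    ∫⁻ ω, jumpIntegral t
      (fun z => w ((denseStop (A ∪ B) z.1.2).1 (rightPt k z.1.1)) * H z) ω ∂P := by
  have hac : (P.withDensity fun ω => w (hitValue A B ω)) ≪ P :=
    withDensity_absolutelyContinuous _ _
  have hHj : ∀ j : ℕ, Measurable[𝔉.predictable.prod inferInstance] fun z =>
      (Ioc ((j : ℝ≥0) / (k + 1)) ((j + 1) / (k + 1)) ∩ Iic t).indicator 1 z.1.1 * H z := by
    intro j
    refine Measurable.mul ?_ hH
    exact (measurable_predictable_indicator_time (𝔉 := 𝔉) (Γ := Γ) (a := (j : ℝ≥0) / (k + 1))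
      (b := min ((j + 1) / (k + 1)) t) (by ext u; simp)).comp measurable_fst
  choose Y hYm hY using fun j : ℕ =>
    exists_measurable_eq_jumpIntegral hX (((j : ℝ≥0) + 1) / (k + 1)) (hHj j)
  have hYm' : ∀ j, Measurable (Y j) := fun j => (hYm j).mono (𝔉.le _) le_rfl
  have e1 : ∀ᵐ ω ∂P, jumpIntegral t
      (fun z => w ((denseStop (A ∪ B) z.1.2).1 (rightPt k z.1.1)) * H z) ω =
      ∑' j : ℕ, w ((denseStop (A ∪ B) ω).1 (((j : ℝ≥0) + 1) / (k + 1))) * Y j ω := by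
    filter_upwards [hP] with ω hω
    rw [jumpIntegral_rightPt_mul_eq_tsum_grid k t H
      (fun s ω => w ((denseStop (A ∪ B) ω).1 s))]
    exact tsum_congr fun j => by rw [hY j ω hω]
  have hmeas : ∀ j : ℕ, Measurable fun ω =>
      w ((denseStop (A ∪ B) ω).1 (((j : ℝ≥0) + 1) / (k + 1))) * Y j ω :=
    fun j => (measurable_stop hE hw _).mul (hYm' j)
  refine ⟨⟨_, Measurable.tsum hmeas, e1⟩, ?_⟩
  rw [lintegral_congr_ae e1, lintegral_tsum fun j => (hmeas j).aemeasurable]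
  have e2 : ∀ᵐ ω ∂(P.withDensity fun ω => w (hitValue A B ω)),
      jumpIntegral t H ω = ∑' j : ℕ, Y j ω := by
    filter_upwards [hac.ae_le hP] with ω hω
    rw [jumpIntegral_eq_tsum_grid k]
    exact tsum_congr fun j => by rw [hY j ω hω]
  rw [lintegral_congr_ae e2, lintegral_tsum fun j => (hYm' j).aemeasurable]
  exact tsum_congr fun j =>
    lintegral_withDensity_hitValue hP hX hC hE hτ hw hc hwc hharm (hYm j)

end Girsanov

/-! ### Compensator under the density w(X_τ) -/

section Girsanov

variable {Γ : Type*} [TopologicalSpace Γ] [PolishSpace Γ] [MeasurableSpace Γ] [BorelSpace Γ]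
  {L : Kernel Γ Γ} [IsFiniteKernel L]
  {𝔉 : Filtration ℝ≥0 (inferInstance : MeasurableSpace (PathSpace Γ))}
  {P : Measure (PathSpace Γ)} {A B : Set Γ} {w : Γ → ℝ≥0∞} {c : ℝ≥0∞}

theorem jumpIntegral_mono {t : ℝ≥0} {H H' : (ℝ≥0 × PathSpace Γ) × Γ → ℝ≥0∞} (h : ∀ z, H z ≤ H' z)
    (ω : PathSpace Γ) : jumpIntegral t H ω ≤ jumpIntegral t H' ω := by
  refine jumpSum_mono fun u _ => ?_
  by_cases h3 : u ≤ t <;> simp [h3, h]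

theorem lintegral_jumpIntegral_const_ne_top [IsFiniteMeasure P]
    (hC : CompensationFormula L 𝔉 P fun _ => 1) (t : ℝ≥0) (hc : c ≠ ∞) :
    ∫⁻ ω, jumpIntegral t (fun _ => c) ω ∂P ≠ ∞ := by
  rw [hC t _ measurable_const]
  have h1 : ∫⁻ ω, rateIntegral L t (fun _ => c * 1) ω ∂P ≤ ∫⁻ _, c * L.bound * t ∂P :=
    lintegral_mono fun ω => rateIntegral_le t (fun z => (mul_one c).le) ω
  refine (h1.trans_lt ?_).ne
  rw [lintegral_const]
  have := L.bound_lt_top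
  have := hc.lt_top
  have := measure_lt_top P univ
  finiteness

/-- The jumps under the changed measure, weighted with the density at the time of the jump. -/
theorem lintegral_jumpIntegral_withDensity [IsFiniteMeasure P]
    (hP : ∀ᵐ ω ∂P, IsPureJump ω.1) (hX : ∀ t, Measurable[𝔉 t] (canon t : PathSpace Γ → Γ))
    (hC : CompensationFormula L 𝔉 P fun _ => 1) (hE : MeasurableSet (A ∪ B))
    (hτ : ∀ᵐ ω ∂P, hitTime A B ω ≠ ⊤) (hw : Measurable w) (hc : c ≠ ∞) (hwc : ∀ x, w x ≤ c)
    (hharm : ∀ x, x ∉ A ∪ B → ∫⁻ y, w y ∂(L x) = w x * L x univ) (t : ℝ≥0)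
    {H : (ℝ≥0 × PathSpace Γ) × Γ → ℝ≥0∞} (hH : Measurable[𝔉.predictable.prod inferInstance] H)
    {d : ℝ≥0∞} (hd : d ≠ ∞) (hHd : ∀ z, H z ≤ d) :
    ∫⁻ ω, jumpIntegral t H ω ∂(P.withDensity fun ω => w (hitValue A B ω)) =
      ∫⁻ ω, jumpIntegral t (fun z => w ((denseStop (A ∪ B) z.1.2).1 z.1.1) * H z) ω ∂P := by
  have hgrid := fun k => lintegral_jumpIntegral_withDensity_grid hP hX hC hE hτ hw hc hwc hharm k t hH
  have hlim : Tendsto (fun k => ∫⁻ ω, jumpIntegral t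
      (fun z => w ((denseStop (A ∪ B) z.1.2).1 (rightPt k z.1.1)) * H z) ω ∂P) atTop
      (𝓝 (∫⁻ ω, jumpIntegral t (fun z => w ((denseStop (A ∪ B) z.1.2).1 z.1.1) * H z) ω ∂P)) := by
    -- A path has finitely many jumps up to t, and right of each of them the stopped path is
    -- constant, so the sampled density is eventually the one at the jump time itself. The number of
    -- jumps times c d dominates.
    refine tendsto_lintegral_of_dominated_convergence' (jumpIntegral t fun _ => c * d)
      (fun k => (hgrid k).1) (fun k => ae_of_all _ fun ω => ?_)
      (lintegral_jumpIntegral_const_ne_top hC t (ENNReal.mul_ne_top hc hd)) ?_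
    · exact jumpIntegral_mono (fun z => mul_le_mul' (hwc _) (hHd z)) ω
    · filter_upwards [hP] with ω hω
      refine tendsto_const_nhds.congr' ?_
      have h1 : ∀ᶠ k in atTop, ∀ u ∈ jumpSet ω.1 ∩ Iic t,
          (denseStop (A ∪ B) ω).1 (rightPt k u) = (denseStop (A ∪ B) ω).1 u :=
        (eventually_all_finite (hω.finite_jumpSet t)).2 fun u _ =>
          (isPureJump_denseStop hω A B).eventually_rightPt u
      filter_upwards [h1] with k hk
      exact jumpIntegral_congr fun u hu hut => by simp only [hk u ⟨hu, hut⟩]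
  refine tendsto_nhds_unique (tendsto_const_nhds.congr fun k => ?_) hlim
  exact (hgrid k).2

/-- The rates under the changed measure, weighted with the density just before the jump. -/
theorem lintegral_rateIntegral_withDensity [IsFiniteMeasure P]
    (hP : ∀ᵐ ω ∂P, IsPureJump ω.1) (hX : ∀ t, Measurable[𝔉 t] (canon t : PathSpace Γ → Γ))
    (hC : CompensationFormula L 𝔉 P fun _ => 1) (hE : MeasurableSet (A ∪ B))
    (hτ : ∀ᵐ ω ∂P, hitTime A B ω ≠ ⊤) (hw : Measurable w) (hc : c ≠ ∞) (hwc : ∀ x, w x ≤ c)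
    (hharm : ∀ x, x ∉ A ∪ B → ∫⁻ y, w y ∂(L x) = w x * L x univ) (t : ℝ≥0)
    {H : (ℝ≥0 × PathSpace Γ) × Γ → ℝ≥0∞} (hH : Measurable[𝔉.predictable.prod inferInstance] H) :
    ∫⁻ ω, rateIntegral L t H ω ∂(P.withDensity fun ω => w (hitValue A B ω)) =
      ∫⁻ ω, rateIntegral L t
        (fun z => w (canonLeft z.1.1 (denseStop (A ∪ B) z.1.2)) * H z) ω ∂P := by
  set J : ℝ≥0 × PathSpace Γ → ℝ≥0∞ := fun z => ∫⁻ y, H (z, y) ∂(L (canonLeft z.1 z.2)) with hJ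
  have hJp : Measurable[𝔉.predictable] J :=
    measurable_lintegral_rate (measurable_predictable_canonLeft hX) hH
  have hJs : ∀ s, Measurable[𝔉 s] fun ω => J (s, ω) := by
    intro s
    have h2 := @Measurable.comp _ _ _ (𝔉 s) (MeasurableSpace.prod inferInstance (𝔉 s)) _ _ _
      (hJp.comp (measurable_min_predictable s))
      (@measurable_prodMk_left _ _ _ (𝔉 s) s)
    exact measurable_of_forall_eq h2 fun ω => by simp
  have hJm : Measurable J := hJp.mono predictable_le_prod le_rfl
  have hJm' : Measurable fun z : PathSpace Γ × ℝ => J (z.2.toNNReal, z.1) :=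
    hJm.comp ((measurable_real_toNNReal.comp measurable_snd).prodMk measurable_fst)
  have hDm : Measurable fun z : ℝ≥0 × PathSpace Γ => w ((denseStop (A ∪ B) z.2).1 z.1) :=
    hw.comp (measurable_uncurry_canon.comp
      (measurable_fst.prodMk ((measurable_denseStop hE).comp measurable_snd)))
  have hDm' : Measurable fun z : PathSpace Γ × ℝ =>
      w ((denseStop (A ∪ B) z.1).1 z.2.toNNReal) :=
    hDm.comp ((measurable_real_toNNReal.comp measurable_snd).prodMk measurable_fst)
  have e1 : ∀ ω : PathSpace Γ, IsPureJump ω.1 → rateIntegral L t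
      (fun z => w (canonLeft z.1.1 (denseStop (A ∪ B) z.1.2)) * H z) ω =
      ∫⁻ s in Ioc (0 : ℝ) t, w ((denseStop (A ∪ B) ω).1 s.toNNReal) * J (s.toNNReal, ω) := by
    intro ω hω
    -- The stopped path differs from its left limits at finitely many times only, so inside the time
    -- integral the left limit may be replaced by the value; the density can then be exchanged at
    -- each fixed s.
    have hnull : ∀ᵐ s : ℝ, s ∉ (fun u : ℝ≥0 => (u : ℝ)) ''
        (jumpSet (denseStop (A ∪ B) ω).1 ∩ Iic t) :=
      measure_eq_zero_iff_ae_notMem.1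
        ((((isPureJump_denseStop hω A B).finite_jumpSet t).image _).measure_zero volume)
    refine setLIntegral_congr_fun_ae measurableSet_Ioc ?_
    filter_upwards [hnull] with s hs hst
    have h1 : s.toNNReal ∉ jumpSet (denseStop (A ∪ B) ω).1 := fun h =>
      hs ⟨s.toNNReal, ⟨h, Real.toNNReal_le_iff_le_coe.2 hst.2⟩, Real.coe_toNNReal s hst.1.le⟩
    have h2 : canonLeft s.toNNReal (denseStop (A ∪ B) ω) =
        (denseStop (A ∪ B) ω).1 s.toNNReal := by
      by_contra h
      exact h1 (Ne.symm h)
    simp only [h2]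
    exact lintegral_const_mul _ ((measurable_of_predictable hH).comp measurable_prodMk_left)
  rw [lintegral_congr_ae (hP.mono e1)]
  rw [lintegral_lintegral_swap (hDm'.mul hJm').aemeasurable]
  have e2 : ∀ s : ℝ, ∫⁻ ω, w ((denseStop (A ∪ B) ω).1 s.toNNReal) * J (s.toNNReal, ω) ∂P =
      ∫⁻ ω, J (s.toNNReal, ω) ∂(P.withDensity fun ω => w (hitValue A B ω)) := fun s =>
    (lintegral_withDensity_hitValue hP hX hC hE hτ hw hc hwc hharm (hJs _)).symm
  simp only [e2]
  rw [lintegral_lintegral_swap]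
  · rfl
  · exact (hJm.comp ((measurable_real_toNNReal.comp measurable_fst).prodMk
      measurable_snd)).aemeasurable

/-- Under the changed measure the rate is multiplied by `w (X_t) / w (X_{t-})` up to time `τ`. -/
theorem compensation_withDensity [IsFiniteMeasure P]
    (hP : ∀ᵐ ω ∂P, IsPureJump ω.1) (hX : ∀ t, Measurable[𝔉 t] (canon t : PathSpace Γ → Γ))
    (hC : CompensationFormula L 𝔉 P fun _ => 1) (hE : MeasurableSet (A ∪ B))
    (hτ : ∀ᵐ ω ∂P, hitTime A B ω ≠ ⊤) (hw : Measurable w) (hc : c ≠ ∞) (hwc : ∀ x, w x ≤ c)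
    (hharm : ∀ x, x ∉ A ∪ B → ∫⁻ y, w y ∂(L x) = w x * L x univ)
    {k : (ℝ≥0 × PathSpace Γ) × Γ → ℝ≥0∞} (hk : Measurable[𝔉.predictable.prod inferInstance] k)
    (hk1 : ∀ z ∈ aliveSet (A ∪ B), ∀ y, w (canonLeft z.1 z.2) * k (z, y) = w y)
    (hk2 : ∀ z, z ∉ aliveSet (A ∪ B) → ∀ y, k (z, y) = 1) (t : ℝ≥0)
    {H : (ℝ≥0 × PathSpace Γ) × Γ → ℝ≥0∞} (hH : Measurable[𝔉.predictable.prod inferInstance] H)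
    {d : ℝ≥0∞} (hd : d ≠ ∞) (hHd : ∀ z, H z ≤ d) :
    ∫⁻ ω, jumpIntegral t H ω ∂(P.withDensity fun ω => w (hitValue A B ω)) =
      ∫⁻ ω, rateIntegral L t (fun z => H z * k z) ω
        ∂(P.withDensity fun ω => w (hitValue A B ω)) := by
  have hHk : Measurable[𝔉.predictable.prod inferInstance] fun z => H z * k z := hH.mul hk
  have hD : Measurable[𝔉.predictable.prod inferInstance] fun z : (ℝ≥0 × PathSpace Γ) × Γ =>
      w (canonLeft z.1.1 (denseStop (A ∪ B) z.1.2)) :=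
    (hw.comp (measurable_predictable_canonLeft_denseStop hX hE)).comp measurable_fst
  rw [lintegral_jumpIntegral_withDensity hP hX hC hE hτ hw hc hwc hharm t hH hd hHd,
    lintegral_rateIntegral_withDensity hP hX hC hE hτ hw hc hwc hharm t hHk]
  -- The rate side, weighted with the left limit of the density, has a predictable integrand and is
  -- turned back into a jump sum under P. The two jump sums agree term by term: up to τ by the
  -- relation between k and w, afterwards because the stopped path is constant and k = 1.
  have h := hC t (fun z => w (canonLeft z.1.1 (denseStop (A ∪ B) z.1.2)) * (H z * k z))
    (hD.mul hHk)
  simp only [mul_one] at h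
  rw [← h]
  refine lintegral_congr_ae (hP.mono fun ω hω => jumpIntegral_congr fun u hu _ => ?_)
  simp only
  by_cases ha : (u, ω) ∈ aliveSet (A ∪ B)
  · have h1 : canonLeft u (denseStop (A ∪ B) ω) = canonLeft u ω := leftLim_denseStop_of_alive hω ha
    rw [h1, denseStop_of_alive hω ha, ← hk1 _ ha]
    ring
  · have h1 : canonLeft u (denseStop (A ∪ B) ω) = hitValue A B ω :=
      leftLim_denseStop_of_not_alive hω ha
    rw [h1, (denseStop_of_not_alive hω ha).1, hk2 _ ha, mul_one]

end Girsanov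

/-! ### From the compensation formula to the martingale problem -/

section CompensationToMartingale

variable {Γ : Type*} [TopologicalSpace Γ] [PolishSpace Γ] [MeasurableSpace Γ] [BorelSpace Γ]
  {L : Kernel Γ Γ} [IsFiniteKernel L]

theorem integrableOn_integral_kernel {ω : PathSpace Γ} {t : ℝ≥0}
    {K : PathSpace Γ → ℝ≥0 → Measure Γ} {k : (ℝ≥0 × PathSpace Γ) × Γ → ℝ≥0∞} (hk : Measurable k)
    {c : ℝ≥0∞} (hc : c ≠ ∞) (hkc : ∀ z, k z ≤ c)
    (hK : ∀ᵐ s : ℝ, s ∈ Ioc (0 : ℝ) t → K ω s.toNNReal =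
      (L (canonLeft s.toNNReal ω)).withDensity fun y => k ((s.toNNReal, ω), y))
    {φ : ℝ≥0 × Γ × Γ → ℝ} (hφ : Measurable φ) (h0 : ∀ z, 0 ≤ φ z) {C : ℝ} (hC : ∀ z, φ z ≤ C) :
    IntegrableOn (fun s : ℝ => ∫ y, φ (s.toNNReal, canonLeft s.toNNReal ω, y) ∂K ω s.toNNReal)
      (Ioc (0 : ℝ) t) := by
  have hpi : Measurable (pathIntegrand φ : (ℝ≥0 × PathSpace Γ) × Γ → ℝ≥0∞) :=
    measurable_of_predictable (𝔉 := ⊤) (measurable_pathIntegrand measurable_canon hφ)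
  have h1 : IntegrableOn (fun s : ℝ => (∫⁻ y, pathIntegrand φ ((s.toNNReal, ω), y) *
      k ((s.toNNReal, ω), y) ∂L (canonLeft s.toNNReal ω)).toReal) (Ioc (0 : ℝ) t) := by
    refine integrable_toReal_of_lintegral_ne_top (measurable_rate_left
      (H := fun z => pathIntegrand φ z * k z)
      (measurable_section_left (hpi.mul hk) ω)).aemeasurable ?_
    exact (rateIntegral_lt_top (L := L) (ENNReal.mul_ne_top (ENNReal.ofReal_ne_top (r := C)) hc)
      (H := fun z => pathIntegrand φ z * k z)
      (fun z => mul_le_mul' (ENNReal.ofReal_le_ofReal (hC _)) (hkc _)) ω).ne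
  refine h1.congr_fun_ae ?_
  filter_upwards [(ae_restrict_iff' measurableSet_Ioc).2 hK] with s hs
  exact (integral_eq_toReal_of_eq_withDensity hk hs hφ h0).symm

/-- Signed integrands are reduced to nonnegative ones, for which the compensation formula is stated;
bounded rates make all the integrals finite. -/
theorem compensatedSum_eq_sub {ω : PathSpace Γ} (hω : IsPureJump ω.1) {t : ℝ≥0}
    {K : PathSpace Γ → ℝ≥0 → Measure Γ} {k : (ℝ≥0 × PathSpace Γ) × Γ → ℝ≥0∞} (hk : Measurable k)
    {c : ℝ≥0∞} (hc : c ≠ ∞) (hkc : ∀ z, k z ≤ c)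
    (hK : ∀ᵐ s : ℝ, s ∈ Ioc (0 : ℝ) t → K ω s.toNNReal =
      (L (canonLeft s.toNNReal ω)).withDensity fun y => k ((s.toNNReal, ω), y))
    {φ : ℝ≥0 × Γ × Γ → ℝ} (hφ : Measurable φ) {C : ℝ} (hC : ∀ z, |φ z| ≤ C) :
    compensatedSum K φ t ω = compensatedSum K (fun z => max (φ z) 0) t ω -
      compensatedSum K (fun z => max (-φ z) 0) t ω := by
  have hC0 : 0 ≤ C := (abs_nonneg _).trans (hC (0, canonLeft 0 ω, canonLeft 0 ω))
  have hb1 : ∀ z, max (φ z) 0 ≤ C := fun z => max_le ((le_abs_self _).trans (hC z)) hC0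
  have hb2 : ∀ z, max (-φ z) 0 ≤ C := fun z => max_le ((neg_le_abs _).trans (hC z)) hC0
  have hm1 : Measurable fun z => max (φ z) 0 := hφ.max measurable_const
  have hm2 : Measurable fun z => max (-φ z) 0 := hφ.neg.max measurable_const
  have hsub : ∀ a : ℝ, a = max a 0 - max (-a) 0 := fun a => by
    rcases le_total 0 a with h | h
    · rw [max_eq_left h, max_eq_right (by linarith)]; ring
    · rw [max_eq_right h, max_eq_left (by linarith)]; ring
  have e1 : ∑' s : jumpTimes t ω, φ ((s : ℝ≥0), canonLeft (s : ℝ≥0) ω, canon (s : ℝ≥0) ω) =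
      ∑' s : jumpTimes t ω, max (φ ((s : ℝ≥0), canonLeft (s : ℝ≥0) ω, canon (s : ℝ≥0) ω)) 0 -
      ∑' s : jumpTimes t ω, max (-φ ((s : ℝ≥0), canonLeft (s : ℝ≥0) ω, canon (s : ℝ≥0) ω)) 0 := by
    rw [tsum_jumpTimes hω t fun s => φ (s, canonLeft s ω, canon s ω),
      tsum_jumpTimes hω t fun s => max (φ (s, canonLeft s ω, canon s ω)) 0,
      tsum_jumpTimes hω t fun s => max (-φ (s, canonLeft s ω, canon s ω)) 0,
      ← Finset.sum_sub_distrib]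
    exact Finset.sum_congr rfl fun u _ => hsub _
  have i1 := integrableOn_integral_kernel hk hc hkc hK hm1 (fun z => le_max_right _ _) hb1
  have i2 := integrableOn_integral_kernel hk hc hkc hK hm2 (fun z => le_max_right _ _) hb2
  have e2 : ∫ s in Ioc (0 : ℝ) t, ∫ y, φ (s.toNNReal, canonLeft s.toNNReal ω, y)
        ∂(K ω s.toNNReal) =
      (∫ s in Ioc (0 : ℝ) t, ∫ y, max (φ (s.toNNReal, canonLeft s.toNNReal ω, y)) 0
        ∂(K ω s.toNNReal)) -
      ∫ s in Ioc (0 : ℝ) t, ∫ y, max (-φ (s.toNNReal, canonLeft s.toNNReal ω, y)) 0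
        ∂(K ω s.toNNReal) := by
    rw [← integral_sub i1 i2]
    refine integral_congr_ae ?_
    filter_upwards [(ae_restrict_iff' measurableSet_Ioc).2 hK] with s hs
    have hfin : IsFiniteMeasure (K ω s.toNNReal) := by
      rw [hs]
      refine isFiniteMeasure_withDensity (ne_of_lt ?_)
      calc _ ≤ ∫⁻ _, c ∂L (canonLeft s.toNNReal ω) := lintegral_mono fun y => hkc _
        _ < ∞ := by
          rw [lintegral_const]
          exact ENNReal.mul_lt_top hc.lt_top (measure_lt_top _ _)
    have hs : Measurable fun y : Γ => ((s.toNNReal, canonLeft s.toNNReal ω, y) : ℝ≥0 × Γ × Γ) := by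
      fun_prop
    rw [← integral_sub]
    · exact integral_congr_ae (ae_of_all _ fun y => hsub _)
    · exact Integrable.of_mem_Icc 0 C (hm1.comp hs).aemeasurable
        (ae_of_all _ fun y => ⟨le_max_right _ _, hb1 _⟩)
    · exact Integrable.of_mem_Icc 0 C (hm2.comp hs).aemeasurable
        (ae_of_all _ fun y => ⟨le_max_right _ _, hb2 _⟩)
  simp only [compensatedSum]
  rw [e1, e2]
  ring

/-- The increment over (s, t] on the event F is the jump sum of an integrand that is again
predictable when F is known at s. -/
theorem jumpIntegral_split {s t : ℝ≥0} (hst : s ≤ t) (F : Set (PathSpace Γ))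
    (H : (ℝ≥0 × PathSpace Γ) × Γ → ℝ≥0∞) (ω : PathSpace Γ) :
    F.indicator 1 ω * jumpIntegral t H ω = F.indicator 1 ω * jumpIntegral s H ω +
      jumpIntegral t (fun z => (Ioi s ×ˢ F).indicator 1 z.1 * H z) ω := by
  simp only [jumpIntegral]
  rw [← jumpSum_const_mul, ← jumpSum_const_mul, ← jumpSum_add]
  refine jumpSum_congr fun u _ => ?_
  by_cases h1 : u ≤ s
  · simp [indicator, h1, h1.trans hst, not_lt.2 h1]
  · by_cases h2 : u ≤ t <;> by_cases h3 : ω ∈ F <;> simp [indicator, h1, h2, h3, not_le.1 h1]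

theorem rateIntegral_split {s t : ℝ≥0} (hst : s ≤ t) (F : Set (PathSpace Γ))
    (H : (ℝ≥0 × PathSpace Γ) × Γ → ℝ≥0∞) (ω : PathSpace Γ) :
    F.indicator 1 ω * rateIntegral L t H ω = F.indicator 1 ω * rateIntegral L s H ω +
      rateIntegral L t (fun z => (Ioi s ×ˢ F).indicator 1 z.1 * H z) ω := by
  by_cases hF : ω ∈ F
  · have h1 : rateIntegral L t (fun z => (Ioi s ×ˢ F).indicator 1 z.1 * H z) ω =
        ∫⁻ u in Ioc (s : ℝ) t, ∫⁻ y, H ((u.toNNReal, ω), y) ∂(L (canonLeft u.toNNReal ω)) := by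
      rw [rateIntegral, ← lintegral_indicator measurableSet_Ioc,
        ← lintegral_indicator measurableSet_Ioc]
      refine lintegral_congr fun u => ?_
      by_cases h2 : u ∈ Ioc (s : ℝ) t
      · have h3 : s < u.toNNReal := Real.lt_toNNReal_iff_coe_lt.2 h2.1
        rw [indicator_of_mem h2, indicator_of_mem
          (show u ∈ Ioc (0 : ℝ) t from ⟨lt_of_le_of_lt s.2 h2.1, h2.2⟩)]
        simp [indicator, h3, hF]
      · rw [indicator_of_notMem h2]
        by_cases h4 : u ∈ Ioc (0 : ℝ) t
        · have h3 : ¬ s < u.toNNReal := fun h => h2 ⟨Real.lt_toNNReal_iff_coe_lt.1 h, h4.2⟩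
          rw [indicator_of_mem h4]
          simp [indicator, h3]
        · rw [indicator_of_notMem h4]
    rw [h1, rateIntegral, rateIntegral, ← Ioc_union_Ioc_eq_Ioc (NNReal.coe_nonneg s)
      (NNReal.coe_le_coe.2 hst), lintegral_union measurableSet_Ioc]
    · simp [hF]
    · exact Set.disjoint_left.2 fun u h2 h3 => not_lt.2 h2.2 h3.1
  · have : rateIntegral L t (fun z => (Ioi s ×ˢ F).indicator 1 z.1 * H z) ω = 0 := by
      simp [rateIntegral, indicator, hF]
    simp [this, hF]

variable {𝔉 : Filtration ℝ≥0 (inferInstance : MeasurableSpace (PathSpace Γ))}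
  {P : Measure (PathSpace Γ)}

/-- The compensation formula for H restricted to (s, ∞) × F says that the increment after s has mean
zero on F. The martingale uses adapted versions Y of the jump sums, which agree with them on pure
jump paths. -/
theorem exists_martingale_of_compensation [IsProbabilityMeasure P]
    (hP : ∀ᵐ ω ∂P, IsPureJump ω.1) (hX : ∀ t, Measurable[𝔉 t] (canon t : PathSpace Γ → Γ))
    {k : (ℝ≥0 × PathSpace Γ) × Γ → ℝ≥0∞} (hk : Measurable[𝔉.predictable.prod inferInstance] k)
    {c : ℝ≥0∞} (hc : c ≠ ∞) (hkc : ∀ z, k z ≤ c)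
    (hcomp : ∀ (t : ℝ≥0) (H : (ℝ≥0 × PathSpace Γ) × Γ → ℝ≥0∞),
      Measurable[𝔉.predictable.prod inferInstance] H → (∃ d ≠ ∞, ∀ z, H z ≤ d) →
      ∫⁻ ω, jumpIntegral t H ω ∂P = ∫⁻ ω, rateIntegral L t (fun z => H z * k z) ω ∂P)
    {H : (ℝ≥0 × PathSpace Γ) × Γ → ℝ≥0∞} (hH : Measurable[𝔉.predictable.prod inferInstance] H)
    {d : ℝ≥0∞} (hd : d ≠ ∞) (hHd : ∀ z, H z ≤ d) :
    ∃ M : ℝ≥0 → PathSpace Γ → ℝ, Martingale M 𝔉 P ∧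
      ∀ (t : ℝ≥0) (ω : PathSpace Γ), IsPureJump ω.1 → M t ω = (jumpIntegral t H ω).toReal -
        (rateIntegral L t (fun z => H z * k z) ω).toReal := by
  choose Y hYm hY using fun t => exists_measurable_eq_jumpIntegral hX t hH
  set R := fun t => rateIntegral L t (fun z => H z * k z) with hR
  have hHk : Measurable[𝔉.predictable.prod inferInstance] fun z => H z * k z := hH.mul hk
  have hRm : ∀ t, Measurable[𝔉 t] (R t) := fun t => measurable_rateIntegral hX t hHk
  have hYm' : ∀ t, Measurable (Y t) := fun t => (hYm t).mono (𝔉.le t) le_rfl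
  have hRm' : ∀ t, Measurable (R t) := fun t => (hRm t).mono (𝔉.le t) le_rfl
  have hYJ : ∀ t, ∀ᵐ ω ∂P, Y t ω = jumpIntegral t H ω := fun t =>
    hP.mono fun ω hω => (hY t ω hω).symm
  have hRfin : ∀ t, ∫⁻ ω, R t ω ∂P ≠ ∞ := by
    intro t
    have h1 : ∫⁻ ω, R t ω ∂P ≤ ∫⁻ _, d * c * L.bound * t ∂P :=
      lintegral_mono fun ω => rateIntegral_le t (fun z => mul_le_mul' (hHd z) (hkc z)) ω
    refine (h1.trans_lt ?_).ne
    rw [lintegral_const]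
    have := L.bound_lt_top
    have := hc.lt_top
    have := hd.lt_top
    have := measure_lt_top P univ
    finiteness
  have hYfin : ∀ t, ∫⁻ ω, Y t ω ∂P ≠ ∞ := by
    intro t
    rw [lintegral_congr_ae (hYJ t), hcomp t H hH ⟨d, hd, hHd⟩]
    exact hRfin t
  have hYi : ∀ t, Integrable (fun ω => (Y t ω).toReal) P := fun t =>
    integrable_toReal_of_lintegral_ne_top (hYm' t).aemeasurable (hYfin t)
  have hRi : ∀ t, Integrable (fun ω => (R t ω).toReal) P := fun t =>
    integrable_toReal_of_lintegral_ne_top (hRm' t).aemeasurable (hRfin t)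
  -- The martingale identity with the negative terms moved across, so that it holds in `ℝ≥0∞`.
  have hinc : ∀ s t, s ≤ t → ∀ F, MeasurableSet[𝔉 s] F →
      ∫⁻ ω in F, Y t ω ∂P + ∫⁻ ω in F, R s ω ∂P = ∫⁻ ω in F, Y s ω ∂P + ∫⁻ ω in F, R t ω ∂P := by
    intro s t hst F hF
    have hFm := 𝔉.le s _ hF
    have hind : ∀ f : PathSpace Γ → ℝ≥0∞, ∫⁻ ω in F, f ω ∂P = ∫⁻ ω, F.indicator 1 ω * f ω ∂P := by
      intro f
      rw [← lintegral_indicator hFm]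
      refine lintegral_congr fun ω => ?_
      by_cases hω : ω ∈ F <;> simp [hω]
    have hI : Measurable (F.indicator (1 : PathSpace Γ → ℝ≥0∞)) := measurable_one.indicator hFm
    have hG : Measurable[𝔉.predictable.prod inferInstance]
        fun z : (ℝ≥0 × PathSpace Γ) × Γ => (Ioi s ×ˢ F).indicator (1 : ℝ≥0 × PathSpace Γ → ℝ≥0∞) z.1 * H z := by
      have h1 : Measurable[𝔉.predictable] (fun _ : ℝ≥0 × PathSpace Γ => (1 : ℝ≥0∞)) :=
        measurable_const
      exact ((h1.indicator (measurableSet_predictable_Ioi_prod hF)).comp measurable_fst).mul hH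
    have h1 := hcomp t _ hG ⟨1 * d, ENNReal.mul_ne_top ENNReal.one_ne_top hd, fun z =>
      mul_le_mul' (indicator_le_self' (fun _ _ => zero_le) _) (hHd z)⟩
    have e1 : ∫⁻ ω in F, Y t ω ∂P = ∫⁻ ω in F, Y s ω ∂P +
        ∫⁻ ω, jumpIntegral t (fun z => (Ioi s ×ˢ F).indicator 1 z.1 * H z) ω ∂P := by
      rw [hind, hind, ← lintegral_add_left
        (show Measurable fun ω => F.indicator (1 : PathSpace Γ → ℝ≥0∞) ω * Y s ω from
          hI.mul (hYm' s))]
      refine lintegral_congr_ae ?_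
      filter_upwards [hYJ s, hYJ t] with ω h2 h3
      rw [h2, h3]
      exact jumpIntegral_split hst F H ω
    have e2 : ∫⁻ ω in F, R t ω ∂P = ∫⁻ ω in F, R s ω ∂P +
        ∫⁻ ω, rateIntegral L t (fun z => (Ioi s ×ˢ F).indicator 1 z.1 * (H z * k z)) ω ∂P := by
      rw [hind, hind, ← lintegral_add_left
        (show Measurable fun ω => F.indicator (1 : PathSpace Γ → ℝ≥0∞) ω * R s ω from
          hI.mul (hRm' s))]
      exact lintegral_congr fun ω => rateIntegral_split hst F _ ω
    simp only [mul_assoc] at h1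
    rw [e1, e2, h1]
    ring
  refine ⟨fun t ω => (Y t ω).toReal - (R t ω).toReal, ⟨fun t => ?_, fun s t hst => ?_⟩,
    fun t ω hω => by simp only [← hY t ω hω, hR]⟩
  · exact ((hYm t).ennreal_toReal.sub (hRm t).ennreal_toReal).stronglyMeasurable
  · refine (ae_eq_condExp_of_forall_setIntegral_eq (𝔉.le s) ((hYi t).sub (hRi t))
      (fun F _ _ => ((hYi s).sub (hRi s)).integrableOn) (fun F hF _ => ?_) ?_).symm
    · have hto : ∀ {Z : PathSpace Γ → ℝ≥0∞}, Measurable Z → ∫⁻ ω, Z ω ∂P ≠ ∞ →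
          ∫ ω in F, (Z ω).toReal ∂P = (∫⁻ ω in F, Z ω ∂P).toReal := fun hZ hZf =>
        integral_toReal hZ.aemeasurable (ae_restrict_of_ae (ae_lt_top hZ hZf))
      have hfin : ∀ {Z : PathSpace Γ → ℝ≥0∞}, ∫⁻ ω, Z ω ∂P ≠ ∞ → ∫⁻ ω in F, Z ω ∂P ≠ ∞ :=
        fun hZ => ((setLIntegral_le_lintegral _ _).trans_lt hZ.lt_top).ne
      have h1 := congrArg ENNReal.toReal (hinc s t hst F hF)
      rw [ENNReal.toReal_add (hfin (hYfin t)) (hfin (hRfin s)),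
        ENNReal.toReal_add (hfin (hYfin s)) (hfin (hRfin t)), ← hto (hYm' t) (hYfin t),
        ← hto (hRm' s) (hRfin s), ← hto (hYm' s) (hYfin s), ← hto (hRm' t) (hRfin t)] at h1
      simp only [Pi.sub_apply]
      rw [integral_sub (hYi s).integrableOn (hRi s).integrableOn,
        integral_sub (hYi t).integrableOn (hRi t).integrableOn]
      linarith
    · exact ((hYm s).ennreal_toReal.sub
        (hRm s).ennreal_toReal).stronglyMeasurable.aestronglyMeasurable

/-- A compensation formula with bounded predictable rates gives a solution of the martingale
problem. -/
theorem solvesMartingaleProblem_of_compensation [IsProbabilityMeasure P] {μ : Measure Γ}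
    (hμ : P.map (canon 0) = μ) (hr : 𝔉.IsRightContinuous)
    (hP : ∀ᵐ ω ∂P, IsPureJump ω.1) (hX : ∀ t, Measurable[𝔉 t] (canon t : PathSpace Γ → Γ))
    {k : (ℝ≥0 × PathSpace Γ) × Γ → ℝ≥0∞} (hk : Measurable[𝔉.predictable.prod inferInstance] k)
    {c : ℝ≥0∞} (hc : c ≠ ∞) (hkc : ∀ z, k z ≤ c) {K : PathSpace Γ → ℝ≥0 → Measure Γ}
    (hK : ∀ ω : PathSpace Γ, IsPureJump ω.1 → ∀ᵐ s : ℝ, 0 < s → K ω s.toNNReal =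
      (L (canonLeft s.toNNReal ω)).withDensity fun y => k ((s.toNNReal, ω), y))
    (hcomp : ∀ (t : ℝ≥0) (H : (ℝ≥0 × PathSpace Γ) × Γ → ℝ≥0∞),
      Measurable[𝔉.predictable.prod inferInstance] H → (∃ d ≠ ∞, ∀ z, H z ≤ d) →
      ∫⁻ ω, jumpIntegral t H ω ∂P = ∫⁻ ω, rateIntegral L t (fun z => H z * k z) ω ∂P) :
    SolvesMartingaleProblem P K μ := by
  have hkm := measurable_of_predictable hk
  have hK' : ∀ (t : ℝ≥0) (ω : PathSpace Γ), IsPureJump ω.1 → ∀ᵐ s : ℝ, s ∈ Ioc (0 : ℝ) t →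
      K ω s.toNNReal = (L (canonLeft s.toNNReal ω)).withDensity fun y => k ((s.toNNReal, ω), y) :=
    fun t ω hω => (hK ω hω).mono fun s hs hst => hs hst.1
  refine ⟨inferInstance, hμ, hP, 𝔉, hr, hX, fun t C hC => ?_, fun φ hφ ⟨C, hφC⟩ => ?_⟩
  · have hCm : Measurable[𝔉.predictable.prod inferInstance]
        fun z : (ℝ≥0 × PathSpace Γ) × Γ => C.indicator (1 : Γ → ℝ≥0∞) z.2 * k z :=
      ((measurable_one.indicator hC).comp measurable_snd).mul hk
    refine ⟨_, (measurable_rateIntegral (L := L) hX t hCm).stronglyMeasurable,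
      hP.mono fun ω hω => ?_⟩
    refine setLIntegral_congr_fun_ae measurableSet_Ioc ?_
    filter_upwards [hK' t ω hω] with s hs hst
    rw [hs hst, withDensity_apply _ hC, ← lintegral_indicator hC]
    refine lintegral_congr fun y => ?_
    by_cases hy : y ∈ C <;> simp [hy]
  · have hC0 : ∀ z, max (φ z) 0 ≤ max C 0 := fun z =>
      max_le_max ((le_abs_self _).trans (hφC z)) le_rfl
    have hC1 : ∀ z, max (-φ z) 0 ≤ max C 0 := fun z =>
      max_le_max ((neg_le_abs _).trans (hφC z)) le_rfl
    have hm0 : Measurable fun z => max (φ z) 0 := hφ.max measurable_const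
    have hm1 : Measurable fun z => max (-φ z) 0 := hφ.neg.max measurable_const
    obtain ⟨M, hM, hMeq⟩ := exists_martingale_of_compensation hP hX hk hc hkc hcomp
      (measurable_pathIntegrand hX hm0) (ENNReal.ofReal_ne_top (r := max C 0))
      fun z => ENNReal.ofReal_le_ofReal (hC0 _)
    obtain ⟨N, hN, hNeq⟩ := exists_martingale_of_compensation hP hX hk hc hkc hcomp
      (measurable_pathIntegrand hX hm1) (ENNReal.ofReal_ne_top (r := max C 0))
      fun z => ENNReal.ofReal_le_ofReal (hC1 _)
    refine ⟨M - N, hM.sub hN, fun t => hP.mono fun ω hω => ?_⟩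
    rw [compensatedSum_eq_sub hω hkm hc hkc (hK' t ω hω) hφ hφC,
      compensatedSum_eq hω hkm hc hkc (hK' t ω hω) hm0 (fun z => le_max_right _ _) hC0,
      compensatedSum_eq hω hkm hc hkc (hK' t ω hω) hm1 (fun z => le_max_right _ _) hC1,
      ← hMeq t ω hω, ← hNeq t ω hω]
    rfl

end CompensationToMartingale

/-! ### The martingale problems of the Doob transform -/

section DoobRatio

variable {Γ : Type*} [TopologicalSpace Γ] {A B : Set Γ} {h : Γ → ℝ}

open Classical in
/-- The ratio `h(y) / h(X_{t-})` up to the hitting time, and `e` afterwards. -/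
def doobRatio (A B : Set Γ) (h : Γ → ℝ) (e : ℝ≥0∞) (z : (ℝ≥0 × PathSpace Γ) × Γ) : ℝ≥0∞ :=
  if z.1 ∈ aliveSet (A ∪ B) then ENNReal.ofReal (h z.2 / h (canonLeft z.1.1 z.1.2)) else e

theorem doobRatio_of_alive {e : ℝ≥0∞} {z : ℝ≥0 × PathSpace Γ} (hz : z ∈ aliveSet (A ∪ B)) (y : Γ) :
    doobRatio A B h e (z, y) = ENNReal.ofReal (h y / h (canonLeft z.1 z.2)) := if_pos hz

theorem doobRatio_of_not_alive {e : ℝ≥0∞} {z : ℝ≥0 × PathSpace Γ} (hz : z ∉ aliveSet (A ∪ B))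
    (y : Γ) : doobRatio A B h e (z, y) = e := if_neg hz

theorem doobRatio_le {ε : ℝ} (hε : 0 < ε) (hI : ∀ y, h y ∈ Icc ε 1) {e : ℝ≥0∞} (he : e ≤ 1)
    (z : (ℝ≥0 × PathSpace Γ) × Γ) : doobRatio A B h e z ≤ ENNReal.ofReal (1 / ε) + 1 := by
  unfold doobRatio
  split_ifs
  · refine le_add_right (ENNReal.ofReal_le_ofReal ?_)
    exact div_le_div₀ zero_le_one (hI _).2 hε (hI _).1
  · exact he.trans le_add_self

/-- Path and stopped path agree up to τ and so enter A ∪ B at the same time; quantities cut at τ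
therefore commute with stopping. -/
theorem mem_aliveSet_denseStop_iff {ω : PathSpace Γ} (hω : IsPureJump ω.1) {u : ℝ≥0} :
    (u, denseStop (A ∪ B) ω) ∈ aliveSet (A ∪ B) ↔ (u, ω) ∈ aliveSet (A ∪ B) := by
  rw [mem_aliveSet_iff (isPureJump_denseStop hω A B), mem_aliveSet_iff hω]
  refine ⟨fun h1 s hs hsE => ?_, fun h1 s hs => ?_⟩
  · rcases hitTime_cases hω A B with ⟨h0, _⟩ | ⟨r, _, _, hrE, hr⟩
    · exact h0 s hsE
    · have hrs : r ≤ s := not_lt.1 fun hsr => hr s hsr hsE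
      have h2 := h1 r (hrs.trans_lt hs)
      rw [denseStop_of_alive hω ((mem_aliveSet_iff hω).2 hr)] at h2
      exact h2 hrE
  · rw [denseStop_of_alive hω ((mem_aliveSet_iff hω).2 fun r hr => h1 r (hr.trans hs))]
    exact h1 s hs

variable [MeasurableSpace Γ]

theorem withDensity_doobRatio_of_alive (L : Kernel Γ Γ) {e : ℝ≥0∞} {ω : PathSpace Γ} {u : ℝ≥0}
    (hu : (u, ω) ∈ aliveSet (A ∪ B)) :
    ((L (canonLeft u ω)).withDensity fun y => doobRatio A B h e ((u, ω), y)) =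
      doobRate L h (canonLeft u ω) := by
  simp only [doobRatio_of_alive hu]
  rfl

/-- The controlled kernels switch at t < τ but the predictable ratio at t ≤ τ; the single time τ is
Lebesgue null. -/
theorem ae_doobKernel_eq (L : Kernel Γ Γ) {ω : PathSpace Γ} (hω : IsPureJump ω.1) :
    ∀ᵐ s : ℝ, 0 < s →
      doobKernel L A B h ω s.toNNReal = (L (canonLeft s.toNNReal ω)).withDensity
        (fun y => doobRatio A B h 0 ((s.toNNReal, ω), y)) ∧
      doobKernelThenRef L A B h ω s.toNNReal = (L (canonLeft s.toNNReal ω)).withDensity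
        fun y => doobRatio A B h 1 ((s.toNNReal, ω), y) := by
  -- If τ = ∞ the default 0 excludes one irrelevant point.
  have hne : ∀ᵐ s : ℝ, s ≠ (hitTime A B ω).untopD 0 := by
    simp [ae_iff]
  filter_upwards [hne] with s hs h0
  have hlt : ((s.toNNReal : ℝ≥0) : WithTop ℝ≥0) < hitTime A B ω ↔
      (s.toNNReal, ω) ∈ aliveSet (A ∪ B) := by
    rw [mem_aliveSet_iff_le_hitTime hω, lt_iff_le_and_ne, and_iff_left_iff_imp]
    intro _ h1
    rw [← h1, WithTop.untopD_coe, Real.coe_toNNReal s h0.le] at hs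
    exact hs rfl
  by_cases ha : (s.toNNReal, ω) ∈ aliveSet (A ∪ B)
  · rw [withDensity_doobRatio_of_alive L ha, withDensity_doobRatio_of_alive L ha]
    exact ⟨if_pos (hlt.2 ha), if_pos (hlt.2 ha)⟩
  · have h1 := mt hlt.1 ha
    simp only [doobRatio_of_not_alive ha]
    refine ⟨?_, ?_⟩
    · rw [withDensity_const, zero_smul]
      exact if_neg h1
    · rw [withDensity_const, one_smul]
      exact if_neg h1

variable [PolishSpace Γ] [BorelSpace Γ]
  {𝔉 : Filtration ℝ≥0 (inferInstance : MeasurableSpace (PathSpace Γ))}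

theorem measurable_doobRatio (hX : ∀ t, Measurable[𝔉 t] (canon t : PathSpace Γ → Γ))
    (hE : MeasurableSet (A ∪ B)) (hh : Measurable h) (e : ℝ≥0∞) :
    Measurable[𝔉.predictable.prod inferInstance] (doobRatio A B h e) := by
  classical
  refine Measurable.ite ?_ ?_ measurable_const
  · have := measurableSet_predictable_aliveSet hX hE
    exact measurable_fst this
  · refine ENNReal.measurable_ofReal.comp ((hh.comp measurable_snd).div ?_)
    exact hh.comp ((measurable_predictable_canonLeft hX).comp measurable_fst)

end DoobRatio

/-! ### The image of a compensation formula under stopping at τ -/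

section Stopped

variable {Γ : Type*} [TopologicalSpace Γ] [PolishSpace Γ] [MeasurableSpace Γ] [BorelSpace Γ]
  {L : Kernel Γ Γ} [IsFiniteKernel L] {A B : Set Γ} {h : Γ → ℝ}

/-- The events whose preimage under the stopping map is known at time `t`. -/
def stoppedFiltration (E : Set Γ)
    (𝔉 : Filtration ℝ≥0 (inferInstance : MeasurableSpace (PathSpace Γ))) :
    Filtration ℝ≥0 (inferInstance : MeasurableSpace (PathSpace Γ)) where
  seq t := (𝔉 t).map (denseStop E) ⊓ inferInstance
  mono' _ _ hst := inf_le_inf_right _ (MeasurableSpace.map_mono (𝔉.mono hst))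
  le' _ := inf_le_right

variable {𝔉 : Filtration ℝ≥0 (inferInstance : MeasurableSpace (PathSpace Γ))}
  {P : Measure (PathSpace Γ)}

theorem measurableSet_stoppedFiltration_iff {E : Set Γ} {t : ℝ≥0} {F : Set (PathSpace Γ)} :
    MeasurableSet[stoppedFiltration E 𝔉 t] F ↔
      MeasurableSet[𝔉 t] (denseStop E ⁻¹' F) ∧ MeasurableSet F :=
  MeasurableSpace.measurableSet_inf

theorem isRightContinuous_stoppedFiltration (hr : 𝔉.IsRightContinuous) (E : Set Γ) :
    (stoppedFiltration E 𝔉).IsRightContinuous := by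
  constructor
  intro t F hF
  rw [Filtration.rightCont_eq, MeasurableSpace.measurableSet_iInf] at hF
  simp only [MeasurableSpace.measurableSet_iInf, measurableSet_stoppedFiltration_iff] at hF
  -- Any later time, such as t + 1, gives measurability of F in the ambient σ-algebra; the other
  -- half is right continuity of the original filtration applied to the preimage.
  refine measurableSet_stoppedFiltration_iff.2 ⟨?_, (hF (t + 1) (by simp)).2⟩
  refine hr.RC t _ ?_
  rw [Filtration.rightCont_eq]
  simp only [MeasurableSpace.measurableSet_iInf]
  exact fun u hu => (hF u hu).1

theorem measurable_canon_stoppedFiltration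
    (hX : ∀ t, Measurable[𝔉 t] (canon t : PathSpace Γ → Γ)) {E : Set Γ} (hE : MeasurableSet E)
    (t : ℝ≥0) : Measurable[stoppedFiltration E 𝔉 t] (canon t : PathSpace Γ → Γ) := by
  intro C hC
  exact measurableSet_stoppedFiltration_iff.2
    ⟨measurable_canon_denseStop (fun s hs => (hX s).mono (𝔉.mono hs) le_rfl) hE hC,
      measurable_canon t hC⟩

/-- Stopping leaves the time coordinate alone, and by the choice of `stoppedFiltration` it pulls
generating predictable sets back to generating predictable sets. -/
theorem measurable_predictable_denseStop (E : Set Γ) :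
    @Measurable _ _ 𝔉.predictable (stoppedFiltration E 𝔉).predictable
      fun z : ℝ≥0 × PathSpace Γ => (z.1, denseStop E z.2) := by
  refine @measurable_generateFrom _ _ 𝔉.predictable _ _ fun S hS => ?_
  rcases hS with ⟨F, hF, rfl⟩ | ⟨i, F, hF, rfl⟩
  · exact MeasurableSpace.measurableSet_generateFrom
      (Or.inl ⟨_, (measurableSet_stoppedFiltration_iff.1 hF).1, rfl⟩)
  · exact MeasurableSpace.measurableSet_generateFrom
      (Or.inr ⟨i, _, (measurableSet_stoppedFiltration_iff.1 hF).1, rfl⟩)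

/-- The stopped path has exactly the jumps up to τ, so the integrand is pulled back along the
stopping map and cut at τ. After τ the cut removes the rates, which is why e disappears and the new
ratio is 0 there. -/
theorem compensation_map_denseStop (hP : ∀ᵐ ω ∂P, IsPureJump ω.1)
    (hX : ∀ t, Measurable[𝔉 t] (canon t : PathSpace Γ → Γ)) (hE : MeasurableSet (A ∪ B))
    (hh : Measurable h) {e : ℝ≥0∞}
    (hcomp : ∀ (t : ℝ≥0) (H : (ℝ≥0 × PathSpace Γ) × Γ → ℝ≥0∞),
      Measurable[𝔉.predictable.prod inferInstance] H → (∃ d ≠ ∞, ∀ z, H z ≤ d) →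
      ∫⁻ ω, jumpIntegral t H ω ∂P =
        ∫⁻ ω, rateIntegral L t (fun z => H z * doobRatio A B h e z) ω ∂P)
    (t : ℝ≥0) {H : (ℝ≥0 × PathSpace Γ) × Γ → ℝ≥0∞}
    (hH : Measurable[(stoppedFiltration (A ∪ B) 𝔉).predictable.prod inferInstance] H)
    (hHd : ∃ d ≠ ∞, ∀ z, H z ≤ d) :
    ∫⁻ ω, jumpIntegral t H ω ∂(P.map (denseStop (A ∪ B))) =
      ∫⁻ ω, rateIntegral L t (fun z => H z * doobRatio A B h 0 z) ω
        ∂(P.map (denseStop (A ∪ B))) := by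
  have hg : Measurable (denseStop (A ∪ B) : PathSpace Γ → PathSpace Γ) := measurable_denseStop hE
  have hX' := measurable_canon_stoppedFiltration hX hE
  have hPg : ∀ᵐ ω ∂(P.map (denseStop (A ∪ B))), IsPureJump ω.1 :=
    (ae_map_iff hg.aemeasurable measurableSet_isPureJump).2
      (hP.mono fun ω hω => isPureJump_denseStop hω A B)
  have hHk := hH.mul (measurable_doobRatio hX' hE hh 0)
  have hHr : Measurable (rateIntegral L t fun z => H z * doobRatio A B h 0 z) :=
    (measurable_rateIntegral hX' t hHk).mono ((stoppedFiltration (A ∪ B) 𝔉).le t) le_rfl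
  rw [lintegral_map' (aemeasurable_jumpIntegral hX' t hH hPg) hg.aemeasurable, lintegral_map hHr hg]
  set G : (ℝ≥0 × PathSpace Γ) × Γ → ℝ≥0∞ := fun z =>
    (aliveSet (A ∪ B)).indicator 1 z.1 * H ((z.1.1, denseStop (A ∪ B) z.1.2), z.2) with hG
  have hGm : Measurable[𝔉.predictable.prod inferInstance] G := by
    have h1 : Measurable[𝔉.predictable] (fun _ : ℝ≥0 × PathSpace Γ => (1 : ℝ≥0∞)) :=
      measurable_const
    refine ((h1.indicator (measurableSet_predictable_aliveSet hX hE)).comp measurable_fst).mul ?_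
    exact hH.comp (((measurable_predictable_denseStop (A ∪ B)).comp measurable_fst).prodMk
      measurable_snd)
  obtain ⟨d, hd, hHd⟩ := hHd
  have h1 := hcomp t G hGm ⟨1 * d, ENNReal.mul_ne_top ENNReal.one_ne_top hd, fun z =>
    mul_le_mul' (indicator_le_self' (fun _ _ => zero_le) _) (hHd _)⟩
  have e1 : ∀ᵐ ω ∂P, jumpIntegral t H (denseStop (A ∪ B) ω) = jumpIntegral t G ω := by
    filter_upwards [hP] with ω hω
    have h2 := jumpSum_denseStop hω (A := A) (B := B)
      (fun u _ y => (Iic t).indicator (fun u => H ((u, denseStop (A ∪ B) ω), y)) u)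
    refine Eq.trans (jumpSum_congr fun u _ => ?_) (h2.trans (jumpSum_congr fun u _ => ?_))
    · by_cases h3 : u ≤ t <;> simp [indicator, h3]
    · by_cases h3 : u ≤ t <;> by_cases h4 : (u, ω) ∈ aliveSet (A ∪ B) <;>
        simp [indicator, h3, h4, hG]
  have e2 : ∀ᵐ ω ∂P, rateIntegral L t (fun z => H z * doobRatio A B h 0 z)
      (denseStop (A ∪ B) ω) = rateIntegral L t (fun z => G z * doobRatio A B h e z) ω := by
    filter_upwards [hP] with ω hω
    refine setLIntegral_congr_fun measurableSet_Ioc fun s hs => ?_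
    simp only
    by_cases h4 : (s.toNNReal, ω) ∈ aliveSet (A ∪ B)
    · have h5 : canonLeft s.toNNReal (denseStop (A ∪ B) ω) = canonLeft s.toNNReal ω :=
        leftLim_denseStop_of_alive hω h4
      rw [h5]
      refine lintegral_congr fun y => ?_
      rw [doobRatio_of_alive h4, doobRatio_of_alive ((mem_aliveSet_denseStop_iff hω).2 h4), h5, hG]
      simp [h4]
    · have h5 := mt (mem_aliveSet_denseStop_iff (A := A) (B := B) hω).1 h4
      simp [doobRatio_of_not_alive h5, hG, h4]
  rw [lintegral_congr_ae e1, h1]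
  exact (lintegral_congr_ae e2).symm

end Stopped

/-! ### Doob transform by the solution of the boundary value problem -/

section DoobMartingaleProblem

variable {Γ : Type*} [TopologicalSpace Γ] [PolishSpace Γ] [MeasurableSpace Γ] [BorelSpace Γ]
  {L : Kernel Γ Γ} [IsFiniteKernel L] {A B : Set Γ} {h : Γ → ℝ} {ε : ℝ} {x : Γ}
  {𝔉 : Filtration ℝ≥0 (inferInstance : MeasurableSpace (PathSpace Γ))}
  {P : Measure (PathSpace Γ)}

/-- Subtraction-free form of the harmonic equation for h/h(x); finiteness of L allows the constant
to be integrated separately. -/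
theorem IsBVPSolution.lintegral_ofReal_div_eq (hh : IsBVPSolution L A B ε h) (hε : 0 < ε)
    (hI : ∀ y, h y ∈ Icc ε 1) (x : Γ) {y : Γ} (hy : y ∉ A ∪ B) :
    ∫⁻ z, ENNReal.ofReal (h z / h x) ∂(L y) = ENNReal.ofReal (h y / h x) * L y univ := by
  have h0 : ∀ z, 0 < h z := fun z => hε.trans_le (hI z).1
  have hi : Integrable h (L y) := integrable_of_mem_Icc hh.measurable hI
  have h1 := hh.harmonic y hy
  rw [integral_sub hi (integrable_const _), integral_const, smul_eq_mul, sub_eq_zero] at h1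
  rw [← ofReal_integral_eq_lintegral_ofReal (hi.div_const _)
    (ae_of_all _ fun z => (div_pos (h0 z) (h0 x)).le), integral_div, h1, ← ofReal_measureReal,
    ← ENNReal.ofReal_mul (div_pos (h0 y) (h0 x)).le]
  congr 1
  ring

theorem ae_apply_zero_eq (h0 : P.map (canon 0) = Measure.dirac x) :
    ∀ᵐ ω ∂P, ω.1 0 = x := by
  have h1 : ∀ᵐ y ∂(P.map (canon 0)), y = x := by
    rw [h0]
    exact (ae_dirac_iff (p := fun y => y = x) (measurableSet_singleton x)).2 rfl
  exact ae_of_ae_map (measurable_canon 0).aemeasurable h1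

theorem map_canon_zero_eq_dirac [IsProbabilityMeasure P] (h0 : ∀ᵐ ω ∂P, ω.1 0 = x) :
    P.map (canon 0) = Measure.dirac x := by
  rw [Measure.map_congr (show canon 0 =ᵐ[P] fun _ => x from h0), Measure.map_const]
  simp

theorem isProbabilityMeasure_doobMeasure [IsProbabilityMeasure P]
    (hP : ∀ᵐ ω ∂P, IsPureJump ω.1) (hX : ∀ t, Measurable[𝔉 t] (canon t : PathSpace Γ → Γ))
    (hC : CompensationFormula L 𝔉 P fun _ => 1) (hE : MeasurableSet (A ∪ B))
    (hτ : ∀ᵐ ω ∂P, hitTime A B ω ≠ ⊤) (hh : IsBVPSolution L A B ε h) (hε : 0 < ε)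
    (hI : ∀ y, h y ∈ Icc ε 1) (hx : ∀ᵐ ω ∂P, ω.1 0 = x) :
    IsProbabilityMeasure (doobMeasure A B h x P) := by
  have hx0 : 0 < h x := hε.trans_le (hI x).1
  refine isProbabilityMeasure_withDensity_hitValue (w := fun y => ENNReal.ofReal (h y / h x))
    (c := ENNReal.ofReal (1 / ε)) (x := x) hP hX hC hE hτ
    (ENNReal.measurable_ofReal.comp (hh.measurable.div_const _)) ENNReal.ofReal_ne_top
    (fun y => ENNReal.ofReal_le_ofReal (div_le_div₀ zero_le_one (hI y).2 hε (hI x).1))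
    (fun y hy => hh.lintegral_ofReal_div_eq hε hI x hy) hx ?_
  simp [hx0.ne']

/-- The case w = h/h(x): up to τ the Doob ratio satisfies w(X_{t-}) · (h(y)/h(X_{t-})) = w(y), and
the lower bound ε on h keeps w bounded. -/
theorem compensation_doobMeasure [IsProbabilityMeasure P]
    (hP : ∀ᵐ ω ∂P, IsPureJump ω.1) (hX : ∀ t, Measurable[𝔉 t] (canon t : PathSpace Γ → Γ))
    (hC : CompensationFormula L 𝔉 P fun _ => 1) (hE : MeasurableSet (A ∪ B))
    (hτ : ∀ᵐ ω ∂P, hitTime A B ω ≠ ⊤) (hh : IsBVPSolution L A B ε h) (hε : 0 < ε)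
    (hI : ∀ y, h y ∈ Icc ε 1) (x : Γ) (t : ℝ≥0) (H : (ℝ≥0 × PathSpace Γ) × Γ → ℝ≥0∞)
    (hH : Measurable[𝔉.predictable.prod inferInstance] H) (hHd : ∃ d ≠ ∞, ∀ z, H z ≤ d) :
    ∫⁻ ω, jumpIntegral t H ω ∂(doobMeasure A B h x P) =
      ∫⁻ ω, rateIntegral L t (fun z => H z * doobRatio A B h 1 z) ω ∂(doobMeasure A B h x P) := by
  obtain ⟨d, hd, hHd⟩ := hHd
  have h0 : ∀ z, 0 < h z := fun z => hε.trans_le (hI z).1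
  refine compensation_withDensity (w := fun y => ENNReal.ofReal (h y / h x))
    (c := ENNReal.ofReal (1 / ε)) hP hX hC hE hτ
    (ENNReal.measurable_ofReal.comp (hh.measurable.div_const _)) ENNReal.ofReal_ne_top
    (fun y => ENNReal.ofReal_le_ofReal (div_le_div₀ zero_le_one (hI y).2 hε (hI x).1))
    (fun y hy => hh.lintegral_ofReal_div_eq hε hI x hy)
    (measurable_doobRatio hX hE hh.measurable 1) (fun z hz y => ?_)
    (fun z hz y => doobRatio_of_not_alive hz y) t hH hd hHd
  rw [doobRatio_of_alive hz, ← ENNReal.ofReal_mul (div_pos (h0 _) (h0 _)).le]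
  have := (h0 (canonLeft z.1 z.2)).ne'
  congr 1
  field_simp

theorem solvesMartingaleProblem_doobMeasure [IsProbabilityMeasure P] (hr : 𝔉.IsRightContinuous)
    (hP : ∀ᵐ ω ∂P, IsPureJump ω.1) (hX : ∀ t, Measurable[𝔉 t] (canon t : PathSpace Γ → Γ))
    (hC : CompensationFormula L 𝔉 P fun _ => 1) (hE : MeasurableSet (A ∪ B))
    (hτ : ∀ᵐ ω ∂P, hitTime A B ω ≠ ⊤) (hh : IsBVPSolution L A B ε h) (hε : 0 < ε)
    (hI : ∀ y, h y ∈ Icc ε 1) (hx : ∀ᵐ ω ∂P, ω.1 0 = x) :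
    SolvesMartingaleProblem (doobMeasure A B h x P) (doobKernelThenRef L A B h)
      (Measure.dirac x) := by
  have := isProbabilityMeasure_doobMeasure hP hX hC hE hτ hh hε hI hx
  have hac : doobMeasure A B h x P ≪ P := withDensity_absolutelyContinuous _ _
  exact solvesMartingaleProblem_of_compensation (map_canon_zero_eq_dirac (hac.ae_le hx)) hr
    (hac.ae_le hP) hX (measurable_doobRatio hX hE hh.measurable 1)
    (ENNReal.add_ne_top.2 ⟨ENNReal.ofReal_ne_top, ENNReal.one_ne_top⟩) (doobRatio_le hε hI le_rfl)
    (fun ω hω => (ae_doobKernel_eq L hω).mono fun s hs h0 => (hs h0).2)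
    (compensation_doobMeasure hP hX hC hE hτ hh hε hI x)

theorem solvesMartingaleProblem_map_stopPath [IsProbabilityMeasure P] (hr : 𝔉.IsRightContinuous)
    (hP : ∀ᵐ ω ∂P, IsPureJump ω.1) (hX : ∀ t, Measurable[𝔉 t] (canon t : PathSpace Γ → Γ))
    (hC : CompensationFormula L 𝔉 P fun _ => 1) (hE : MeasurableSet (A ∪ B))
    (hτ : ∀ᵐ ω ∂P, hitTime A B ω ≠ ⊤) (hh : IsBVPSolution L A B ε h) (hε : 0 < ε)
    (hI : ∀ y, h y ∈ Icc ε 1) (hx : ∀ᵐ ω ∂P, ω.1 0 = x) :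
    SolvesMartingaleProblem ((doobMeasure A B h x P).map (stopPath A B)) (doobKernel L A B h)
      (Measure.dirac x) := by
  have := isProbabilityMeasure_doobMeasure hP hX hC hE hτ hh hε hI hx
  have hac : doobMeasure A B h x P ≪ P := withDensity_absolutelyContinuous _ _
  have hP' : ∀ᵐ ω ∂(doobMeasure A B h x P), IsPureJump ω.1 := hac.ae_le hP
  have hg : Measurable (denseStop (A ∪ B) : PathSpace Γ → PathSpace Γ) := measurable_denseStop hE
  have hX' := measurable_canon_stoppedFiltration hX hE
  rw [Measure.map_congr (hP'.mono fun ω hω => stopPath_eq_denseStop hω A B)]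
  have := Measure.isProbabilityMeasure_map (μ := doobMeasure A B h x P) hg.aemeasurable
  refine solvesMartingaleProblem_of_compensation (map_canon_zero_eq_dirac ?_)
    (isRightContinuous_stoppedFiltration hr _) ?_ hX' (measurable_doobRatio hX' hE hh.measurable 0)
    (ENNReal.add_ne_top.2 ⟨ENNReal.ofReal_ne_top, ENNReal.one_ne_top⟩) (doobRatio_le hε hI zero_le)
    (fun ω hω => (ae_doobKernel_eq L hω).mono fun s hs h0 => (hs h0).1) fun t H hH hHd =>
      compensation_map_denseStop hP' hX hE hh.measurable
        (compensation_doobMeasure hP hX hC hE hτ hh hε hI x) t hH hHd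
  · refine (ae_map_iff hg.aemeasurable (measurable_canon 0 (measurableSet_singleton x))).2 ?_
    filter_upwards [hac.ae_le hx] with ω hω
    exact (denseStop_apply_zero _ ω).trans hω
  · exact (ae_map_iff hg.aemeasurable measurableSet_isPureJump).2
      (hP'.mono fun ω hω => isPureJump_denseStop hω A B)

end DoobMartingaleProblem

/-! ### The entropic minimization problem -/

section Entropy

open InformationTheory

variable {Ω : Type*} [MeasurableSpace Ω] {P Q : Measure Ω} {g : Ω → ℝ} {ε c : ℝ}

/-- The Gibbs variational identity. -/
theorem lintegral_neg_log_add_klDiv [IsProbabilityMeasure P] [IsProbabilityMeasure Q]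
    (hg : AEMeasurable g P) (hε : 0 < ε) (hgI : ∀ ω, g ω ∈ Icc ε 1) (hc0 : 0 < c) (hc1 : c ≤ 1)
    (hp : IsProbabilityMeasure (P.withDensity fun ω => ENNReal.ofReal (g ω / c))) :
    (∫⁻ ω, ENNReal.ofReal (-Real.log (g ω)) ∂Q) + klDiv Q P =
      ENNReal.ofReal (-Real.log c) +
        klDiv Q (P.withDensity fun ω => ENNReal.ofReal (g ω / c)) := by
  have hg0 : ∀ ω, 0 < g ω := fun ω => hε.trans_le (hgI ω).1
  have hgi : Integrable g P := Integrable.of_mem_Icc ε 1 hg (ae_of_all _ hgI)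
  have hexp : (fun ω => Real.exp (Real.log (g ω))) = g := funext fun ω => Real.exp_log (hg0 ω)
  have hint : ∫ ω, Real.exp (Real.log (g ω)) ∂P = c := by
    rw [hexp]
    have h1 := hp.measure_univ
    rw [withDensity_apply _ MeasurableSet.univ, setLIntegral_univ,
      ← ofReal_integral_eq_lintegral_ofReal (hgi.div_const c)
        (ae_of_all _ fun ω => (div_pos (hg0 ω) hc0).le), integral_div, ENNReal.ofReal_eq_one] at h1
    field_simp at h1
    exact h1
  -- The total mass one of the weighted measure identifies c as the mean of g, so the density is the
  -- exponential tilt by log g.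
  have htilt : (P.withDensity fun ω => ENNReal.ofReal (g ω / c)) =
      P.tilted fun ω => Real.log (g ω) := by
    rw [Measure.tilted, hint]
    simp only [Real.exp_log (hg0 _)]
  have hexpi : Integrable (fun ω => Real.exp (Real.log (g ω))) P := by rwa [hexp]
  rw [htilt]
  by_cases hac : Q ≪ P
  · have hac' : Q ≪ P.tilted fun ω => Real.log (g ω) :=
      hac.trans (absolutelyContinuous_tilted hexpi)
    have hlogm : AEMeasurable (fun ω => Real.log (g ω)) Q :=
      Real.measurable_log.comp_aemeasurable (hg.mono_ac hac)
    have hlog : Integrable (fun ω => Real.log (g ω)) Q :=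
      Integrable.of_mem_Icc (Real.log ε) 0 hlogm (ae_of_all _ fun ω =>
        ⟨Real.log_le_log hε (hgI ω).1, Real.log_nonpos (hg0 ω).le (hgI ω).2⟩)
    have hneg : ∀ ω, 0 ≤ -Real.log (g ω) := fun ω =>
      neg_nonneg.2 (Real.log_nonpos (hg0 ω).le (hgI ω).2)
    by_cases hi : Integrable (llr Q P) Q
    · have hi' := integrable_llr_tilted_right hac hlog hi hexpi
      have hprob : IsProbabilityMeasure (P.tilted fun ω => Real.log (g ω)) := htilt ▸ hp
      rw [klDiv_of_ac_of_integrable hac hi, klDiv_of_ac_of_integrable hac' hi',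
        integral_llr_tilted_right hac hlog hexpi hi, hint]
      have h1 := integral_llr_add_sub_measure_univ_nonneg hac hi
      have h2 := integral_llr_add_sub_measure_univ_nonneg hac' hi'
      rw [integral_llr_tilted_right hac hlog hexpi hi, hint] at h2
      simp only [probReal_univ, add_sub_cancel_right] at h1 h2 ⊢
      have hlogneg : Integrable (fun ω => -Real.log (g ω)) Q := hlog.neg
      rw [← ofReal_integral_eq_lintegral_ofReal hlogneg (ae_of_all _ hneg),
        ← ENNReal.ofReal_add (integral_nonneg hneg) h1,
        ← ENNReal.ofReal_add (neg_nonneg.2 (Real.log_nonpos hc0.le hc1)) h2, integral_neg]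
      congr 1
      ring
    -- The two log-likelihood ratios differ by log g and a constant, both bounded; hence the
    -- divergences are infinite together.
    · have hi' : ¬ Integrable (llr Q (P.tilted fun ω => Real.log (g ω))) Q := by
        intro h
        rw [integrable_congr (llr_tilted_right hac hexpi)] at h
        refine hi ((h.sub (hlog.neg.add
          (integrable_const (Real.log (∫ ω, Real.exp (Real.log (g ω)) ∂P))))).congr (ae_of_all _ fun ω => ?_))
        exact add_sub_cancel_left _ _
      rw [klDiv_of_not_integrable hi, klDiv_of_not_integrable hi', add_top, add_top]
  · have hac' : ¬ Q ≪ P.tilted fun ω => Real.log (g ω) := fun h =>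
      hac (h.trans (tilted_absolutelyContinuous _ _))
    rw [klDiv_of_not_ac hac, klDiv_of_not_ac hac', add_top, add_top]

/-- The divergence is nonnegative and vanishes only for equal measures; finiteness of v is what
permits cancelling it. -/
theorem isUniqueMinimizer_of_eq_add_klDiv {J : Measure Ω → ℝ≥0∞} [IsProbabilityMeasure P]
    {v : ℝ≥0∞} (hv : v ≠ ∞) (h : ∀ Q : Measure Ω, IsProbabilityMeasure Q → J Q = v + klDiv Q P) :
    IsUniqueMinimizer J P := by
  have hP : J P = v := by rw [h P inferInstance, klDiv_self, add_zero]
  refine ⟨inferInstance, fun Q hQ => ?_, fun Q hQ hle => ?_⟩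
  · rw [hP, h Q hQ]
    exact le_self_add
  · rw [hP, h Q hQ] at hle
    have h1 : v + klDiv Q P ≤ v + 0 := by simpa using hle
    have h2 := (ENNReal.add_le_add_iff_left hv).1 h1
    exact klDiv_eq_zero_iff.1 (le_antisymm h2 zero_le)

end Entropy

/-! ### Disintegration along the hitting point -/

section Disintegration

variable {Ω Γ : Type*} [MeasurableSpace Ω] [MeasurableSpace Γ] {P : Measure Ω} {Y : Ω → Γ}
  {κ : Kernel Γ Ω} {w : Γ → ℝ≥0∞}

/-- A density that depends on `Y` only changes the law of `Y`, but not the conditional law. -/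
theorem withDensity_comp_eq_bind [IsFiniteMeasure P] (hY : AEMeasurable Y P)
    (hκ : IsConditionalLaw P Y κ) (hw : Measurable w) :
    P.withDensity (fun ω => w (Y ω)) = ((P.map Y).withDensity w).bind κ := by
  have := hκ.1
  refine Measure.ext fun S hS => ?_
  have hF : Measurable fun z : Γ × Ω => w z.1 * S.indicator 1 z.2 :=
    (hw.comp measurable_fst).mul ((measurable_one.indicator hS).comp measurable_snd)
  have hκS : Measurable fun η => κ η S := κ.measurable_coe hS
  rw [withDensity_apply _ hS, Measure.bind_apply hS κ.aemeasurable,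
    lintegral_withDensity_eq_lintegral_mul _ hw hκS]
  calc ∫⁻ ω in S, w (Y ω) ∂P = ∫⁻ ω, w (Y ω) * S.indicator 1 ω ∂P := by
        rw [← lintegral_indicator hS]
        refine lintegral_congr fun ω => ?_
        by_cases hω : ω ∈ S <;> simp [hω]
    _ = ∫⁻ z, w z.1 * S.indicator 1 z.2 ∂(P.map fun ω => (Y ω, ω)) :=
        (lintegral_map' hF.aemeasurable (hY.prodMk aemeasurable_id)).symm
    _ = ∫⁻ η, ∫⁻ ω, w η * S.indicator 1 ω ∂(κ η) ∂(P.map Y) := by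
        rw [hκ.2, Measure.lintegral_compProd hF]
    _ = ∫⁻ η, (w * fun η => κ η S) η ∂(P.map Y) := by
        refine lintegral_congr fun η => ?_
        rw [lintegral_const_mul _ (measurable_one.indicator hS), lintegral_indicator_one hS]
        rfl

end Disintegration

end JumpControl

end

theorem proposition4p4 {Γ : Type*} [TopologicalSpace Γ] [PolishSpace Γ] [MeasurableSpace Γ]
    [BorelSpace Γ] (L : Kernel Γ Γ) [IsFiniteKernel L] (A B : Set Γ)
    (hA : MeasurableSet A) (hB : MeasurableSet B) (hA0 : A.Nonempty) (hB0 : B.Nonempty)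
    (hAB : Disjoint A B) (n : ℕ) (hn : 1 ≤ n) (h : Γ → ℝ)
    (hh : JumpControl.IsUniqueBVPSolution L A B (Real.exp (-(n : ℝ))) h) (x : Γ)
    (Rx : Measure (JumpControl.PathSpace Γ))
    (hR : JumpControl.SolvesMartingaleProblem Rx (JumpControl.refKernel L) (Measure.dirac x)) :
    -- `e^{-n} ≤ h ≤ 1` and the hitting time is almost surely finite
    (∀ y, Real.exp (-(n : ℝ)) ≤ h y ∧ h y ≤ 1) ∧
    (∀ᵐ ω ∂ Rx, JumpControl.hitTime A B ω ≠ ⊤) ∧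
    -- (i) unique minimizer, and its disintegration along the hitting point
    JumpControl.IsUniqueMinimizer
      (JumpControl.pathCost A B (JumpControl.termCost h) Rx)
      (JumpControl.doobMeasure A B h x Rx) ∧
    (∀ κ : Kernel Γ (JumpControl.PathSpace Γ),
      JumpControl.IsConditionalLaw Rx (JumpControl.hitValue A B) κ →
      JumpControl.doobMeasure A B h x Rx =
        ((Rx.map (JumpControl.hitValue A B)).withDensity
          (fun η => ENNReal.ofReal (h η / h x))).bind κ) ∧
    -- (ii) value function
    JumpControl.valueFunction A B (JumpControl.termCost h) Rx = ENNReal.ofReal (-Real.log (h x)) ∧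
    -- (iii) martingale problems, for the process stopped at the hitting time and for all time
    JumpControl.SolvesMartingaleProblem
      ((JumpControl.doobMeasure A B h x Rx).map (JumpControl.stopPath A B))
      (JumpControl.doobKernel L A B h) (Measure.dirac x) ∧
    JumpControl.SolvesMartingaleProblem
      (JumpControl.doobMeasure A B h x Rx)
      (JumpControl.doobKernelThenRef L A B h) (Measure.dirac x) := by
  have hE := hA.union hB
  have hε : 0 < Real.exp (-(n : ℝ)) := Real.exp_pos _
  have hε1 : Real.exp (-(n : ℝ)) ≤ 1 := Real.exp_le_one_iff.2 (by simp)
  have hI := hh.mem_Icc hA hB hAB hε1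
  obtain ⟨hprob, h0, hP, 𝔉, hr, hX, -, hM⟩ := hR
  have hx := JumpControl.ae_apply_zero_eq h0
  have hC := JumpControl.compensationFormula_of_martingale hP hX hM
  obtain ⟨l, hl0, hl⟩ := JumpControl.exists_rate_bound L
  obtain ⟨w, hw, hw1, hwb, hw0, hmono, hT, hlim⟩ := hh.exists_killed_iterates hA hB hl0 hl
  have hτ := JumpControl.ae_hitTime_ne_top hP hX hC hE hx hl0 hl hw hw1 hwb hw0 hmono hT (hlim x)
  have hY := JumpControl.aemeasurable_hitValue hP hτ hE
  have hD : IsProbabilityMeasure (JumpControl.doobMeasure A B h x Rx) :=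
    JumpControl.isProbabilityMeasure_doobMeasure hP hX hC hE hτ hh.1 hε hI hx
  -- The Gibbs identity with g = h(X_τ) and normalizing constant c = h(x); the minimizer and the
  -- value both come from it.
  have hJ : ∀ Q : Measure (JumpControl.PathSpace Γ), IsProbabilityMeasure Q →
      JumpControl.pathCost A B (JumpControl.termCost h) Rx Q = ENNReal.ofReal (-Real.log (h x)) +
        InformationTheory.klDiv Q (JumpControl.doobMeasure A B h x Rx) := fun Q hQ =>
    JumpControl.lintegral_neg_log_add_klDiv (hh.1.measurable.comp_aemeasurable hY) hε
      (fun ω => hI _) (hε.trans_le (hI x).1) (hI x).2 hD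
  have hmin := JumpControl.isUniqueMinimizer_of_eq_add_klDiv ENNReal.ofReal_ne_top hJ
  refine ⟨hI, hτ, hmin, fun κ hκ => ?_, ?_, ?_, ?_⟩
  · exact JumpControl.withDensity_comp_eq_bind (w := fun η => ENNReal.ofReal (h η / h x)) hY hκ
      (ENNReal.measurable_ofReal.comp (hh.1.measurable.div_const _))
  · refine le_antisymm ?_ (le_iInf fun Q => ?_)
    · refine (iInf_le _ ⟨_, hD⟩).trans (le_of_eq ?_)
      change JumpControl.pathCost A B (JumpControl.termCost h) Rx
        (JumpControl.doobMeasure A B h x Rx) = _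
      rw [hJ _ hD, InformationTheory.klDiv_self, add_zero]
    · exact le_self_add.trans (hJ Q Q.2).ge
  · exact JumpControl.solvesMartingaleProblem_map_stopPath hr hP hX hC hE hτ hh.1 hε hI hx
  · exact JumpControl.solvesMartingaleProblem_doobMeasure hr hP hX hC hE hτ hh.1 hε hI hx
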